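/- **Setting.** Let $(A,\Delta,\varepsilon,S)$ be a Hopf algebra over $\mathbb C$ with bijective antipode, and let $(\Gamma,\mathrm d)$ be a bicovariant first order differential calculus over $A$: $\Gamma$ is an $A$-bimodule, $\mathrm d:A\to\Gamma$ is linear with $\mathrm d(xy)=(\mathrm dx)y+x\,\mathrm dy$, $\Gamma$ is spanned by the elements $x\,\mathrm dy$, and there are a left coaction $\Delta_\Gamma:\Gamma\to A\otimes\Gamma$ and a right coaction ${}_\Gamma\Delta:\Gamma\to\Gamma\otimes A$ of $A$ with $\Delta_\Gamma(x\,\mathrm dy)=\Delta(x)(\mathrm{id}\otimes\mathrm d)\Delta(y)$ and ${}_\Gamma\Delta(x\,\mathrm dy)=\Delta(x)(\mathrm d\otimes\mathrm{id})\Delta(y)$. Let the space of left invariant forms $\{\omega:\Delta_\Gamma\omega=1\otimes\omega\}$ have finite dimension $N$ and basis $\omega_1,\dots,\omega_N$. The dual $A'$ carries the product $(fg)(x)=f(x_{(1)})g(x_{(2)})$ and acts on $A$ by $f\triangleright x=x_{(1)}f(x_{(2)})$. Repeated indices are summed over $1,\dots,N$, and $\otimes$ between elements of $\Gamma$ is $\otimes_A$.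 **Components.** There are unique $f_{ij},X_i\in A'$, $J_{ij}\in A$, $\sigma:\Gamma\otimes_A\Gamma\to\Gamma\otimes_A\Gamma$ and $\sigma^{kl}_{ij}\in\mathbb C$ such that: $\omega_ix=(f_{ij}\triangleright x)\omega_j$ for $x\in A$; ${}_\Gamma\Delta(\omega_i)=\omega_j\otimes J_{ji}$; $X_i(1)=0$, $X_i$ vanishes on $R_\Gamma=\{x\in\ker\varepsilon: S(x_{(1)})\,\mathrm dx_{(2)}=0\}$, and $\langle X_i,\omega_j\rangle=\delta_{ij}$ for a linear functional $\langle X_i,\cdot\rangle$ on $\Gamma$ with $\langle X_i,x\,\mathrm dy\rangle=\varepsilon(x)X_i(y)$; $\sigma$ is a bimodule map with $\sigma(\omega\otimes\eta)=\eta\otimes\omega$ for $\omega$ left invariant and $\eta$ right invariant; and $\sigma(\omega_i\otimes\omega_j)=\sigma^{kl}_{ij}\,\omega_k\otimes\omega_l$. Put $C_{ij}^k=X_j(J_{ik})$, and let $\mathcal U\subset A'$ be the subalgebra generated by all $X_i,f_{jk}$. In $\mathcal U$ one has $$X_iX_j-\sigma^{ij}_{kl}X_kX_l=C_{ij}^kX_k,\qquad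 \sigma^{ij}_{nm}f_{ip}f_{jq}=f_{ni}f_{mj}\sigma^{pq}_{ij},$$ $$C^i_{mn}f_{mj}f_{nk}+f_{ij}X_k=\sigma^{jk}_{pq}X_pf_{iq}+C^l_{jk}f_{il},\qquad X_kf_{nl}=\sigma^{kl}_{ij}f_{ni}X_j .$$ The calculus is *$S$-compatible* if $f_{ij}\circ S\in\mathcal U$ for all $i,j$. **Quantum Cartan algebra.** $\mathfrak C_\Gamma$ is the $\mathbb Z_2$-graded algebra generated by even $X_i,f_{jk}$ and odd $\xi_i,\delta$, subject to all the relations that hold among the $X_i,f_{jk}$ in $\mathcal U$ and to $$a_{ij}\,\xi_i\xi_j=0\ \text{ whenever } a_{ij}\,\sigma^{ij}_{kl}=a_{kl}\text{ for all }k,l,\qquad \xi_i\delta+\delta\xi_i=X_i,\qquad \delta^2=0,$$ $$\xi_if_{kj}=\sigma^{ij}_{nm}f_{kn}\xi_m,\qquad \xi_iX_j-\sigma^{ij}_{kl}X_k\xi_l=C_{ij}^k\xi_k,\qquad f_{ij}\delta=\delta f_{ij},\qquad X_i\delta=\delta X_i .$$ **Exterior algebra.** Let $\Gamma^\wedge=\Gamma^\otimes/\langle\ker(\mathrm{id}-\sigma)\rangle$,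 where $\Gamma^\otimes$ is the tensor algebra of the bimodule $\Gamma$ over $A$. **Theorem.** Let $(\Gamma,\mathrm d)$ be $S$-compatible. 1. $\mathfrak C_\Gamma$ has a unique $\mathbb Z_2$-graded Hopf algebra structure with $$\Delta X_i=1\otimes X_i+X_j\otimes f_{ji},\quad \Delta f_{ij}=f_{ik}\otimes f_{kj},\quad \Delta\xi_i=1\otimes\xi_i+\xi_j\otimes f_{ji},\quad \Delta\delta=1\otimes\delta+\delta\otimes1,$$ $$\varepsilon(X_i)=\varepsilon(\xi_i)=\varepsilon(\delta)=0,\qquad \varepsilon(f_{ij})=\delta_{ij},$$ $$S(f_{ij})=f_{ij}\circ S\in\mathcal U,\quad S(X_i)=-X_jS(f_{ji}),\quad S(\xi_i)=-\xi_jS(f_{ji}),\quad S(\delta)=-\delta .$$ 2. Suppose that $\mathrm d$ extends to $\Gamma^\wedge$, that is, that there is a graded derivation $\mathrm d$ of degree one of $\Gamma^\wedge$ with $\mathrm d^2=0$ which extends $\mathrm d:A\to\Gamma$. Then this extension is unique. There are a unique linear map ${}_\Gamma\Delta:\Gamma^\wedge\to\Gamma^\wedge\otimes A$ that extends $\Delta$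 and satisfies ${}_\Gamma\Delta(x\,\mathrm d\alpha)=\Delta(x)(\mathrm d\otimes\mathrm{id})\,{}_\Gamma\Delta(\alpha)$ for $x\in A$, $\alpha\in\Gamma^\wedge$, and, with $h\triangleright\alpha=(\mathrm{id}\otimes h)\,{}_\Gamma\Delta(\alpha)$ for $h\in A'$, unique linear maps $i_1,\dots,i_N$ of degree $-1$ on $\Gamma^\wedge$ (the left inner derivatives) with $i_k|_A=0$, $i_k(\omega_j)=\delta_{kj}$ and $$i_k(\alpha\wedge\beta)=(-1)^{|\alpha|}\alpha\wedge i_k(\beta)+i_j(\alpha)\wedge(f_{jk}\triangleright\beta).$$ There is a unique algebra homomorphism $\lambda:\mathfrak C_\Gamma\to\mathrm{End}(\Gamma^\wedge)$, $x\mapsto\lambda_x$, with $$\lambda_{X_j}=X_j\triangleright\ (\text{the left Lie derivative}),\qquad \lambda_{f_{jk}}=f_{jk}\triangleright,\qquad \lambda_{\xi_j}=i_j,\qquad \lambda_\delta=\mathrm d .$$ It preserves the $\mathbb Z_2$-degree and makes $\Gamma^\wedge$ a left $\mathfrak C_\Gamma$-(Hopf) module algebra: for all $x\in\mathfrak C_\Gamma$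 and all $\alpha,\beta\in\Gamma^\wedge$ with $\alpha$ homogeneous, $$\lambda_x(\alpha\wedge\beta)=(-1)^{|x_{(2)}||\alpha|}\,\lambda_{x_{(1)}}(\alpha)\wedge\lambda_{x_{(2)}}(\beta),\qquad \lambda_x(1)=\varepsilon(x)1 .$$ -/

import Mathlib

open scoped TensorProduct DirectSum BigOperators
open MulOpposite (op)

namespace QCartan

noncomputable section

/-! ### Super (`ℤ/2`-graded) algebras, Hopf algebras and module algebras over `ℂ` -/

section Super

variable {B : Type*} [Ring B] [Algebra ℂ B]

/-- The `ℤ/2`-grading defined by a parity automorphism `γ`: the elements of degree `i` are those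
with `γ x = (-1)^i x`. -/
def parityGrading (γ : B →ₐ[ℂ] B) (i : ZMod 2) : Submodule ℂ B :=
  LinearMap.ker (γ.toLinearMap - ((-1 : ℂ) ^ i.val) • LinearMap.id)

theorem mem_parityGrading {γ : B →ₐ[ℂ] B} {i : ZMod 2} {x : B} :
    x ∈ parityGrading γ i ↔ γ x = ((-1 : ℂ) ^ i.val) • x := by
  simp [parityGrading, sub_eq_zero]

theorem mem_parityGrading_zero {γ : B →ₐ[ℂ] B} {x : B} :
    x ∈ parityGrading γ 0 ↔ γ x = x := by
  simp [mem_parityGrading]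

theorem mem_parityGrading_one {γ : B →ₐ[ℂ] B} {x : B} :
    x ∈ parityGrading γ 1 ↔ γ x = -x := by
  have h : (1 : ZMod 2).val = 1 := rfl
  simp [mem_parityGrading, h]

theorem parityGrading_gradedMonoid (γ : B →ₐ[ℂ] B) : SetLike.GradedMonoid (parityGrading γ) where
  one_mem := by simp [mem_parityGrading_zero]
  mul_mem := by
    intro i j x y hx hy
    rw [mem_parityGrading] at *
    rw [map_mul, hx, hy, smul_mul_smul_comm, ← pow_add, ZMod.val_add,
      ← neg_one_pow_eq_pow_mod_two]

/-- The even part of an element. -/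
def evenPart (γ : B →ₐ[ℂ] B) (hγ : ∀ x, γ (γ x) = x) : B →ₗ[ℂ] parityGrading γ 0 :=
  LinearMap.codRestrict (parityGrading γ 0) ((1 / 2 : ℂ) • (LinearMap.id + γ.toLinearMap))
    (fun x => by rw [mem_parityGrading_zero]; simp [hγ, add_comm])

/-- The odd part of an element. -/
def oddPart (γ : B →ₐ[ℂ] B) (hγ : ∀ x, γ (γ x) = x) : B →ₗ[ℂ] parityGrading γ 1 :=
  LinearMap.codRestrict (parityGrading γ 1) ((1 / 2 : ℂ) • (LinearMap.id - γ.toLinearMap))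
    (fun x => by rw [mem_parityGrading_one]; simp [hγ, ← smul_neg])

/-- The decomposition of an element into its even part and its odd part. -/
@[reducible]
def parityDecomposition (γ : B →ₐ[ℂ] B) (hγ : ∀ x, γ (γ x) = x) :
    DirectSum.Decomposition (parityGrading γ) :=
  DirectSum.Decomposition.ofLinearMap (parityGrading γ)
    (DirectSum.lof ℂ (ZMod 2) (fun i => parityGrading γ i) 0 ∘ₗ evenPart γ hγ +
      DirectSum.lof ℂ (ZMod 2) (fun i => parityGrading γ i) 1 ∘ₗ oddPart γ hγ)
    (by
      ext x
      simp only [LinearMap.comp_apply, LinearMap.add_apply, map_add]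
      erw [DirectSum.coeLinearMap_lof, DirectSum.coeLinearMap_lof]
      simp only [evenPart, oddPart, LinearMap.codRestrict_apply, LinearMap.smul_apply,
        LinearMap.add_apply, LinearMap.sub_apply, LinearMap.id_apply, AlgHom.toLinearMap_apply]
      module)
    (by
      ext i x : 2
      obtain ⟨x, hx⟩ := x
      simp only [LinearMap.comp_apply, LinearMap.add_apply, LinearMap.id_apply]
      erw [DirectSum.coeLinearMap_lof]
      fin_cases i
      · have hx' := mem_parityGrading_zero.1 hx
        have h0 : evenPart γ hγ x = ⟨x, hx⟩ := by
          apply Subtype.ext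
          simp only [evenPart, LinearMap.codRestrict_apply, LinearMap.smul_apply,
            LinearMap.add_apply, LinearMap.id_apply, AlgHom.toLinearMap_apply, hx']
          module
        have h1 : oddPart γ hγ x = 0 := by
          apply Subtype.ext; simp [oddPart, hx']
        erw [h0, h1, map_zero, add_zero]
        rfl
      · have hx' := mem_parityGrading_one.1 hx
        have h0 : evenPart γ hγ x = 0 := by
          apply Subtype.ext; simp [evenPart, hx']
        have h1 : oddPart γ hγ x = ⟨x, hx⟩ := by
          apply Subtype.ext
          simp only [oddPart, LinearMap.codRestrict_apply, LinearMap.smul_apply,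
            LinearMap.sub_apply, LinearMap.id_apply, AlgHom.toLinearMap_apply, hx']
          module
        erw [h0, h1, map_zero, zero_add]
        rfl)

/-- A parity automorphism with `γ² = 1` makes the algebra a `ℤ/2`-graded algebra. -/
@[reducible]
def parityGradedAlgebra (γ : B →ₐ[ℂ] B) (hγ : ∀ x, γ (γ x) = x) :
    GradedAlgebra (parityGrading γ) :=
  { parityGrading_gradedMonoid γ, parityDecomposition γ hγ with }

/-- A `ℤ/2`-graded Hopf algebra structure on a `ℤ/2`-graded algebra `B`. The coproduct is an
algebra homomorphism into the graded tensor product, in which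
`(a₁ ⊗ a₂)(b₁ ⊗ b₂) = (-1)^(|a₂||b₁|) a₁b₁ ⊗ a₂b₂`. -/
structure SuperHopf (𝒜 : ZMod 2 → Submodule ℂ B) [GradedAlgebra 𝒜] where
  /-- the coproduct, as a homomorphism of algebras -/
  comulHom : B →ₐ[ℂ] GradedTensorProduct ℂ 𝒜 𝒜
  /-- the counit -/
  counit : B →ₐ[ℂ] ℂ
  /-- the antipode -/
  antipode : B →ₗ[ℂ] B
  coassoc :
    let Δ : B →ₗ[ℂ] B ⊗[ℂ] B := (GradedTensorProduct.of ℂ 𝒜 𝒜).symm.toLinearMap ∘ₗ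
      comulHom.toLinearMap
    (TensorProduct.assoc ℂ B B B).toLinearMap ∘ₗ Δ.rTensor B ∘ₗ Δ = Δ.lTensor B ∘ₗ Δ
  counit_left : ∀ x, TensorProduct.lid ℂ B (counit.toLinearMap.rTensor B
    ((GradedTensorProduct.of ℂ 𝒜 𝒜).symm (comulHom x))) = x
  counit_right : ∀ x, TensorProduct.rid ℂ B (counit.toLinearMap.lTensor B
    ((GradedTensorProduct.of ℂ 𝒜 𝒜).symm (comulHom x))) = x
  antipode_left : ∀ x, LinearMap.mul' ℂ B (antipode.rTensor B
    ((GradedTensorProduct.of ℂ 𝒜 𝒜).symm (comulHom x))) = algebraMap ℂ B (counit x)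
  antipode_right : ∀ x, LinearMap.mul' ℂ B (antipode.lTensor B
    ((GradedTensorProduct.of ℂ 𝒜 𝒜).symm (comulHom x))) = algebraMap ℂ B (counit x)
  comul_mem : ∀ i, ∀ x ∈ 𝒜 i, (GradedTensorProduct.of ℂ 𝒜 𝒜).symm (comulHom x) ∈
    ⨆ j, LinearMap.range (TensorProduct.map (𝒜 j).subtype (𝒜 (i - j)).subtype)
  counit_odd : ∀ x ∈ 𝒜 1, counit x = 0
  antipode_mem : ∀ i, ∀ x ∈ 𝒜 i, antipode x ∈ 𝒜 i

/-- The coproduct of a `ℤ/2`-graded Hopf algebra with values in the plain tensor product. -/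
def SuperHopf.comul {𝒜 : ZMod 2 → Submodule ℂ B} [GradedAlgebra 𝒜] (H : SuperHopf 𝒜) :
    B →ₗ[ℂ] B ⊗[ℂ] B :=
  (GradedTensorProduct.of ℂ 𝒜 𝒜).symm.toLinearMap ∘ₗ H.comulHom.toLinearMap

/-- The map `b ↦ (-1)^(n|b|) b`, the sign of moving `b` past an element of degree `n`. -/
def koszulSign (𝒜 : ZMod 2 → Submodule ℂ B) [GradedAlgebra 𝒜] (n : ℕ) : B →ₗ[ℂ] B :=
  ∑ i : ZMod 2, ((-1 : ℂ) ^ (n * i.val)) • GradedAlgebra.proj 𝒜 i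

variable {E : Type*} [Ring E] [Algebra ℂ E]

/-- The part of parity `j` of an algebra `E` whose part of degree `n` is `F n`. -/
def parityPart (F : ℕ → Submodule ℂ E) (j : ZMod 2) : Submodule ℂ E :=
  ⨆ (n : ℕ) (_ : (n : ZMod 2) = j), F n

/-- The representation `lam` of the `ℤ/2`-graded Hopf algebra `B` makes `E`, whose part of degree
`n` is `F n`, a left module algebra: `lam` is even,
`lam_x (αβ) = (-1)^(|x₂||α|) lam_{x₁}(α) lam_{x₂}(β)` and `lam_x 1 = ε(x) 1`. -/
structure IsModuleAlgebra {𝒜 : ZMod 2 → Submodule ℂ B} [GradedAlgebra 𝒜] (H : SuperHopf 𝒜)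
    (F : ℕ → Submodule ℂ E) (lam : B →ₐ[ℂ] Module.End ℂ E) : Prop where
  even : ∀ i, ∀ x ∈ 𝒜 i, ∀ j, ∀ α ∈ parityPart F j, lam x α ∈ parityPart F (i + j)
  map_mul : ∀ (x : B) (n : ℕ), ∀ α ∈ F n, ∀ β : E,
    lam x (α * β) = LinearMap.mul' ℂ E (TensorProduct.map
      (LinearMap.applyₗ α ∘ₗ lam.toLinearMap)
      (LinearMap.applyₗ β ∘ₗ lam.toLinearMap ∘ₗ koszulSign 𝒜 n) (H.comul x))
  map_one : ∀ x : B, lam x 1 = H.counit x • (1 : E)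

end Super

/-! ### Functionals on a Hopf algebra -/

section Functionals

variable (A : Type*) [Ring A] [HopfAlgebra ℂ A]

/-- The dual `A'`, with the convolution product `(fg)(x) = f(x₁) g(x₂)`. -/
abbrev DualAlg := WithConv (A →ₗ[ℂ] ℂ)

variable {A}

/-- The transposed antipode `h ↦ h ∘ S`. -/
def dualAntipode (h : DualAlg A) : DualAlg A :=
  WithConv.toConv (h.ofConv ∘ₗ HopfAlgebra.antipode ℂ)

/-- The left action `h ▷ x = x₁ h(x₂)` of functionals on `A`. -/
def leftAct (h : DualAlg A) : A →ₗ[ℂ] A :=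
  (TensorProduct.rid ℂ A).toLinearMap ∘ₗ h.ofConv.lTensor A ∘ₗ Coalgebra.comul

end Functionals

/-! ### Bicovariant first order differential calculi -/

section Calculus

variable (A : Type*) [Ring A] [HopfAlgebra ℂ A]
variable (Γ : Type*) [AddCommGroup Γ] [Module ℂ Γ] [Module A Γ] [Module Aᵐᵒᵖ Γ]
  [SMulCommClass A Aᵐᵒᵖ Γ] [IsScalarTower ℂ A Γ] [IsScalarTower ℂ Aᵐᵒᵖ Γ]

/-- The action of `A ⊗ A` on `A ⊗ Γ` by left multiplication in both factors. -/
def mulLeftTensor : A ⊗[ℂ] A →ₗ[ℂ] A ⊗[ℂ] Γ →ₗ[ℂ] A ⊗[ℂ] Γ :=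
  TensorProduct.map₂ (LinearMap.mul ℂ A) (Algebra.lsmul ℂ ℂ Γ).toLinearMap

/-- The action of `A ⊗ A` on `Γ ⊗ A` by left multiplication in both factors. -/
def mulRightTensor : A ⊗[ℂ] A →ₗ[ℂ] Γ ⊗[ℂ] A →ₗ[ℂ] Γ ⊗[ℂ] A :=
  TensorProduct.map₂ (Algebra.lsmul ℂ ℂ Γ).toLinearMap (LinearMap.mul ℂ A)

/-- A bicovariant first order differential calculus `(Γ, d)` over `A`: the `A`-bimodule `Γ` is
spanned by the `x dy`, and `Γ` has a left and a right coaction of `A` with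
`x dy ↦ Δ(x)(id ⊗ d)Δ(y)` and `x dy ↦ Δ(x)(d ⊗ id)Δ(y)`. -/
structure BicovariantCalculus where
  /-- the differential -/
  d : A →ₗ[ℂ] Γ
  leibniz : ∀ x y : A, d (x * y) = op y • d x + x • d y
  span_smul_d : Submodule.span ℂ {ρ : Γ | ∃ x y : A, ρ = x • d y} = ⊤
  /-- the left coaction -/
  coactL : Γ →ₗ[ℂ] A ⊗[ℂ] Γ
  coactL_coassoc : (TensorProduct.assoc ℂ A A Γ).toLinearMap ∘ₗ Coalgebra.comul.rTensor Γ ∘ₗ coactL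
    = coactL.lTensor A ∘ₗ coactL
  coactL_counit : ∀ ρ, TensorProduct.lid ℂ Γ (Coalgebra.counit.rTensor Γ (coactL ρ)) = ρ
  coactL_smul_d : ∀ x y : A, coactL (x • d y) =
    mulLeftTensor A Γ (Coalgebra.comul x) (d.lTensor A (Coalgebra.comul y))
  /-- the right coaction -/
  coactR : Γ →ₗ[ℂ] Γ ⊗[ℂ] A
  coactR_coassoc : (TensorProduct.assoc ℂ Γ A A).toLinearMap ∘ₗ coactR.rTensor A ∘ₗ coactR
    = Coalgebra.comul.lTensor Γ ∘ₗ coactR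
  coactR_counit : ∀ ρ, TensorProduct.rid ℂ Γ (Coalgebra.counit.lTensor Γ (coactR ρ)) = ρ
  coactR_smul_d : ∀ x y : A, coactR (x • d y) =
    mulRightTensor A Γ (Coalgebra.comul x) (d.rTensor A (Coalgebra.comul y))

/-- The relations `ρa ⊗ ρ' = ρ ⊗ aρ'`. -/
def balancedRel : Submodule ℂ (Γ ⊗[ℂ] Γ) :=
  Submodule.span ℂ {z | ∃ (a : A) (ρ ρ' : Γ), z = (op a • ρ) ⊗ₜ[ℂ] ρ' - ρ ⊗ₜ[ℂ] (a • ρ')}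

/-- The tensor product `Γ ⊗_A Γ` over the (noncommutative) algebra `A`. -/
abbrev BalancedTensor := (Γ ⊗[ℂ] Γ) ⧸ balancedRel A Γ

variable {Γ}

/-- The element `ρ ⊗_A ρ'`. -/
def btmul (ρ ρ' : Γ) : BalancedTensor A Γ := (balancedRel A Γ).mkQ (ρ ⊗ₜ[ℂ] ρ')

variable {A} (Γ)

/-- The operator `w ↦ a w b` on the `A`-bimodule `Γ ⊗_A Γ`. -/
def biAct (a b : A) : BalancedTensor A Γ →ₗ[ℂ] BalancedTensor A Γ :=
  Submodule.mapQ _ _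
    (TensorProduct.map (Algebra.lsmul ℂ ℂ Γ a) (Algebra.lsmul ℂ ℂ Γ (op b)))
    (by
      rw [balancedRel, Submodule.span_le]
      rintro _ ⟨c, ρ, ρ', rfl⟩
      refine Submodule.subset_span ⟨c, a • ρ, op b • ρ', ?_⟩
      simp [smul_comm])

variable (A)

/-- The relations, in the free algebra on the vector space `A ⊕ Γ`, of the tensor algebra of the
`A`-bimodule `Γ`. -/
inductive TensorRel : TensorAlgebra ℂ (A × Γ) → TensorAlgebra ℂ (A × Γ) → Prop
  | one : TensorRel (TensorAlgebra.ι ℂ (1, 0)) 1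
  | mul (a b : A) : TensorRel (TensorAlgebra.ι ℂ (a, 0) * TensorAlgebra.ι ℂ (b, 0))
      (TensorAlgebra.ι ℂ (a * b, 0))
  | left (a : A) (ρ : Γ) : TensorRel (TensorAlgebra.ι ℂ (a, 0) * TensorAlgebra.ι ℂ (0, ρ))
      (TensorAlgebra.ι ℂ (0, a • ρ))
  | right (a : A) (ρ : Γ) : TensorRel (TensorAlgebra.ι ℂ (0, ρ) * TensorAlgebra.ι ℂ (a, 0))
      (TensorAlgebra.ι ℂ (0, op a • ρ))

/-- The tensor algebra `Γ^⊗ = A ⊕ Γ ⊕ (Γ ⊗_A Γ) ⊕ …` of the `A`-bimodule `Γ`. -/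
def BimoduleTensorAlg := RingQuot (TensorRel A Γ)

instance : Ring (BimoduleTensorAlg A Γ) := inferInstanceAs (Ring (RingQuot (TensorRel A Γ)))
instance : Algebra ℂ (BimoduleTensorAlg A Γ) :=
  inferInstanceAs (Algebra ℂ (RingQuot (TensorRel A Γ)))

/-- The projection onto the tensor algebra of the bimodule. -/
def toTensorAlg : TensorAlgebra ℂ (A × Γ) →ₐ[ℂ] BimoduleTensorAlg A Γ :=
  RingQuot.mkAlgHom ℂ (TensorRel A Γ)

/-- The inclusion of `Γ` in its tensor algebra. -/
def tensorForm : Γ →ₗ[ℂ] BimoduleTensorAlg A Γ :=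
  (toTensorAlg A Γ).toLinearMap ∘ₗ TensorAlgebra.ι ℂ ∘ₗ LinearMap.inr ℂ A Γ

/-- The inclusion of `A` in the tensor algebra of `Γ`. -/
def tensorScalar : A →ₗ[ℂ] BimoduleTensorAlg A Γ :=
  (toTensorAlg A Γ).toLinearMap ∘ₗ TensorAlgebra.ι ℂ ∘ₗ LinearMap.inl ℂ A Γ

/-- The canonical map from `Γ ⊗_A Γ` to the tensor algebra, `ρ ⊗ ρ' ↦ ρ ρ'`. -/
def tensorSquare : BalancedTensor A Γ →ₗ[ℂ] BimoduleTensorAlg A Γ :=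
  (balancedRel A Γ).liftQ
    (LinearMap.mul' ℂ _ ∘ₗ TensorProduct.map (tensorForm A Γ) (tensorForm A Γ))
    (by
      rw [balancedRel, Submodule.span_le]
      rintro _ ⟨a, ρ, ρ', rfl⟩
      have h1 : tensorForm A Γ (op a • ρ) = tensorForm A Γ ρ * tensorScalar A Γ a := by
        simp only [tensorForm, tensorScalar, LinearMap.comp_apply, LinearMap.inr_apply,
          LinearMap.inl_apply, AlgHom.toLinearMap_apply, ← map_mul]
        exact (RingQuot.mkAlgHom_rel ℂ (TensorRel.right a ρ)).symm
      have h2 : tensorForm A Γ (a • ρ') = tensorScalar A Γ a * tensorForm A Γ ρ' := by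
        simp only [tensorForm, tensorScalar, LinearMap.comp_apply, LinearMap.inr_apply,
          LinearMap.inl_apply, AlgHom.toLinearMap_apply, ← map_mul]
        exact (RingQuot.mkAlgHom_rel ℂ (TensorRel.left a ρ')).symm
      simp [h1, h2, mul_assoc])

variable {A Γ}

/-- The relations `w = 0` for `w ∈ ker (id - σ)`. -/
inductive ExteriorRel (σ : BalancedTensor A Γ →ₗ[ℂ] BalancedTensor A Γ) :
    BimoduleTensorAlg A Γ → BimoduleTensorAlg A Γ → Prop
  | ker (w : BalancedTensor A Γ) (hw : w ∈ LinearMap.ker (LinearMap.id - σ)) :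
      ExteriorRel σ (tensorSquare A Γ w) 0

/-- The exterior algebra `Γ^∧ = Γ^⊗ / ⟨ker (id - σ)⟩`. -/
def Ext (σ : BalancedTensor A Γ →ₗ[ℂ] BalancedTensor A Γ) := RingQuot (ExteriorRel σ)

namespace Ext

variable (σ : BalancedTensor A Γ →ₗ[ℂ] BalancedTensor A Γ)

instance : Ring (Ext σ) := inferInstanceAs (Ring (RingQuot (ExteriorRel σ)))
instance : Algebra ℂ (Ext σ) := inferInstanceAs (Algebra ℂ (RingQuot (ExteriorRel σ)))

/-- The projection of the tensor algebra onto the exterior algebra. -/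
def proj : BimoduleTensorAlg A Γ →ₐ[ℂ] Ext σ := RingQuot.mkAlgHom ℂ (ExteriorRel σ)

/-- The inclusion of `A` as the `0`-forms. -/
def scalar : A →ₗ[ℂ] Ext σ := (proj σ).toLinearMap ∘ₗ tensorScalar A Γ

/-- The inclusion of `Γ` as the `1`-forms. -/
def form : Γ →ₗ[ℂ] Ext σ := (proj σ).toLinearMap ∘ₗ tensorForm A Γ

/-- The forms of degree `n`: the span of the products `a ρ₁ ⋯ ρₙ`. -/
def degree (n : ℕ) : Submodule ℂ (Ext σ) :=
  LinearMap.range (scalar σ) * LinearMap.range (form σ) ^ n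

end Ext

namespace BicovariantCalculus

variable (G : BicovariantCalculus A Γ)

/-- The left invariant one-forms, `Δ_Γ ω = 1 ⊗ ω`. -/
def leftInvariants : Submodule ℂ Γ :=
  LinearMap.eqLocus G.coactL (TensorProduct.mk ℂ A Γ 1)

/-- The right invariant one-forms, `_ΓΔ η = η ⊗ 1`. -/
def rightInvariants : Submodule ℂ Γ :=
  LinearMap.eqLocus G.coactR ((TensorProduct.mk ℂ Γ A).flip 1)

/-- The linear map `x ↦ S(x₁) d x₂`. -/
def maurerCartan : A →ₗ[ℂ] Γ :=
  TensorProduct.lift (Algebra.lsmul ℂ ℂ Γ).toLinearMap ∘ₗ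
    TensorProduct.map (HopfAlgebra.antipode ℂ) G.d ∘ₗ Coalgebra.comul

/-- The right ideal `R_Γ ⊆ ker ε` that determines the calculus, `Γ ≃ A ⊗ (ker ε / R_Γ)`. -/
def ideal : Submodule ℂ A :=
  LinearMap.ker (Coalgebra.counit : A →ₗ[ℂ] ℂ) ⊓ LinearMap.ker G.maurerCartan

/-- The quantum tangent space: the functionals on `A` that vanish at `1` and on `R_Γ`. -/
def tangentSpace : Set (DualAlg A) :=
  {X | X.ofConv 1 = 0 ∧ ∀ x ∈ G.ideal, X.ofConv x = 0}

/-- The braiding: the morphism of bimodules `Γ ⊗_A Γ → Γ ⊗_A Γ` with `σ(ω ⊗ η) = η ⊗ ω` for `ω` left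
invariant and `η` right invariant (such a map intertwines the coactions). -/
structure IsBraiding (σ : BalancedTensor A Γ →ₗ[ℂ] BalancedTensor A Γ) : Prop where
  bimodule : ∀ (a b : A) (w : BalancedTensor A Γ), σ (biAct Γ a b w) = biAct Γ a b (σ w)
  swap : ∀ ω ∈ G.leftInvariants, ∀ η ∈ G.rightInvariants, σ (btmul A ω η) = btmul A η ω

end BicovariantCalculus

variable (A Γ)

/-- The components of a bicovariant calculus with respect to a basis of the left invariant
one-forms. -/
structure Components (N : ℕ) where
  /-- the functionals `f_{ij}` -/
  f : Fin N → Fin N → DualAlg A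
  /-- the matrix `J_{ij}` of elements of `A` -/
  J : Fin N → Fin N → A
  /-- the basis `X_i` of the quantum tangent space -/
  X : Fin N → DualAlg A
  /-- the braiding -/
  σ : BalancedTensor A Γ →ₗ[ℂ] BalancedTensor A Γ
  /-- the components of the braiding: `s i j k l` is `σ^{ij}_{kl}`, the upper indices first -/
  s : Fin N → Fin N → Fin N → Fin N → ℂ

variable {A Γ}

/-- `D` is the family of components of the calculus `G` in the basis `ω`. -/
structure Components.IsFor {N : ℕ} (D : Components A Γ N) (G : BicovariantCalculus A Γ)
    (ω : Module.Basis (Fin N) ℂ G.leftInvariants) : Prop where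
  /-- `ω_i x = (f_{ij} ▷ x) ω_j` -/
  f_spec : ∀ i x, op x • (ω i : Γ) = ∑ j, leftAct (D.f i j) x • (ω j : Γ)
  /-- the right coaction sends `ω_i` to `ω_j ⊗ J_{ji}` -/
  J_spec : ∀ i, G.coactR (ω i : Γ) = ∑ j, (ω j : Γ) ⊗ₜ[ℂ] D.J j i
  X_mem : ∀ i, D.X i ∈ G.tangentSpace
  /-- `⟨X_i, ω_j⟩ = δ_{ij}`, where `⟨X, x dy⟩ = ε(x) X(y)` -/
  X_dual : ∀ i, ∃ p : Γ →ₗ[ℂ] ℂ,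
    (∀ x y : A, p (x • G.d y) = Coalgebra.counit (R := ℂ) x * (D.X i).ofConv y) ∧
    ∀ j, p (ω j : Γ) = if i = j then 1 else 0
  braiding : G.IsBraiding D.σ
  /-- `σ(ω_i ⊗ ω_j) = σ^{kl}_{ij} ω_k ⊗ ω_l` -/
  s_spec : ∀ i j, D.σ (btmul A (ω i : Γ) (ω j : Γ)) =
    ∑ k, ∑ l, D.s k l i j • btmul A (ω k : Γ) (ω l : Γ)

namespace Components

variable {N : ℕ} (D : Components A Γ N)

/-- The structure constants `C_{ij}^k = X_j(J_{ik})`. -/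
def C (i j k : Fin N) : ℂ := (D.X j).ofConv (D.J i k)

/-- The subalgebra of `A'` generated by the `X_i` and the `f_{jk}`. -/
def evenAlg : Subalgebra ℂ (DualAlg A) :=
  Algebra.adjoin ℂ (Set.range D.X ∪ Set.range (fun p : Fin N × Fin N => D.f p.1 p.2))

/-- The calculus is `S`-compatible: `S(f_{ij})` lies in the subalgebra generated by the `X_i` and
the `f_{jk}`. -/
def SCompatible : Prop := ∀ i j, dualAntipode (D.f i j) ∈ D.evenAlg

/-- The quadratic relations between the `X_i` and the `f_{jk}`. -/
structure QuadraticRelations : Prop where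
  X_X : ∀ i j, D.X i * D.X j - ∑ k, ∑ l, D.s i j k l • (D.X k * D.X l) = ∑ k, D.C i j k • D.X k
  f_f : ∀ n m p q, ∑ i, ∑ j, D.s i j n m • (D.f i p * D.f j q)
    = ∑ i, ∑ j, D.s p q i j • (D.f n i * D.f m j)
  f_X : ∀ i j k, ∑ m, ∑ n, D.C m n i • (D.f m j * D.f n k) + D.f i j * D.X k
    = ∑ p, ∑ q, D.s j k p q • (D.X p * D.f i q) + ∑ l, D.C j k l • D.f i l
  X_f : ∀ k n l, D.X k * D.f n l = ∑ i, ∑ j, D.s k l i j • (D.f n i * D.X j)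

end Components

/-! ### The quantum Cartan algebra -/

/-- Names for the even generators. -/
inductive EvenGen (N : ℕ)
  | X (i : Fin N)
  | f (i j : Fin N)

/-- Names for the generators. -/
inductive CartanGen (N : ℕ)
  | even (g : EvenGen N)
  | xi (i : Fin N)
  | del

namespace Components

variable {N : ℕ} (D : Components A Γ N)

/-- The value in `A'` of a noncommutative polynomial in the even generators. -/
def evenEval : FreeAlgebra ℂ (EvenGen N) →ₐ[ℂ] DualAlg A :=
  FreeAlgebra.lift ℂ fun g => match g with
    | .X i => D.X i
    | .f i j => D.f i j

/-- A noncommutative polynomial in the even generators, as one in all the generators. -/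
def evenIncl (N : ℕ) : FreeAlgebra ℂ (EvenGen N) →ₐ[ℂ] FreeAlgebra ℂ (CartanGen N) :=
  FreeAlgebra.lift ℂ fun g => FreeAlgebra.ι ℂ (CartanGen.even g)

/-- The free generator `X_i`. -/
abbrev gX (i : Fin N) : FreeAlgebra ℂ (CartanGen N) := FreeAlgebra.ι ℂ (.even (.X i))
/-- The free generator `f_{ij}`. -/
abbrev gf (i j : Fin N) : FreeAlgebra ℂ (CartanGen N) := FreeAlgebra.ι ℂ (.even (.f i j))
/-- The free generator `ξ_i`. -/
abbrev gxi (i : Fin N) : FreeAlgebra ℂ (CartanGen N) := FreeAlgebra.ι ℂ (.xi i)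
/-- The free generator `δ`. -/
abbrev gdel (N : ℕ) : FreeAlgebra ℂ (CartanGen N) := FreeAlgebra.ι ℂ .del

/-- The defining relations of the quantum Cartan algebra: the relations that hold between the even
generators in `A'`, and the relations that involve odd generators. In `xi_xi` the tensor
`∑ a_{ij} X_i ⊗ X_j` runs over `ker (id - σᵗ)`, `σᵗ(X_i ⊗ X_j) = σ^{ij}_{kl} X_k ⊗ X_l`. -/
inductive CartanRel : FreeAlgebra ℂ (CartanGen N) → FreeAlgebra ℂ (CartanGen N) → Prop
  | even (p q : FreeAlgebra ℂ (EvenGen N)) (h : D.evenEval p = D.evenEval q) :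
      CartanRel (evenIncl N p) (evenIncl N q)
  | xi_xi (a : Fin N → Fin N → ℂ) (ha : ∀ k l, ∑ i, ∑ j, a i j * D.s i j k l = a k l) :
      CartanRel (∑ i, ∑ j, a i j • (gxi i * gxi j)) 0
  | xi_del (i : Fin N) : CartanRel (gxi i * gdel N + gdel N * gxi i) (gX i)
  | del_del : CartanRel (gdel N * gdel N) 0
  | xi_f (i j k : Fin N) :
      CartanRel (gxi i * gf k j) (∑ n, ∑ m, D.s i j n m • (gf k n * gxi m))
  | xi_X (i j : Fin N) :
      CartanRel (gxi i * gX j - ∑ k, ∑ l, D.s i j k l • (gX k * gxi l)) (∑ k, D.C i j k • gxi k)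
  | f_del (i j : Fin N) : CartanRel (gf i j * gdel N) (gdel N * gf i j)
  | X_del (i : Fin N) : CartanRel (gX i * gdel N) (gdel N * gX i)

/-- The quantum Cartan algebra. -/
def CartanAlg := RingQuot D.CartanRel

instance : Ring D.CartanAlg := inferInstanceAs (Ring (RingQuot D.CartanRel))
instance : Algebra ℂ D.CartanAlg := inferInstanceAs (Algebra ℂ (RingQuot D.CartanRel))

/-- The projection from the free algebra to the quantum Cartan algebra. -/
def toCartan : FreeAlgebra ℂ (CartanGen N) →ₐ[ℂ] D.CartanAlg := RingQuot.mkAlgHom ℂ D.CartanRel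

/-- The generator `X_i`. -/
def cX (i : Fin N) : D.CartanAlg := D.toCartan (gX i)
/-- The generator `f_{ij}`. -/
def cf (i j : Fin N) : D.CartanAlg := D.toCartan (gf i j)
/-- The generator `ξ_i`. -/
def cxi (i : Fin N) : D.CartanAlg := D.toCartan (gxi i)
/-- The generator `δ`. -/
def cdel : D.CartanAlg := D.toCartan (gdel N)

/-- The sign change of the odd generators, on the free algebra. -/
def freeParity (N : ℕ) : FreeAlgebra ℂ (CartanGen N) →ₐ[ℂ] FreeAlgebra ℂ (CartanGen N) :=
  FreeAlgebra.lift ℂ fun g => match g with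
    | .even g => FreeAlgebra.ι ℂ (.even g)
    | .xi i => -FreeAlgebra.ι ℂ (.xi i)
    | .del => -FreeAlgebra.ι ℂ .del

theorem freeParity_evenIncl (p : FreeAlgebra ℂ (EvenGen N)) :
    freeParity N (evenIncl N p) = evenIncl N p := by
  have h : (freeParity N).comp (evenIncl N) = evenIncl N := by
    ext g; simp [freeParity, evenIncl]
  exact DFunLike.congr_fun h p

theorem toCartan_freeParity_rel ⦃x y : FreeAlgebra ℂ (CartanGen N)⦄ (h : D.CartanRel x y) :
    D.toCartan (freeParity N x) = D.toCartan (freeParity N y) := by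
  have key := RingQuot.mkAlgHom_rel ℂ h
  change D.toCartan x = D.toCartan y at key
  cases h with
  | even p q h => simpa only [freeParity_evenIncl] using key
  | xi_xi a ha => simpa [freeParity, gxi] using key
  | xi_del i => simpa [freeParity, gxi, gdel, gX] using key
  | del_del => simpa [freeParity, gdel] using key
  | xi_f i j k => simpa [freeParity, gxi, gf] using key
  | xi_X i j =>
    have := congrArg Neg.neg key
    simpa [freeParity, gxi, gX, sub_eq_add_neg, add_comm] using this
  | f_del i j => simpa [freeParity, gdel, gf] using key
  | X_del i => simpa [freeParity, gdel, gX] using key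

/-- The parity automorphism of the quantum Cartan algebra: it fixes the even generators `X_i`,
`f_{jk}` and changes the sign of the odd generators `ξ_i`, `δ`. -/
def parity : D.CartanAlg →ₐ[ℂ] D.CartanAlg :=
  RingQuot.liftAlgHom ℂ ⟨D.toCartan.comp (freeParity N), D.toCartan_freeParity_rel⟩

theorem parity_toCartan (y : FreeAlgebra ℂ (CartanGen N)) :
    D.parity (D.toCartan y) = D.toCartan (freeParity N y) :=
  RingQuot.liftAlgHom_mkAlgHom_apply _ _ D.toCartan_freeParity_rel y

theorem freeParity_freeParity (y : FreeAlgebra ℂ (CartanGen N)) :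
    freeParity N (freeParity N y) = y := by
  have h : (freeParity N).comp (freeParity N) = AlgHom.id ℂ _ := by
    ext g
    rcases g with g | i | _ <;> simp [freeParity]
  exact DFunLike.congr_fun h y

theorem parity_parity (x : D.CartanAlg) : D.parity (D.parity x) = x := by
  obtain ⟨y, rfl⟩ := RingQuot.mkAlgHom_surjective ℂ D.CartanRel x
  change D.parity (D.parity (D.toCartan y)) = D.toCartan y
  rw [parity_toCartan, parity_toCartan, freeParity_freeParity]

/-- The `ℤ/2`-grading of the quantum Cartan algebra, with `X_i`, `f_{jk}` even and `ξ_i`, `δ` odd. -/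
def grading : ZMod 2 → Submodule ℂ D.CartanAlg := parityGrading D.parity

instance : GradedAlgebra D.grading := parityGradedAlgebra D.parity D.parity_parity

/-- The `ℤ/2`-graded Hopf algebra structure of the quantum Cartan algebra, on generators. -/
structure IsCartanHopf (H : SuperHopf D.grading) : Prop where
  comul_X : ∀ i, H.comul (D.cX i) = 1 ⊗ₜ D.cX i + ∑ j, D.cX j ⊗ₜ D.cf j i
  comul_f : ∀ i j, H.comul (D.cf i j) = ∑ k, D.cf i k ⊗ₜ D.cf k j
  comul_xi : ∀ i, H.comul (D.cxi i) = 1 ⊗ₜ D.cxi i + ∑ j, D.cxi j ⊗ₜ D.cf j i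
  comul_del : H.comul D.cdel = 1 ⊗ₜ D.cdel + D.cdel ⊗ₜ 1
  counit_X : ∀ i, H.counit (D.cX i) = 0
  counit_f : ∀ i j, H.counit (D.cf i j) = if i = j then 1 else 0
  counit_xi : ∀ i, H.counit (D.cxi i) = 0
  counit_del : H.counit D.cdel = 0
  /-- the antipode of `f_{ij}` is the element `f_{ij} ∘ S` of the even subalgebra -/
  antipode_f : ∀ i j (q : FreeAlgebra ℂ (EvenGen N)), D.evenEval q = dualAntipode (D.f i j) →
    H.antipode (D.cf i j) = D.toCartan (evenIncl N q)
  antipode_X : ∀ i, H.antipode (D.cX i) = -∑ j, D.cX j * H.antipode (D.cf j i)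
  antipode_xi : ∀ i, H.antipode (D.cxi i) = -∑ j, D.cxi j * H.antipode (D.cf j i)
  antipode_del : H.antipode D.cdel = -D.cdel

end Components

/-! ### The left Cartan calculus on the exterior algebra -/

/-- `d` is the extension of the differential of `G` to the exterior algebra: a graded derivation of
degree one with `d² = 0`. -/
structure IsDifferential {N : ℕ} (D : Components A Γ N) (G : BicovariantCalculus A Γ)
    (d : Ext D.σ →ₗ[ℂ] Ext D.σ) : Prop where
  d_scalar : ∀ x, d (Ext.scalar D.σ x) = Ext.form D.σ (G.d x)
  d_degree : ∀ n, ∀ α ∈ Ext.degree D.σ n, d α ∈ Ext.degree D.σ (n + 1)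
  d_mul : ∀ n, ∀ α ∈ Ext.degree D.σ n, ∀ β, d (α * β) = d α * β + (-1 : ℂ) ^ n • (α * d β)
  d_d : ∀ α, d (d α) = 0

/-- Operators on the exterior algebra. -/
structure CartanOps {N : ℕ} (D : Components A Γ N) where
  /-- the right coaction of `A` -/
  coact : Ext D.σ →ₗ[ℂ] Ext D.σ ⊗[ℂ] A
  /-- the left inner derivatives -/
  inner : Fin N → Ext D.σ →ₗ[ℂ] Ext D.σ

namespace CartanOps

variable {N : ℕ} {D : Components A Γ N} (O : CartanOps D)

/-- The action `h ▷ α = α₀ h(α₁)` of functionals on forms. For `h = X_i` this is the left Lie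
derivative. -/
def act (h : DualAlg A) : Ext D.σ →ₗ[ℂ] Ext D.σ :=
  (TensorProduct.rid ℂ (Ext D.σ)).toLinearMap ∘ₗ h.ofConv.lTensor (Ext D.σ) ∘ₗ O.coact

/-- `O` consists of the right coaction and the left inner derivatives of the exterior algebra of
`G` with differential `d`. -/
structure IsFor (G : BicovariantCalculus A Γ)
    (ω : Module.Basis (Fin N) ℂ G.leftInvariants) (d : Ext D.σ →ₗ[ℂ] Ext D.σ) : Prop where
  coact_scalar : ∀ x, O.coact (Ext.scalar D.σ x) = (Ext.scalar D.σ).rTensor A (Coalgebra.comul x)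
  /-- the coaction sends `x dα` to `Δ(x) (d ⊗ id)(coaction of α)` -/
  coact_mul_d : ∀ x α, O.coact (Ext.scalar D.σ x * d α) =
    (Ext.scalar D.σ).rTensor A (Coalgebra.comul x) * d.rTensor A (O.coact α)
  inner_zero : ∀ k, ∀ α ∈ Ext.degree D.σ 0, O.inner k α = 0
  inner_degree : ∀ k n, ∀ α ∈ Ext.degree D.σ (n + 1), O.inner k α ∈ Ext.degree D.σ n
  inner_basis : ∀ k j, O.inner k (Ext.form D.σ (ω j : Γ)) = if k = j then 1 else 0
  inner_mul : ∀ k n, ∀ α ∈ Ext.degree D.σ n, ∀ β, O.inner k (α * β) =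
    (-1 : ℂ) ^ n • (α * O.inner k β) + ∑ j, O.inner j α * O.act (D.f j k) β

/-- The homomorphism `lam` takes the values `X_j ↦ L_j`, `f_{jk} ↦ f_{jk} ▷`, `ξ_j ↦ i_j`,
`δ ↦ d` on the generators. -/
structure IsCartanRep (d : Ext D.σ →ₗ[ℂ] Ext D.σ)
    (lam : D.CartanAlg →ₐ[ℂ] Module.End ℂ (Ext D.σ)) : Prop where
  map_X : ∀ j, lam (D.cX j) = O.act (D.X j)
  map_f : ∀ j k, lam (D.cf j k) = O.act (D.f j k)
  map_xi : ∀ j, lam (D.cxi j) = O.inner j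
  map_del : lam D.cdel = d

end CartanOps

end Calculus

end

end QCartan

set_option linter.unusedSectionVars false

namespace QCartan

noncomputable section

/-! ### Slices of tensors -/

section Slices

variable {V W : Type*} [AddCommGroup V] [Module ℂ V] [AddCommGroup W] [Module ℂ W]

/-! Components. The form θ(y) = S(y₁) dy₂ is left invariant and dy = y₁ θ(y₂), so Γ is a free left
A-module on the ω_i (`sum_formCoord_smul`). All components are then coordinates of explicit forms.
Associativity of the right action, the Leibniz rule and coassociativity of the right coaction turn
into product and coproduct formulas (`f_mul`, `X_mul`, `comul_J`). Computing the right coaction of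
ω_i x and of dy in two ways yields two identities in A, `J_mul_rightAct_f` and `rightAct_X`; pairing
each of them with the X's and with the f's gives the four quadratic relations. The braiding must
have the matrix σ^{kl}_{ij} = f_{il}(J_{kj}), since every ω_j is a right combination of right
invariant forms (`apply_basis`), and the left linear map with this matrix is a braiding
(`braidOf_isBraiding`).

Hopf structure. The odd relations are handled as statements about a family of operators at one
vector (`RelAt`). The central computation is `RelAt.tmul`: if they hold at v and at w, they hold at
v ⊗ w for the operators prescribed by the coproduct. It needs only the relations f-f and f-X and a
sign operator that anticommutes with the odd generators. Applied to left multiplications it makes ℭ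
act on ℭ ⊗ ℭ, and x ↦ x·(1 ⊗ 1) is the coproduct (`of_tensorRep`). The even relations are not an
explicit list. They are respected because the coproduct of a functional h is determined by the
numbers h(xy) (`evenComul_congr`), its counit is h(1), and its antipode is h ∘ S. The last one stays
in 𝒰 because the transposed antipode is antimultiplicative and X_i ∘ S = -X_j (f_{ji} ∘ S). The
graded antipode is built from an ordinary antihomomorphism by inserting factors of the imaginary
unit on odd elements. The Hopf axioms are then proved by induction over left multiplication with
generators. Uniqueness holds because coproduct and counit are fixed on generators and the antipode
is a convolution inverse.

Exterior algebra. The sign automorphism, the coaction and the inner derivatives all come from the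
universal property of Γ^∧. The inner derivatives are entries of a homomorphism into block triangular
matrices, whose multiplicativity is their twisted Leibniz rule. In coordinates, the degree two
relations say that ∑ a_{ij} ω_i ω_j = 0 when the array a is fixed by σ (`sum_form_form`), and this
is what each construction has to respect. Uniqueness of the coaction follows from x dy β = x d(yβ) -
xy dβ, which reduces degree n + 1 to degree n. Finally λ exists because the relations hold at each a
∈ A and each dy and pass to products: the multiplication of Γ^∧ intertwines the tensor operators, so
`RelAt.tmul` applies again (`relAt_mul`). -/

/-- The slice map `v ⊗ w ↦ g(w) v`. -/
def slice (V : Type*) [AddCommGroup V] [Module ℂ V] (g : W →ₗ[ℂ] ℂ) : V ⊗[ℂ] W →ₗ[ℂ] V :=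
  (TensorProduct.rid ℂ V).toLinearMap ∘ₗ g.lTensor V

@[simp] theorem slice_tmul (g : W →ₗ[ℂ] ℂ) (v : V) (w : W) : slice V g (v ⊗ₜ w) = g w • v := by
  simp [slice]

/-- A basis of `W` identifies `V ⊗ W` with finitely supported families in `V`, and the entries of
the family are the slices along the coordinate functionals. -/
theorem eq_of_slice {z z' : V ⊗[ℂ] W} (h : ∀ g : W →ₗ[ℂ] ℂ, slice V g z = slice V g z') :
    z = z' := by
  let b := Module.Free.chooseBasis ℂ W
  apply (TensorProduct.equivFinsuppOfBasisRight b).injective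
  ext i
  have key : ∀ z : V ⊗[ℂ] W, TensorProduct.equivFinsuppOfBasisRight b z i
      = slice V (b.coord i) z := by
    intro z
    induction z with
    | zero => simp
    | tmul v w => simp
    | add x y hx hy => simp [hx, hy]
  rw [key, key, h]

theorem eq_of_dual {x y : V} (h : ∀ g : V →ₗ[ℂ] ℂ, g x = g y) : x = y := by
  rw [← sub_eq_zero, ← Module.forall_dual_apply_eq_zero_iff ℂ]
  intro g
  rw [map_sub, h, sub_self]

/-- A tensor `∑ v_{mn} ⊗ b_{mn}` vanishes if `b` is fixed by an operator on indices and `v` is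
killed by the fixed vectors of that operator. -/
theorem sum_tmul_eq_zero_of_fixed {N : ℕ} (T : Fin N → Fin N → Fin N → Fin N → ℂ)
    (v : Fin N → Fin N → V) (b : Fin N → Fin N → W)
    (hv : ∀ a : Fin N → Fin N → ℂ, (∀ k l, ∑ i, ∑ j, a i j * T i j k l = a k l) →
      ∑ i, ∑ j, a i j • v i j = 0)
    (hb : ∀ k l, ∑ i, ∑ j, T i j k l • b i j = b k l) :
    ∑ i, ∑ j, v i j ⊗ₜ[ℂ] b i j = 0 := by
  apply eq_of_slice
  intro g
  -- A functional applied to `b` turns it into an array of scalars that `T` still fixes, so the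
  -- hypothesis on `v` applies to it.
  have := hv (fun i j => g (b i j)) fun k l => by
    rw [← hb k l]; simp [mul_comm]
  simpa using this

end Slices

/-! ### Functionals acting on a Hopf algebra -/

section Functionals

variable {A : Type*} [Ring A] [HopfAlgebra ℂ A]

/-- The right action `x ↦ h(x₁) x₂` of functionals on `A`. -/
def rightAct (h : DualAlg A) : A →ₗ[ℂ] A :=
  (TensorProduct.lid ℂ A).toLinearMap ∘ₗ h.ofConv.rTensor A ∘ₗ Coalgebra.comul

theorem leftAct_eq_slice (h : DualAlg A) (x : A) :
    leftAct h x = slice A h.ofConv (Coalgebra.comul x) := rfl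

/-- Recovers a functional from its action, so identities between coordinates in `A` become
identities between functionals after applying ε. -/
theorem counit_leftAct (h : DualAlg A) (x : A) :
    Coalgebra.counit (R := ℂ) (leftAct h x) = h.ofConv x := by
  have key : ∀ t : A ⊗[ℂ] A, Coalgebra.counit (R := ℂ) (slice A h.ofConv t)
      = h.ofConv (TensorProduct.lid ℂ A (Coalgebra.counit.rTensor A t)) := by
    intro t
    induction t with
    | zero => simp
    | tmul v w => simp [mul_comm]
    | add x y hx hy => simp [hx, hy]
  rw [leftAct_eq_slice, key]
  simp

theorem dual_mul_apply (f g : DualAlg A) (x : A) :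
    (f * g).ofConv x = LinearMap.mul' ℂ ℂ (TensorProduct.map f.ofConv g.ofConv
      (Coalgebra.comul x)) := rfl

theorem dual_one_apply (x : A) :
    (1 : DualAlg A).ofConv x = Coalgebra.counit x := rfl

/-- Under the pairing the left action is dual to right convolution. As functionals separate points,
the module axioms below reduce to the ring axioms of `DualAlg A`. -/
theorem apply_leftAct (f g : DualAlg A) (x : A) :
    g.ofConv (leftAct f x) = (g * f).ofConv x := by
  rw [dual_mul_apply, leftAct_eq_slice]
  generalize Coalgebra.comul (R := ℂ) x = t
  induction t with
  | zero => simp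
  | tmul v w => simp [mul_comm]
  | add x y hx hy => simp only [map_add, hx, hy]

theorem apply_rightAct (f g : DualAlg A) (x : A) :
    g.ofConv (rightAct f x) = (f * g).ofConv x := by
  rw [dual_mul_apply]
  simp only [rightAct, LinearMap.comp_apply]
  generalize Coalgebra.comul (R := ℂ) x = t
  induction t with
  | zero => simp
  | tmul v w => simp
  | add x y hx hy => simp only [map_add, hx, hy]

theorem eq_of_forall_functional {x y : A} (h : ∀ g : DualAlg A, g.ofConv x = g.ofConv y) :
    x = y := eq_of_dual fun g => h (WithConv.toConv g)

theorem leftAct_mul (f g : DualAlg A) (x : A) : leftAct (f * g) x = leftAct f (leftAct g x) := by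
  apply eq_of_forall_functional
  intro h
  rw [apply_leftAct, apply_leftAct, apply_leftAct, mul_assoc]

theorem leftAct_one (x : A) : leftAct (1 : DualAlg A) x = x := by
  apply eq_of_forall_functional
  intro h
  rw [apply_leftAct, mul_one]

theorem leftAct_add (f g : DualAlg A) (x : A) : leftAct (f + g) x = leftAct f x + leftAct g x := by
  apply eq_of_forall_functional
  intro h
  simp only [map_add, apply_leftAct, mul_add, WithConv.ofConv_add, LinearMap.add_apply]

theorem leftAct_smul (c : ℂ) (g : DualAlg A) (x : A) : leftAct (c • g) x = c • leftAct g x := by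
  apply eq_of_forall_functional
  intro h
  simp only [map_smul, apply_leftAct, mul_smul_comm, WithConv.ofConv_smul, LinearMap.smul_apply]

theorem leftAct_sum {ι : Type*} (s : Finset ι) (f : ι → DualAlg A) (x : A) :
    leftAct (∑ i ∈ s, f i) x = ∑ i ∈ s, leftAct (f i) x := by
  apply eq_of_forall_functional
  intro h
  simp only [map_sum, apply_leftAct, Finset.mul_sum, WithConv.ofConv_sum, LinearMap.sum_apply]

/-- The left action of a matrix of functionals with matrix coproduct on a product. -/
theorem leftAct_mul_apply {N : ℕ} {f : Fin N → Fin N → DualAlg A}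
    (hf : ∀ i j x y, (f i j).ofConv (x * y) = ∑ k, (f i k).ofConv x * (f k j).ofConv y)
    (i j : Fin N) (x y : A) :
    leftAct (f i j) (x * y) = ∑ k, leftAct (f i k) x * leftAct (f k j) y := by
  simp only [leftAct_eq_slice, Bialgebra.comul_mul]
  generalize Coalgebra.comul (R := ℂ) x = s
  generalize Coalgebra.comul (R := ℂ) y = t
  induction s with
  | zero => simp
  | add x y hx hy => simp only [add_mul, map_add, hx, hy, Finset.sum_add_distrib]
  | tmul a b =>
    induction t with
    | zero => simp
    | add x y hx hy => simp only [mul_add, map_add, hx, hy, Finset.sum_add_distrib]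
    | tmul c d =>
      simp only [Algebra.TensorProduct.tmul_mul_tmul, slice_tmul, hf, Finset.sum_smul,
        smul_mul_smul_comm]

/-- The antipode is an anticoalgebra map. -/
theorem comul_antipode (x : A) : Coalgebra.comul (R := ℂ) (HopfAlgebra.antipode ℂ x) =
    TensorProduct.comm ℂ A A (TensorProduct.map (HopfAlgebra.antipode ℂ) (HopfAlgebra.antipode ℂ)
      (Coalgebra.comul x)) := by
  let iL : A →ₐ[ℂ] A ⊗[ℂ] A := Algebra.TensorProduct.includeLeft
  let iR : A →ₐ[ℂ] A ⊗[ℂ] A := Algebra.TensorProduct.includeRight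
  let c (j : A →ₐ[ℂ] A ⊗[ℂ] A) (u : A →ₗ[ℂ] A) : WithConv (A →ₗ[ℂ] A ⊗[ℂ] A) :=
    WithConv.toConv (j.toLinearMap ∘ₗ u)
  have hc (j : A →ₐ[ℂ] A ⊗[ℂ] A) (u v : A →ₗ[ℂ] A) :
      c j u * c j v = c j (WithConv.toConv u * WithConv.toConv v).ofConv := by
    apply WithConv.ofConv_injective
    exact (LinearMap.algHom_comp_convMul_distrib j (WithConv.toConv u) (WithConv.toConv v)).symm
  have hc1 (j : A →ₐ[ℂ] A ⊗[ℂ] A) :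
      c j (1 : WithConv (A →ₗ[ℂ] A)).ofConv = 1 := by
    apply WithConv.ofConv_injective
    ext y
    simp [c, LinearMap.convOne_def]
  let dl : WithConv (A →ₗ[ℂ] A ⊗[ℂ] A) := WithConv.toConv Coalgebra.comul
  -- In the convolution algebra of maps `A → A ⊗ A` the coproduct factors through the two
  -- inclusions. The inverses of the factors in reverse order give a left inverse of Δ, while Δ ∘ S
  -- is a right inverse, so the two agree.
  have h1 : dl = c iL LinearMap.id * c iR LinearMap.id := by
    apply WithConv.ofConv_injective
    ext y
    change Coalgebra.comul y = LinearMap.mul' ℂ _ (TensorProduct.map _ _ (Coalgebra.comul y))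
    generalize Coalgebra.comul (R := ℂ) y = t
    induction t with
    | zero => simp
    | tmul v w => simp [c, iL, iR]
    | add x y hx hy => rw [map_add, map_add, ← hx, ← hy]
  have h2 : (c iR (HopfAlgebra.antipode ℂ) * c iL (HopfAlgebra.antipode ℂ)) * dl = 1 := by
    rw [h1, mul_assoc, ← mul_assoc (c iL _), hc iL, LinearMap.antipode_mul_id, hc1, one_mul, hc iR,
      LinearMap.antipode_mul_id, hc1]
  have h3 : dl * WithConv.toConv (Coalgebra.comul ∘ₗ HopfAlgebra.antipode ℂ) = 1 :=
    LinearMap.comul_right_inv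
  have h4 := left_inv_eq_right_inv h2 h3
  have h5 := LinearMap.congr_fun (congrArg WithConv.ofConv h4) x
  change LinearMap.mul' ℂ _ (TensorProduct.map _ _ (Coalgebra.comul x)) = _ at h5
  change _ = Coalgebra.comul (HopfAlgebra.antipode ℂ x) at h5
  rw [← h5]
  generalize Coalgebra.comul (R := ℂ) x = t
  induction t with
  | zero => simp
  | tmul v w => simp [c, iL, iR]
  | add x y hx hy => simp only [map_add, hx, hy]

theorem dualAntipode_apply (h : DualAlg A) (x : A) :
    (dualAntipode h).ofConv x = h.ofConv (HopfAlgebra.antipode ℂ x) := rfl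

/-- The transpose of `comul_antipode`. -/
theorem dualAntipode_mul (f g : DualAlg A) :
    dualAntipode (f * g) = dualAntipode g * dualAntipode f := by
  apply WithConv.ofConv_injective
  ext x
  rw [dualAntipode_apply, dual_mul_apply, dual_mul_apply, comul_antipode]
  generalize Coalgebra.comul (R := ℂ) x = t
  induction t with
  | zero => simp
  | tmul v w => simp [dualAntipode_apply, mul_comm]
  | add x y hx hy => simp only [map_add, hx, hy]

theorem dualAntipode_one : dualAntipode (1 : DualAlg A) = 1 := by
  apply WithConv.ofConv_injective
  ext x
  rw [dualAntipode_apply, dual_one_apply, dual_one_apply, HopfAlgebra.counit_antipode]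

/-- The transposed antipode as a linear map. -/
def dualAntipodeLinear : DualAlg A →ₗ[ℂ] DualAlg A where
  toFun := dualAntipode
  map_add' _ _ := rfl
  map_smul' _ _ := rfl

theorem dualAntipodeLinear_apply (f : DualAlg A) : dualAntipodeLinear f = dualAntipode f := rfl

/-- The identity `S(x₁) (x₂ w(x₃)) = w(x)` for a linear map `w` to an `A`-module. -/
theorem antipode_act_cancel {M : Type*} [AddCommGroup M] [Module ℂ M] (μ : A →ₐ[ℂ] Module.End ℂ M)
    (v w : A →ₗ[ℂ] M)
    (h : ∀ y, v y = TensorProduct.lift (LinearMap.compl₂ μ.toLinearMap w) (Coalgebra.comul y))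
    (y : A) :
    TensorProduct.lift (LinearMap.compl₂ (μ.toLinearMap ∘ₗ HopfAlgebra.antipode ℂ) v)
      (Coalgebra.comul y) = w y := by
  -- The trilinear expression S(a)(b w(c)), to be read once as S(a) v(·) and once, after
  -- reassociating, as (S(a)b) w(c).
  let Φ : A ⊗[ℂ] (A ⊗[ℂ] A) →ₗ[ℂ] M := TensorProduct.lift (LinearMap.compl₂
    (μ.toLinearMap ∘ₗ HopfAlgebra.antipode ℂ)
    (TensorProduct.lift (LinearMap.compl₂ μ.toLinearMap w)))
  have h1 : ∀ t : A ⊗[ℂ] A, TensorProduct.lift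
      (LinearMap.compl₂ (μ.toLinearMap ∘ₗ HopfAlgebra.antipode ℂ) v) t
      = Φ (Coalgebra.comul.lTensor A t) := by
    intro t
    induction t with
    | zero => simp
    | tmul a b => simp [Φ, h]
    | add x y hx hy => simp only [map_add, hx, hy]
  have h2 : ∀ t : (A ⊗[ℂ] A) ⊗[ℂ] A, Φ (TensorProduct.assoc ℂ A A A t) =
      TensorProduct.lift (LinearMap.compl₂ μ.toLinearMap w)
        ((LinearMap.mul' ℂ A ∘ₗ (HopfAlgebra.antipode ℂ).rTensor A).rTensor A t) := by
    intro t
    induction t with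
    | zero => simp
    | add x y hx hy => simp only [map_add, hx, hy]
    | tmul s c =>
      induction s with
      | zero => simp
      | add x y hx hy => simp only [map_add, TensorProduct.add_tmul, hx, hy]
      | tmul a b => simp [Φ]
  rw [h1, ← Coalgebra.coassoc_apply, h2, ← LinearMap.rTensor_comp_apply,
    LinearMap.comp_assoc, HopfAlgebra.mul_antipode_rTensor_comul, LinearMap.rTensor_comp_apply,
    Coalgebra.rTensor_counit_comul]
  simp

/-- The identity `x₁ (S(x₂) w(x₃)) = w(x)` for a linear map `w` to an `A`-module. -/
theorem act_antipode_cancel {M : Type*} [AddCommGroup M] [Module ℂ M] (μ : A →ₐ[ℂ] Module.End ℂ M)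
    (v w : A →ₗ[ℂ] M)
    (h : ∀ y, v y = TensorProduct.lift
      (LinearMap.compl₂ (μ.toLinearMap ∘ₗ HopfAlgebra.antipode ℂ) w) (Coalgebra.comul y))
    (y : A) :
    TensorProduct.lift (LinearMap.compl₂ μ.toLinearMap v) (Coalgebra.comul y) = w y := by
  let Φ : A ⊗[ℂ] (A ⊗[ℂ] A) →ₗ[ℂ] M := TensorProduct.lift (LinearMap.compl₂
    μ.toLinearMap
    (TensorProduct.lift (LinearMap.compl₂ (μ.toLinearMap ∘ₗ HopfAlgebra.antipode ℂ) w)))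
  have h1 : ∀ t : A ⊗[ℂ] A, TensorProduct.lift (LinearMap.compl₂ μ.toLinearMap v) t
      = Φ (Coalgebra.comul.lTensor A t) := by
    intro t
    induction t with
    | zero => simp
    | tmul a b => simp [Φ, h]
    | add x y hx hy => simp only [map_add, hx, hy]
  have h2 : ∀ t : (A ⊗[ℂ] A) ⊗[ℂ] A, Φ (TensorProduct.assoc ℂ A A A t) =
      TensorProduct.lift (LinearMap.compl₂ μ.toLinearMap w)
        ((LinearMap.mul' ℂ A ∘ₗ (HopfAlgebra.antipode ℂ).lTensor A).rTensor A t) := by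
    intro t
    induction t with
    | zero => simp
    | add x y hx hy => simp only [map_add, hx, hy]
    | tmul s c =>
      induction s with
      | zero => simp
      | add x y hx hy => simp only [map_add, TensorProduct.add_tmul, hx, hy]
      | tmul a b => simp [Φ]
  rw [h1, ← Coalgebra.coassoc_apply, h2, ← LinearMap.rTensor_comp_apply,
    LinearMap.comp_assoc, HopfAlgebra.mul_antipode_lTensor_comul, LinearMap.rTensor_comp_apply,
    Coalgebra.rTensor_counit_comul]
  simp

end Functionals

section

variable {A : Type*} [Ring A] [HopfAlgebra ℂ A]
variable {Γ : Type*} [AddCommGroup Γ] [Module ℂ Γ] [Module A Γ] [Module Aᵐᵒᵖ Γ]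
  [SMulCommClass A Aᵐᵒᵖ Γ] [IsScalarTower ℂ A Γ] [IsScalarTower ℂ Aᵐᵒᵖ Γ]

/-! ### Bimodule structures on `A ⊗ Γ` and `Γ ⊗ A` -/

variable (A Γ) in
/-- The right action of `A` on `Γ`, as a bilinear map. -/
def opSmul : A →ₗ[ℂ] Γ →ₗ[ℂ] Γ :=
  (Algebra.lsmul ℂ ℂ Γ : Aᵐᵒᵖ →ₐ[ℂ] Module.End ℂ Γ).toLinearMap ∘ₗ
    (MulOpposite.opLinearEquiv ℂ).toLinearMap

@[simp] theorem opSmul_apply (a : A) (ρ : Γ) : opSmul A Γ a ρ = op a • ρ := rfl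

variable (A Γ) in
/-- The action of `A ⊗ A` on `A ⊗ Γ` by right multiplication in both factors. -/
def opLeftTensor : A ⊗[ℂ] A →ₗ[ℂ] A ⊗[ℂ] Γ →ₗ[ℂ] A ⊗[ℂ] Γ :=
  TensorProduct.map₂ (LinearMap.mul ℂ A).flip (opSmul A Γ)

variable (A Γ) in
/-- The action of `A ⊗ A` on `Γ ⊗ A` by right multiplication in both factors. -/
def opRightTensor : A ⊗[ℂ] A →ₗ[ℂ] Γ ⊗[ℂ] A →ₗ[ℂ] Γ ⊗[ℂ] A :=
  TensorProduct.map₂ (opSmul A Γ) (LinearMap.mul ℂ A).flip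

@[simp] theorem mulLeftTensor_tmul (a b c : A) (ρ : Γ) :
    mulLeftTensor A Γ (a ⊗ₜ b) (c ⊗ₜ ρ) = (a * c) ⊗ₜ (b • ρ) := rfl

@[simp] theorem mulRightTensor_tmul (a b c : A) (ρ : Γ) :
    mulRightTensor A Γ (a ⊗ₜ b) (ρ ⊗ₜ c) = (a • ρ) ⊗ₜ (b * c) := rfl

@[simp] theorem opLeftTensor_tmul (a b c : A) (ρ : Γ) :
    opLeftTensor A Γ (a ⊗ₜ b) (c ⊗ₜ ρ) = (c * a) ⊗ₜ (op b • ρ) := rfl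

@[simp] theorem opRightTensor_tmul (a b c : A) (ρ : Γ) :
    opRightTensor A Γ (a ⊗ₜ b) (ρ ⊗ₜ c) = (op a • ρ) ⊗ₜ (c * b) := rfl

theorem mulLeftTensor_mul (s t : A ⊗[ℂ] A) (z : A ⊗[ℂ] Γ) :
    mulLeftTensor A Γ (s * t) z = mulLeftTensor A Γ s (mulLeftTensor A Γ t z) := by
  induction s with
  | zero => simp
  | add x y hx hy => simp only [add_mul, map_add, LinearMap.add_apply, hx, hy]
  | tmul a b =>
    induction t with
    | zero => simp
    | add x y hx hy => simp only [mul_add, map_add, LinearMap.add_apply, hx, hy]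
    | tmul c d =>
      induction z with
      | zero => simp only [LinearMap.map_zero]
      | add x y hx hy => simp only [LinearMap.map_add, hx, hy]
      | tmul e ρ => simp [mul_smul, mul_assoc]

theorem mulRightTensor_mul (s t : A ⊗[ℂ] A) (z : Γ ⊗[ℂ] A) :
    mulRightTensor A Γ (s * t) z = mulRightTensor A Γ s (mulRightTensor A Γ t z) := by
  induction s with
  | zero => simp
  | add x y hx hy => simp only [add_mul, map_add, LinearMap.add_apply, hx, hy]
  | tmul a b =>
    induction t with
    | zero => simp
    | add x y hx hy => simp only [mul_add, map_add, LinearMap.add_apply, hx, hy]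
    | tmul c d =>
      induction z with
      | zero => simp only [LinearMap.map_zero]
      | add x y hx hy => simp only [LinearMap.map_add, hx, hy]
      | tmul ρ e => simp [mul_smul, mul_assoc]

theorem opRightTensor_mul (s t : A ⊗[ℂ] A) (z : Γ ⊗[ℂ] A) :
    opRightTensor A Γ (s * t) z = opRightTensor A Γ t (opRightTensor A Γ s z) := by
  induction s with
  | zero => simp
  | add x y hx hy => simp only [add_mul, map_add, LinearMap.add_apply, hx, hy]
  | tmul a b =>
    induction t with
    | zero => simp
    | add x y hx hy => simp only [mul_add, map_add, LinearMap.add_apply, hx, hy]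
    | tmul c d =>
      induction z with
      | zero => simp only [LinearMap.map_zero]
      | add x y hx hy => simp only [LinearMap.map_add, hx, hy]
      | tmul ρ e => simp [mul_smul, mul_assoc]

theorem opLeftTensor_mulLeftTensor (s t : A ⊗[ℂ] A) (z : A ⊗[ℂ] Γ) :
    opLeftTensor A Γ t (mulLeftTensor A Γ s z) = mulLeftTensor A Γ s (opLeftTensor A Γ t z) := by
  induction s with
  | zero => simp only [LinearMap.map_zero, LinearMap.zero_apply]
  | add x y hx hy => simp only [LinearMap.map_add, LinearMap.add_apply, hx, hy]
  | tmul a b =>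
    induction t with
    | zero => simp only [LinearMap.map_zero, LinearMap.zero_apply]
    | add x y hx hy => simp only [LinearMap.map_add, LinearMap.add_apply, hx, hy]
    | tmul c d =>
      induction z with
      | zero => simp only [LinearMap.map_zero]
      | add x y hx hy => simp only [LinearMap.map_add, hx, hy]
      | tmul e ρ => simp [smul_comm, mul_assoc]

theorem opRightTensor_mulRightTensor (s t : A ⊗[ℂ] A) (z : Γ ⊗[ℂ] A) :
    opRightTensor A Γ t (mulRightTensor A Γ s z)
      = mulRightTensor A Γ s (opRightTensor A Γ t z) := by
  induction s with
  | zero => simp only [LinearMap.map_zero, LinearMap.zero_apply]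
  | add x y hx hy => simp only [LinearMap.map_add, LinearMap.add_apply, hx, hy]
  | tmul a b =>
    induction t with
    | zero => simp only [LinearMap.map_zero, LinearMap.zero_apply]
    | add x y hx hy => simp only [LinearMap.map_add, LinearMap.add_apply, hx, hy]
    | tmul c d =>
      induction z with
      | zero => simp only [LinearMap.map_zero]
      | add x y hx hy => simp only [LinearMap.map_add, hx, hy]
      | tmul e ρ => simp [smul_comm, mul_assoc]

namespace BicovariantCalculus

variable (G : BicovariantCalculus A Γ)

/-- No closure under scalars is needed: a scalar is absorbed in the left factor of `x dy`. -/
theorem form_induction {p : Γ → Prop} (smul_d : ∀ x y : A, p (x • G.d y))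
    (add : ∀ ρ ρ', p ρ → p ρ' → p (ρ + ρ')) (ρ : Γ) : p ρ := by
  have h : ∀ ρ ∈ Submodule.span ℂ {ρ : Γ | ∃ x y : A, ρ = x • G.d y}, ∀ c : ℂ, p (c • ρ) := by
    intro ρ hρ
    induction hρ using Submodule.span_induction with
    | mem x hx =>
      obtain ⟨x, y, rfl⟩ := hx
      intro c
      rw [← smul_assoc]
      exact smul_d _ _
    | zero =>
      intro c
      simpa using smul_d 0 0
    | add x y _ _ hx hy =>
      intro c
      rw [smul_add]
      exact add _ _ (hx c) (hy c)
    | smul a x _ hx =>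
      intro c
      rw [← mul_smul]
      exact hx _
  simpa using h ρ (by rw [G.span_smul_d]; trivial) 1

theorem d_one : G.d 1 = 0 := by
  have h := G.leibniz 1 1
  simpa using h

/-- The Leibniz rule expresses the right action through the left action and `d`; this is how right
linearity of the coactions is obtained from their values on `x dy`. -/
theorem op_smul_smul_d (a x y : A) :
    op a • (x • G.d y) = x • G.d (y * a) - (x * y) • G.d a := by
  rw [← smul_comm, G.leibniz, smul_add, mul_smul, add_sub_cancel_right]

theorem coactL_d (y : A) : G.coactL (G.d y) = G.d.lTensor A (Coalgebra.comul y) := by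
  have h := G.coactL_smul_d 1 y
  rw [one_smul, Bialgebra.comul_one, Algebra.TensorProduct.one_def] at h
  rw [h]
  generalize G.d.lTensor A (Coalgebra.comul (R := ℂ) y) = t
  induction t with
  | zero => simp only [LinearMap.map_zero]
  | add x y hx hy => simp only [LinearMap.map_add, hx, hy]
  | tmul a b => simp

theorem coactR_d (y : A) : G.coactR (G.d y) = G.d.rTensor A (Coalgebra.comul y) := by
  have h := G.coactR_smul_d 1 y
  rw [one_smul, Bialgebra.comul_one, Algebra.TensorProduct.one_def] at h
  rw [h]
  generalize G.d.rTensor A (Coalgebra.comul (R := ℂ) y) = t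
  induction t with
  | zero => simp only [LinearMap.map_zero]
  | add x y hx hy => simp only [LinearMap.map_add, hx, hy]
  | tmul a b => simp

theorem coactL_smul (a : A) (ρ : Γ) :
    G.coactL (a • ρ) = mulLeftTensor A Γ (Coalgebra.comul a) (G.coactL ρ) := by
  induction ρ using G.form_induction with
  | add ρ ρ' h1 h2 => rw [smul_add, map_add, map_add, h1, h2, map_add]
  | smul_d x y =>
    rw [← mul_smul, G.coactL_smul_d, G.coactL_smul_d, Bialgebra.comul_mul, mulLeftTensor_mul]

theorem coactR_smul (a : A) (ρ : Γ) :
    G.coactR (a • ρ) = mulRightTensor A Γ (Coalgebra.comul a) (G.coactR ρ) := by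
  induction ρ using G.form_induction with
  | add ρ ρ' h1 h2 => rw [smul_add, map_add, map_add, h1, h2, map_add]
  | smul_d x y =>
    rw [← mul_smul, G.coactR_smul_d, G.coactR_smul_d, Bialgebra.comul_mul, mulRightTensor_mul]

theorem lTensor_d_mul (s t : A ⊗[ℂ] A) : G.d.lTensor A (s * t) =
    opLeftTensor A Γ t (G.d.lTensor A s) + mulLeftTensor A Γ s (G.d.lTensor A t) := by
  induction s with
  | zero => simp
  | add x y hx hy =>
    simp only [add_mul, map_add, LinearMap.add_apply, hx, hy]; abel
  | tmul a b =>
    induction t with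
    | zero => simp
    | add x y hx hy =>
      simp only [mul_add, map_add, LinearMap.add_apply, hx, hy]; abel
    | tmul c e => simp [G.leibniz, TensorProduct.tmul_add]

theorem rTensor_d_mul (s t : A ⊗[ℂ] A) : G.d.rTensor A (s * t) =
    opRightTensor A Γ t (G.d.rTensor A s) + mulRightTensor A Γ s (G.d.rTensor A t) := by
  induction s with
  | zero => simp
  | add x y hx hy =>
    simp only [add_mul, map_add, LinearMap.add_apply, hx, hy]; abel
  | tmul a b =>
    induction t with
    | zero => simp
    | add x y hx hy =>
      simp only [mul_add, map_add, LinearMap.add_apply, hx, hy]; abel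
    | tmul c e => simp [G.leibniz, TensorProduct.add_tmul]

/-- Right covariance is not an axiom of the calculus. It follows from the formula for `x dy` because
both d and the coproduct obey the Leibniz rule on a product `y a`. -/
theorem coactL_op_smul (a : A) (ρ : Γ) :
    G.coactL (op a • ρ) = opLeftTensor A Γ (Coalgebra.comul a) (G.coactL ρ) := by
  induction ρ using G.form_induction with
  | add ρ ρ' h1 h2 => rw [smul_add, map_add, map_add, h1, h2, map_add]
  | smul_d x y =>
    rw [G.op_smul_smul_d, map_sub, G.coactL_smul_d, G.coactL_smul_d, G.coactL_smul_d,
      Bialgebra.comul_mul, Bialgebra.comul_mul, lTensor_d_mul, map_add, mulLeftTensor_mul,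
      add_sub_cancel_right, opLeftTensor_mulLeftTensor]

theorem coactR_op_smul (a : A) (ρ : Γ) :
    G.coactR (op a • ρ) = opRightTensor A Γ (Coalgebra.comul a) (G.coactR ρ) := by
  induction ρ using G.form_induction with
  | add ρ ρ' h1 h2 => rw [smul_add, map_add, map_add, h1, h2, map_add]
  | smul_d x y =>
    rw [G.op_smul_smul_d, map_sub, G.coactR_smul_d, G.coactR_smul_d, G.coactR_smul_d,
      Bialgebra.comul_mul, Bialgebra.comul_mul, rTensor_d_mul, map_add, mulRightTensor_mul,
      add_sub_cancel_right, opRightTensor_mulRightTensor]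

/-! ### Left invariant forms -/

theorem mem_leftInvariants {ρ : Γ} : ρ ∈ G.leftInvariants ↔ G.coactL ρ = 1 ⊗ₜ ρ := Iff.rfl

theorem maurerCartan_apply (y : A) : G.maurerCartan y =
    TensorProduct.lift (LinearMap.compl₂
      ((Algebra.lsmul ℂ ℂ Γ).toLinearMap ∘ₗ HopfAlgebra.antipode ℂ) G.d)
      (Coalgebra.comul y) := by
  simp only [maurerCartan, LinearMap.comp_apply]
  generalize Coalgebra.comul (R := ℂ) y = t
  induction t with
  | zero => simp only [LinearMap.map_zero]
  | add x y hx hy => simp only [LinearMap.map_add, hx, hy]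
  | tmul a b => simp

/-- The identity dy = y₁ θ(y₂) with θ(y) = S(y₁) dy₂: the factors y₁ S(y₂) cancel. -/
theorem comul_smul_maurerCartan (y : A) :
    TensorProduct.lift (LinearMap.compl₂ (Algebra.lsmul ℂ ℂ Γ).toLinearMap G.maurerCartan)
      (Coalgebra.comul y) = G.d y :=
  act_antipode_cancel (Algebra.lsmul ℂ ℂ Γ) G.maurerCartan G.d G.maurerCartan_apply y

variable (A Γ) in
/-- The diagonal left action of `A` on `A ⊗ Γ`. -/
def diagonalAct : A →ₐ[ℂ] Module.End ℂ (A ⊗[ℂ] Γ) :=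
  AlgHom.ofLinearMap (mulLeftTensor A Γ ∘ₗ Coalgebra.comul)
    (by
      ext a ρ
      simp [Algebra.TensorProduct.one_def])
    (fun x y => by
      refine LinearMap.ext fun z => ?_
      simp only [LinearMap.comp_apply, Bialgebra.comul_mul, mulLeftTensor_mul]
      rfl)

/-- From dy = y₁ θ(y₂) the coaction of dy is y₁ ⊗ y₂ θ(y₃) = Δ(y₁)(1 ⊗ θ(y₂)). Cancelling Δ(y₁) by
the antipode, for the diagonal action on `A ⊗ Γ`, leaves 1 ⊗ θ(y). -/
theorem coactL_maurerCartan (y : A) : G.coactL (G.maurerCartan y) = 1 ⊗ₜ G.maurerCartan y := by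
  have h := antipode_act_cancel (diagonalAct A Γ) (G.coactL ∘ₗ G.d)
    (TensorProduct.mk ℂ A Γ 1 ∘ₗ G.maurerCartan) (fun y => by
      rw [LinearMap.comp_apply, G.coactL_d]
      let Φ : A ⊗[ℂ] (A ⊗[ℂ] A) →ₗ[ℂ] A ⊗[ℂ] Γ := (TensorProduct.lift
        (LinearMap.compl₂ (Algebra.lsmul ℂ ℂ Γ).toLinearMap G.maurerCartan)).lTensor A
      have h1 : ∀ t : A ⊗[ℂ] A, G.d.lTensor A t = Φ (Coalgebra.comul.lTensor A t) := by
        intro t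
        induction t with
        | zero => simp only [LinearMap.map_zero]
        | add x y hx hy => simp only [LinearMap.map_add, hx, hy]
        | tmul a b => simp only [Φ, LinearMap.lTensor_tmul, comul_smul_maurerCartan]
      have h2 : ∀ t : (A ⊗[ℂ] A) ⊗[ℂ] A, Φ (TensorProduct.assoc ℂ A A A t) =
          TensorProduct.lift (LinearMap.compl₂ (mulLeftTensor A Γ)
            (TensorProduct.mk ℂ A Γ 1 ∘ₗ G.maurerCartan)) t := by
        intro t
        induction t with
        | zero => simp only [LinearMap.map_zero, LinearEquiv.map_zero]
        | add x y hx hy => simp only [LinearMap.map_add, LinearEquiv.map_add, hx, hy]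
        | tmul s c =>
          induction s with
          | zero => simp
          | add x y hx hy => simp only [LinearMap.map_add, LinearEquiv.map_add, TensorProduct.add_tmul, hx, hy]
          | tmul a b => simp [Φ]
      rw [h1, ← Coalgebra.coassoc_apply, h2]
      generalize Coalgebra.comul (R := ℂ) y = t
      induction t with
      | zero => simp only [LinearMap.map_zero]
      | add x y hx hy => simp only [LinearMap.map_add, hx, hy]
      | tmul a b => rfl) y
  refine Eq.trans ?_ h
  rw [maurerCartan_apply]
  generalize Coalgebra.comul (R := ℂ) y = t
  induction t with
  | zero => simp only [LinearMap.map_zero]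
  | add x y hx hy => simp only [LinearMap.map_add, hx, hy]
  | tmul a b =>
    simp only [TensorProduct.lift.tmul, LinearMap.compl₂_apply, LinearMap.comp_apply,
      AlgHom.toLinearMap_apply, Algebra.lsmul_coe, coactL_smul]
    rfl

/-- The projection `ρ ↦ S(ρ₋₁) ρ₀` onto the left invariant forms. -/
def invProj : Γ →ₗ[ℂ] Γ :=
  TensorProduct.lift ((Algebra.lsmul ℂ ℂ Γ).toLinearMap ∘ₗ HopfAlgebra.antipode ℂ) ∘ₗ G.coactL

/-- The antipode reverses products, so S(a₁ ρ₋₁) a₂ ρ₀ = S(ρ₋₁) S(a₁) a₂ ρ₀, and the middle factors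
collapse to ε(a). -/
theorem invProj_smul (a : A) (ρ : Γ) :
    G.invProj (a • ρ) = Coalgebra.counit (R := ℂ) a • G.invProj ρ := by
  have key : ∀ (s : A ⊗[ℂ] A) (z : A ⊗[ℂ] Γ),
      TensorProduct.lift ((Algebra.lsmul ℂ ℂ Γ).toLinearMap ∘ₗ HopfAlgebra.antipode ℂ)
        (mulLeftTensor A Γ s z) =
      TensorProduct.lift ((Algebra.lsmul ℂ ℂ Γ).toLinearMap ∘ₗ HopfAlgebra.antipode ℂ)
        ((Algebra.lsmul ℂ ℂ Γ (LinearMap.mul' ℂ A ((HopfAlgebra.antipode ℂ).rTensor A s))).lTensor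
          A z) := by
    intro s z
    induction s with
    | zero => simp
    | add x y hx hy => simp only [map_add, LinearMap.add_apply, LinearMap.lTensor_add, hx, hy]
    | tmul a b =>
      induction z with
      | zero => simp only [LinearMap.map_zero]
      | add x y hx hy => simp only [LinearMap.map_add, hx, hy]
      | tmul c ρ => simp [HopfAlgebra.antipode_mul_antidistrib]
  simp only [invProj, LinearMap.comp_apply, coactL_smul, key,
    HopfAlgebra.mul_antipode_rTensor_comul_apply]
  generalize G.coactL ρ = z
  induction z with
  | zero => simp
  | add x y hx hy => simp only [LinearMap.map_add, smul_add, hx, hy]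
  | tmul c ρ => simp [Algebra.algebraMap_eq_smul_one]

theorem invProj_d (y : A) : G.invProj (G.d y) = G.maurerCartan y := by
  rw [invProj, LinearMap.comp_apply, coactL_d, maurerCartan_apply]
  generalize Coalgebra.comul (R := ℂ) y = t
  induction t with
  | zero => simp only [LinearMap.map_zero]
  | add x y hx hy => simp only [LinearMap.map_add, hx, hy]
  | tmul c ρ => simp

theorem invProj_of_mem {ρ : Γ} (h : ρ ∈ G.leftInvariants) : G.invProj ρ = ρ := by
  rw [mem_leftInvariants] at h
  simp [invProj, h]

theorem invProj_mem (ρ : Γ) : G.invProj ρ ∈ G.leftInvariants := by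
  induction ρ using G.form_induction with
  | add ρ ρ' h1 h2 => rw [map_add]; exact add_mem h1 h2
  | smul_d x y =>
    rw [invProj_smul, invProj_d]
    exact Submodule.smul_mem _ _ (G.coactL_maurerCartan y)

/-! ### Coordinates of one-forms -/

variable {N : ℕ} (ω : Module.Basis (Fin N) ℂ G.leftInvariants)

/-- The functional `a ω_i ↦ ε(a) δ_{ij}` on `Γ`. -/
def evalForm (j : Fin N) : Γ →ₗ[ℂ] ℂ :=
  ω.coord j ∘ₗ LinearMap.codRestrict G.leftInvariants G.invProj G.invProj_mem

/-- The coordinates of a form with respect to the left `A`-basis of left invariant forms. -/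
def formCoord (j : Fin N) : Γ →ₗ[ℂ] A := slice A (G.evalForm ω j) ∘ₗ G.coactL

theorem evalForm_smul (j : Fin N) (a : A) (ρ : Γ) :
    G.evalForm ω j (a • ρ) = Coalgebra.counit (R := ℂ) a * G.evalForm ω j ρ := by
  have : LinearMap.codRestrict G.leftInvariants G.invProj G.invProj_mem (a • ρ)
      = Coalgebra.counit (R := ℂ) a •
        LinearMap.codRestrict G.leftInvariants G.invProj G.invProj_mem ρ :=
    Subtype.ext (G.invProj_smul a ρ)
  simp only [evalForm, LinearMap.comp_apply, this, map_smul, smul_eq_mul]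

theorem evalForm_basis (i j : Fin N) :
    G.evalForm ω i (ω j : Γ) = if i = j then 1 else 0 := by
  have : LinearMap.codRestrict G.leftInvariants G.invProj G.invProj_mem (ω j : Γ) = ω j :=
    Subtype.ext (G.invProj_of_mem (ω j).2)
  simp only [evalForm, LinearMap.comp_apply, this, Module.Basis.coord_apply,
    Module.Basis.repr_self, Finsupp.single_apply, eq_comm]

theorem sum_evalForm_smul (ρ : Γ) : ∑ j, G.evalForm ω j ρ • (ω j : Γ) = G.invProj ρ := by
  have h := congrArg Subtype.val
    (ω.sum_repr (LinearMap.codRestrict G.leftInvariants G.invProj G.invProj_mem ρ))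
  rw [AddSubmonoidClass.coe_finsetSum] at h
  exact h

/-- The coaction of `a ρ` is a₁ ρ₋₁ ⊗ a₂ ρ₀, and `evalForm` replaces a₂ by ε(a₂). -/
theorem formCoord_smul (j : Fin N) (a : A) (ρ : Γ) :
    G.formCoord ω j (a • ρ) = a * G.formCoord ω j ρ := by
  have key : ∀ (s : A ⊗[ℂ] A) (z : A ⊗[ℂ] Γ), slice A (G.evalForm ω j) (mulLeftTensor A Γ s z) =
      slice A Coalgebra.counit s * slice A (G.evalForm ω j) z := by
    intro s z
    induction s with
    | zero => simp
    | add x y hx hy => simp only [LinearMap.map_add, LinearMap.add_apply, add_mul, hx, hy]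
    | tmul a b =>
      induction z with
      | zero => simp
      | add x y hx hy => simp only [LinearMap.map_add, mul_add, hx, hy]
      | tmul c ρ =>
        simp only [mulLeftTensor_tmul, slice_tmul, evalForm_smul, mul_smul, smul_mul_assoc,
          mul_smul_comm]
        exact smul_comm _ _ _
  rw [formCoord, LinearMap.comp_apply, coactL_smul, key]
  congr 1
  exact leftAct_one a

theorem formCoord_basis (i j : Fin N) :
    G.formCoord ω i (ω j : Γ) = if i = j then 1 else 0 := by
  rw [formCoord, LinearMap.comp_apply, (G.mem_leftInvariants).1 (ω j).2, slice_tmul,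
    evalForm_basis]
  split_ifs <;> simp

theorem formCoord_d (j : Fin N) (y : A) :
    G.formCoord ω j (G.d y) = leftAct (WithConv.toConv (G.evalForm ω j ∘ₗ G.d)) y := by
  rw [formCoord, LinearMap.comp_apply, coactL_d, leftAct_eq_slice]
  generalize Coalgebra.comul (R := ℂ) y = t
  induction t with
  | zero => simp only [LinearMap.map_zero]
  | add x y hx hy => simp only [LinearMap.map_add, hx, hy]
  | tmul a b => simp

/-- This is the structure theorem for Hopf modules in the present case. On dy it is the formula dy =
y₁ θ(y₂) with the invariant form θ(y₂) expanded in the basis, and both sides are left linear. -/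
theorem sum_formCoord_smul (ρ : Γ) : ∑ j, G.formCoord ω j ρ • (ω j : Γ) = ρ := by
  induction ρ using G.form_induction with
  | add ρ ρ' h1 h2 => simp only [LinearMap.map_add, add_smul, Finset.sum_add_distrib, h1, h2]
  | smul_d x y =>
    simp only [formCoord_smul, mul_smul, ← Finset.smul_sum, formCoord_d]
    congr 1
    refine Eq.trans ?_ (G.comul_smul_maurerCartan y)
    simp only [leftAct_eq_slice]
    generalize Coalgebra.comul (R := ℂ) y = t
    induction t with
    | zero => simp
    | add x y hx hy => simp only [LinearMap.map_add, add_smul, Finset.sum_add_distrib, hx, hy]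
    | tmul a b =>
      simp only [slice_tmul, LinearMap.comp_apply, TensorProduct.lift.tmul, LinearMap.compl₂_apply,
        AlgHom.toLinearMap_apply, Algebra.lsmul_coe, ← invProj_d, ← sum_evalForm_smul G ω,
        Finset.smul_sum, smul_assoc]
      exact Finset.sum_congr rfl fun j _ => smul_comm _ _ _

theorem formCoord_sum (a : Fin N → A) (j : Fin N) :
    G.formCoord ω j (∑ i, a i • (ω i : Γ)) = a j := by
  simp [formCoord_smul, formCoord_basis]

theorem evalForm_eq_counit (j : Fin N) (ρ : Γ) :
    G.evalForm ω j ρ = Coalgebra.counit (G.formCoord ω j ρ) := by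
  conv_lhs => rw [← G.sum_formCoord_smul ω ρ]
  simp [evalForm_smul, evalForm_basis]

end BicovariantCalculus

end

section

variable {A : Type*} [Ring A] [HopfAlgebra ℂ A]
variable {Γ : Type*} [AddCommGroup Γ] [Module ℂ Γ] [Module A Γ] [Module Aᵐᵒᵖ Γ]
  [SMulCommClass A Aᵐᵒᵖ Γ] [IsScalarTower ℂ A Γ] [IsScalarTower ℂ Aᵐᵒᵖ Γ]

namespace BicovariantCalculus

variable (G : BicovariantCalculus A Γ)

/-! ### The right coaction on left invariant forms -/

/-- The two coactions of a bicovariant calculus commute. -/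
theorem coactL_coactR (ρ : Γ) : G.coactL.rTensor A (G.coactR ρ) =
    (TensorProduct.assoc ℂ A Γ A).symm (G.coactR.lTensor A (G.coactL ρ)) := by
  -- Both sides are linear over the action of `A` on `A ⊗ Γ ⊗ A` through the iterated coproduct.
  -- What remains is the case of dy, which is coassociativity in `A`.
  let act3 : (A ⊗[ℂ] A) ⊗[ℂ] A →ₗ[ℂ] (A ⊗[ℂ] Γ) ⊗[ℂ] A →ₗ[ℂ] (A ⊗[ℂ] Γ) ⊗[ℂ] A :=
    TensorProduct.map₂ (mulLeftTensor A Γ) (LinearMap.mul ℂ A)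
  have h1 : ∀ (s : A ⊗[ℂ] A) (z : Γ ⊗[ℂ] A), G.coactL.rTensor A (mulRightTensor A Γ s z) =
      act3 (Coalgebra.comul.rTensor A s) (G.coactL.rTensor A z) := by
    intro s z
    induction s with
    | zero => simp only [LinearMap.map_zero, LinearMap.zero_apply]
    | add x y hx hy => simp only [LinearMap.map_add, LinearMap.add_apply, hx, hy]
    | tmul a b =>
      induction z with
      | zero => simp only [LinearMap.map_zero]
      | add x y hx hy => simp only [LinearMap.map_add, hx, hy]
      | tmul ρ c => simp [act3, coactL_smul]
  have h2 : ∀ (s : A ⊗[ℂ] A) (z : A ⊗[ℂ] Γ),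
      (TensorProduct.assoc ℂ A Γ A).symm (G.coactR.lTensor A (mulLeftTensor A Γ s z)) =
      act3 ((TensorProduct.assoc ℂ A A A).symm (Coalgebra.comul.lTensor A s))
        ((TensorProduct.assoc ℂ A Γ A).symm (G.coactR.lTensor A z)) := by
    intro s z
    induction s with
    | zero => simp
    | add x y hx hy => simp only [LinearMap.map_add, LinearEquiv.map_add, LinearMap.add_apply, hx, hy]
    | tmul a b =>
      induction z with
      | zero => simp only [LinearMap.map_zero, LinearEquiv.map_zero]
      | add x y hx hy => simp only [LinearMap.map_add, LinearEquiv.map_add, hx, hy]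
      | tmul c ρ =>
        simp only [mulLeftTensor_tmul, LinearMap.lTensor_tmul, coactR_smul]
        generalize Coalgebra.comul (R := ℂ) b = t
        generalize G.coactR ρ = z
        induction t with
        | zero => simp
        | add x y hx hy =>
          simp only [map_add, LinearMap.add_apply, TensorProduct.tmul_add, hx, hy]
        | tmul p q =>
          induction z with
          | zero => simp
          | add x y hx hy => simp only [LinearMap.map_add, LinearEquiv.map_add, TensorProduct.tmul_add, hx, hy]
          | tmul ρ c => simp [act3]
  induction ρ using G.form_induction with
  | add ρ ρ' h1 h2 => simp only [LinearMap.map_add, LinearEquiv.map_add, h1, h2]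
  | smul_d x y =>
    rw [coactR_smul_d, coactL_smul_d, h1, h2, Coalgebra.coassoc_symm_apply]
    congr 1
    have h3 : ∀ t : A ⊗[ℂ] A, G.coactL.rTensor A (G.d.rTensor A t) =
        (G.d.lTensor A).rTensor A (Coalgebra.comul.rTensor A t) := by
      intro t
      induction t with
      | zero => simp only [LinearMap.map_zero]
      | add x y hx hy => simp only [LinearMap.map_add, hx, hy]
      | tmul a b => simp [coactL_d]
    have h4 : ∀ t : A ⊗[ℂ] A,
        (TensorProduct.assoc ℂ A Γ A).symm (G.coactR.lTensor A (G.d.lTensor A t)) =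
        (G.d.lTensor A).rTensor A
          ((TensorProduct.assoc ℂ A A A).symm (Coalgebra.comul.lTensor A t)) := by
      intro t
      induction t with
      | zero => simp only [LinearMap.map_zero, LinearEquiv.map_zero]
      | add x y hx hy => simp only [LinearMap.map_add, LinearEquiv.map_add, hx, hy]
      | tmul a b =>
        simp only [LinearMap.lTensor_tmul, coactR_d]
        generalize Coalgebra.comul (R := ℂ) b = t
        induction t with
        | zero => simp
        | add x y hx hy => simp only [LinearMap.map_add, LinearEquiv.map_add, TensorProduct.tmul_add, hx, hy]
        | tmul p q => simp
    rw [h3, h4, Coalgebra.coassoc_symm_apply]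

/-- Since the two coactions commute, the first legs of the right coaction of a left invariant form
are again left invariant. This is what makes the matrix `J` exist. -/
theorem rTensor_invProj_coactR {ρ : Γ} (h : ρ ∈ G.leftInvariants) :
    G.invProj.rTensor A (G.coactR ρ) = G.coactR ρ := by
  rw [invProj, LinearMap.rTensor_comp_apply, coactL_coactR, (mem_leftInvariants G).1 h,
    LinearMap.lTensor_tmul]
  generalize G.coactR ρ = z
  induction z with
  | zero => simp
  | add x y hx hy => simp only [LinearMap.map_add, LinearEquiv.map_add, TensorProduct.tmul_add, hx, hy]
  | tmul ρ c => simp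

variable {N : ℕ} (ω : Module.Basis (Fin N) ℂ G.leftInvariants)

/-- The map `(a ω_i) ⊗ b ↦ ε(a) δ_{ij} b`. -/
def evalTensor (j : Fin N) : Γ ⊗[ℂ] A →ₗ[ℂ] A :=
  (TensorProduct.lid ℂ A).toLinearMap ∘ₗ (G.evalForm ω j).rTensor A

@[simp] theorem evalTensor_tmul (j : Fin N) (ρ : Γ) (a : A) :
    G.evalTensor ω j (ρ ⊗ₜ a) = G.evalForm ω j ρ • a := by simp [evalTensor]

theorem coactR_basis (i : Fin N) : G.coactR (ω i : Γ) =
    ∑ j, (ω j : Γ) ⊗ₜ[ℂ] G.evalTensor ω j (G.coactR (ω i : Γ)) := by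
  conv_lhs => rw [← G.rTensor_invProj_coactR (ω i).2]
  generalize G.coactR (ω i : Γ) = z
  induction z with
  | zero => simp
  | add x y hx hy => simp only [LinearMap.map_add, TensorProduct.tmul_add, Finset.sum_add_distrib, hx, hy]
  | tmul ρ c =>
    rw [LinearMap.rTensor_tmul, ← G.sum_evalForm_smul ω ρ, TensorProduct.sum_tmul]
    simp [TensorProduct.smul_tmul]

end BicovariantCalculus

/-! ### The relations between the components -/

/-- The components of a calculus other than the braiding operator, with the structure constants of
the braiding given by `σ^{kl}_{ij} = f_{il}(J_{kj})`. -/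
structure Components.IsFrame {N : ℕ} (D : Components A Γ N) (G : BicovariantCalculus A Γ)
    (ω : Module.Basis (Fin N) ℂ G.leftInvariants) : Prop where
  f_spec : ∀ i x, op x • (ω i : Γ) = ∑ j, leftAct (D.f i j) x • (ω j : Γ)
  J_spec : ∀ i, G.coactR (ω i : Γ) = ∑ j, (ω j : Γ) ⊗ₜ[ℂ] D.J j i
  X_spec : ∀ i y, (D.X i).ofConv y = G.evalForm ω i (G.d y)
  s_spec : ∀ i j k l, D.s k l i j = (D.f i l).ofConv (D.J k j)

namespace Components.IsFrame

variable {N : ℕ} {D : Components A Γ N} {G : BicovariantCalculus A Γ}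
  {ω : Module.Basis (Fin N) ℂ G.leftInvariants} (h : D.IsFrame G ω)

include h

theorem formCoord_op (i j : Fin N) (x : A) :
    G.formCoord ω j (op x • (ω i : Γ)) = leftAct (D.f i j) x := by
  rw [h.f_spec, G.formCoord_sum]

theorem evalForm_op (i j : Fin N) (x : A) :
    G.evalForm ω j (op x • (ω i : Γ)) = (D.f i j).ofConv x := by
  rw [G.evalForm_eq_counit, h.formCoord_op, counit_leftAct]

theorem evalTensor_basis (i j : Fin N) : G.evalTensor ω j (G.coactR (ω i : Γ)) = D.J j i := by
  rw [h.J_spec]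
  simp [G.evalForm_basis]

theorem formCoord_d (j : Fin N) (y : A) : G.formCoord ω j (G.d y) = leftAct (D.X j) y := by
  have hX : WithConv.toConv (G.evalForm ω j ∘ₗ G.d) = D.X j := by
    apply WithConv.ofConv_injective
    ext y
    exact (h.X_spec j y).symm
  rw [G.formCoord_d, hX]

theorem d_eq (y : A) : G.d y = ∑ j, leftAct (D.X j) y • (ω j : Γ) := by
  conv_lhs => rw [← G.sum_formCoord_smul ω (G.d y)]
  simp only [h.formCoord_d]

theorem formCoord_op_smul (ρ : Γ) (x : A) (j : Fin N) : G.formCoord ω j (op x • ρ) =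
    ∑ k, G.formCoord ω k ρ * leftAct (D.f k j) x := by
  conv_lhs => rw [← G.sum_formCoord_smul ω ρ]
  simp only [Finset.smul_sum, map_sum, ← smul_comm (_ : A) (op x), G.formCoord_smul,
    h.formCoord_op]

/-- Coordinates of ω_i (xy) = (ω_i x) y, followed by the counit. -/
theorem f_mul (i j : Fin N) (x y : A) :
    (D.f i j).ofConv (x * y) = ∑ k, (D.f i k).ofConv x * (D.f k j).ofConv y := by
  rw [← h.evalForm_op, MulOpposite.op_mul, mul_smul, G.evalForm_eq_counit, h.formCoord_op_smul,
    map_sum]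
  simp only [Bialgebra.counit_mul, h.formCoord_op, counit_leftAct]

theorem f_one (i j : Fin N) : (D.f i j).ofConv 1 = if i = j then 1 else 0 := by
  rw [← h.evalForm_op, MulOpposite.op_one, one_smul, G.evalForm_basis]
  simp only [eq_comm]

theorem leftAct_f_mul (i j : Fin N) (x y : A) :
    leftAct (D.f i j) (x * y) = ∑ k, leftAct (D.f i k) x * leftAct (D.f k j) y :=
  leftAct_mul_apply h.f_mul i j x y

theorem X_one (i : Fin N) : (D.X i).ofConv 1 = 0 := by
  rw [h.X_spec, G.d_one, map_zero]

/-- The Leibniz rule in coordinates. The term (dx) y brings in the f's because y has to be moved to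
the left of the ω_k. -/
theorem X_mul (j : Fin N) (x y : A) : (D.X j).ofConv (x * y) =
    Coalgebra.counit (R := ℂ) x * (D.X j).ofConv y +
      ∑ k, (D.X k).ofConv x * (D.f k j).ofConv y := by
  rw [h.X_spec, G.leibniz, map_add, G.evalForm_smul, ← h.X_spec, add_comm, G.evalForm_eq_counit,
    h.formCoord_op_smul, map_sum]
  simp only [Bialgebra.counit_mul, h.formCoord_d, counit_leftAct]

/-- The coefficient of ω_i in the coassociativity of the right coaction at ω_j. -/
theorem comul_J (i j : Fin N) :
    Coalgebra.comul (R := ℂ) (D.J i j) = ∑ k, D.J i k ⊗ₜ[ℂ] D.J k j := by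
  have h1 := LinearMap.congr_fun G.coactR_coassoc (ω j : Γ)
  simp only [LinearMap.comp_apply, h.J_spec, map_sum, LinearMap.rTensor_tmul, TensorProduct.sum_tmul,
    LinearEquiv.coe_coe, TensorProduct.assoc_tmul, LinearMap.lTensor_tmul] at h1
  have h2 := congrArg (TensorProduct.lid ℂ (A ⊗[ℂ] A) ∘ (G.evalForm ω i).rTensor (A ⊗[ℂ] A)) h1
  simp only [Function.comp_apply, map_sum, LinearMap.rTensor_tmul, G.evalForm_basis,
    TensorProduct.lid_tmul, ite_smul, one_smul, zero_smul] at h2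
  simpa using h2.symm

theorem counit_J (i j : Fin N) :
    Coalgebra.counit (R := ℂ) (D.J i j) = if i = j then 1 else 0 := by
  have h1 := congrArg (G.evalForm ω i) (G.coactR_counit (ω j : Γ))
  rw [h.J_spec, G.evalForm_basis] at h1
  simpa [G.evalForm_basis] using h1

theorem leftAct_J (g : DualAlg A) (i j : Fin N) :
    leftAct g (D.J i j) = ∑ k, g.ofConv (D.J k j) • D.J i k := by
  rw [leftAct_eq_slice, h.comul_J, map_sum]
  simp

theorem rightAct_J (g : DualAlg A) (i j : Fin N) :
    rightAct g (D.J i j) = ∑ k, g.ofConv (D.J i k) • D.J k j := by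
  simp [rightAct, h.comul_J]

theorem evalTensor_coactR_smul (k q : Fin N) (a : A) :
    G.evalTensor ω k (G.coactR (a • (ω q : Γ))) = a * D.J k q := by
  have key : ∀ (s : A ⊗[ℂ] A) (m : Fin N) (c : A),
      G.evalTensor ω k (mulRightTensor A Γ s ((ω m : Γ) ⊗ₜ c)) =
        if k = m then TensorProduct.lid ℂ A (Coalgebra.counit.rTensor A s) * c else 0 := by
    intro s m c
    induction s with
    | zero => simp
    | add x y hx hy =>
      simp only [map_add, LinearMap.add_apply, hx, hy, add_mul]
      split_ifs <;> simp
    | tmul a b =>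
      simp only [mulRightTensor_tmul, G.evalTensor_tmul, G.evalForm_smul, G.evalForm_basis]
      split_ifs <;> simp
  rw [G.coactR_smul, h.J_spec, map_sum, map_sum]
  simp [key]

theorem evalTensor_coactR_op (k j : Fin N) (x : A) :
    G.evalTensor ω k (G.coactR (op x • (ω j : Γ))) =
      ∑ m, D.J m j * rightAct (D.f m k) x := by
  have key : ∀ (s : A ⊗[ℂ] A) (m : Fin N) (c : A),
      G.evalTensor ω k (opRightTensor A Γ s ((ω m : Γ) ⊗ₜ c)) =
        c * TensorProduct.lid ℂ A ((D.f m k).ofConv.rTensor A s) := by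
    intro s m c
    induction s with
    | zero => simp
    | add x y hx hy => simp only [map_add, LinearMap.add_apply, hx, hy, mul_add]
    | tmul a b =>
      simp only [opRightTensor_tmul, G.evalTensor_tmul, h.evalForm_op]
      simp
  rw [G.coactR_op_smul, h.J_spec, map_sum, map_sum]
  simp only [key]
  rfl

theorem evalTensor_coactR_d (k : Fin N) (y : A) :
    G.evalTensor ω k (G.coactR (G.d y)) = rightAct (D.X k) y := by
  rw [G.coactR_d]
  simp only [rightAct, LinearMap.comp_apply]
  generalize Coalgebra.comul (R := ℂ) y = t
  induction t with
  | zero => simp only [LinearMap.map_zero]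
  | add x y hx hy => simp only [LinearMap.map_add, hx, hy]
  | tmul a b => simp [h.X_spec]

/-- `J_{mi} (x ◁ f_{mj}) = (f_{iq} ▷ x) J_{jq}`. -/
theorem J_mul_rightAct_f (i j : Fin N) (x : A) :
    ∑ m, D.J m i * rightAct (D.f m j) x = ∑ q, leftAct (D.f i q) x * D.J j q := by
  -- Both sides are the coefficient of ω_j in the right coaction of ω_i x, once by right covariance
  -- and once after x has been moved to the left.
  rw [← h.evalTensor_coactR_op, h.f_spec, map_sum, map_sum]
  simp only [h.evalTensor_coactR_smul]

/-- `y ◁ X_i = (X_k ▷ y) J_{ik}`. -/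
theorem rightAct_X (i : Fin N) (y : A) :
    rightAct (D.X i) y = ∑ k, leftAct (D.X k) y * D.J i k := by
  -- Both sides are the coefficient of ω_i in the right coaction of dy, once with the coproduct of y
  -- and once with dy expanded in the basis.
  rw [← h.evalTensor_coactR_d, h.d_eq, map_sum, map_sum]
  simp only [h.evalTensor_coactR_smul]

/-- The commutation relation of `J_mul_rightAct_f` at an entry of `J`, whose coproduct is the matrix
one. It says that the braiding matrix commutes with `J ⊗ J`, which makes the coaction on the
exterior algebra well defined. -/
theorem s_J_J (k l i j : Fin N) : ∑ m, ∑ n, D.s k l m n • (D.J m i * D.J n j) =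
    ∑ m, ∑ n, D.s m n i j • (D.J k m * D.J l n) := by
  have h1 := h.J_mul_rightAct_f i l (D.J k j)
  simp only [h.rightAct_J, h.leftAct_J, Finset.mul_sum, Finset.sum_mul, mul_smul_comm,
    smul_mul_assoc] at h1
  simp only [h.s_spec]
  rw [h1, Finset.sum_comm]

/-- The two identities `rightAct_X` and `J_mul_rightAct_f` in `A` are paired with X and with f. The
first gives the relations X-X and X-f, the second gives f-X and f-f. The structure constants enter
as values of f and X on the entries of `J`. -/
theorem quadraticRelations : D.QuadraticRelations where
  X_X i j := by
    apply WithConv.ofConv_injective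
    ext y
    have h1 := congrArg (D.X j).ofConv (h.rightAct_X i y)
    simp only [apply_rightAct, map_sum, h.X_mul, counit_leftAct, apply_leftAct,
      Finset.sum_add_distrib] at h1
    simp only [WithConv.ofConv_sub, WithConv.ofConv_sum, WithConv.ofConv_smul, LinearMap.sub_apply,
      LinearMap.sum_apply, LinearMap.smul_apply, smul_eq_mul, h.s_spec, C, h1]
    rw [sub_eq_iff_eq_add]
    congr 1
    · exact Finset.sum_congr rfl fun k _ => mul_comm _ _
    · rw [Finset.sum_comm]
      exact Finset.sum_congr rfl fun k _ => Finset.sum_congr rfl fun l _ => mul_comm _ _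
  f_f n m p q := by
    apply WithConv.ofConv_injective
    ext x
    have h1 := congrArg (D.f n q).ofConv (h.J_mul_rightAct_f m p x)
    simp only [map_sum, h.f_mul, apply_rightAct, apply_leftAct] at h1
    simp only [WithConv.ofConv_sum, WithConv.ofConv_smul, LinearMap.sum_apply,
      LinearMap.smul_apply, smul_eq_mul, h.s_spec, h1]
    rw [Finset.sum_comm]
    exact Finset.sum_congr rfl fun k _ => Finset.sum_congr rfl fun l _ => mul_comm _ _
  f_X i j k := by
    apply WithConv.ofConv_injective
    ext x
    have h1 := congrArg (D.X k).ofConv (h.J_mul_rightAct_f i j x)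
    simp only [map_sum, h.X_mul, apply_rightAct, apply_leftAct, h.counit_J, counit_leftAct,
      Finset.sum_add_distrib, ite_mul, one_mul, zero_mul, Finset.sum_ite_eq', Finset.mem_univ,
      if_true] at h1
    simp only [WithConv.ofConv_add, WithConv.ofConv_sum, WithConv.ofConv_smul, LinearMap.sum_apply,
      LinearMap.add_apply, LinearMap.smul_apply, smul_eq_mul, h.s_spec, C]
    rw [add_comm, h1, add_comm]
    congr 1
    · rw [Finset.sum_comm]
      exact Finset.sum_congr rfl fun k _ => Finset.sum_congr rfl fun l _ => mul_comm _ _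
    · exact Finset.sum_congr rfl fun k _ => mul_comm _ _
  X_f k n l := by
    apply WithConv.ofConv_injective
    ext x
    have h1 := congrArg (D.f n l).ofConv (h.rightAct_X k x)
    simp only [map_sum, h.f_mul, apply_rightAct, apply_leftAct] at h1
    simp only [WithConv.ofConv_sum, WithConv.ofConv_smul, LinearMap.sum_apply,
      LinearMap.smul_apply, smul_eq_mul, h.s_spec, h1]
    rw [Finset.sum_comm]
    exact Finset.sum_congr rfl fun k _ => Finset.sum_congr rfl fun l _ => mul_comm _ _

end Components.IsFrame

end

section

variable {A : Type*} [Ring A] [HopfAlgebra ℂ A]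
variable {Γ : Type*} [AddCommGroup Γ] [Module ℂ Γ] [Module A Γ] [Module Aᵐᵒᵖ Γ]
  [SMulCommClass A Aᵐᵒᵖ Γ] [IsScalarTower ℂ A Γ] [IsScalarTower ℂ Aᵐᵒᵖ Γ]

/-! ### Coordinates on `Γ ⊗_A Γ` -/

theorem sum_comm_pairs {N : ℕ} {M : Type*} [AddCommMonoid M]
    (F : Fin N → Fin N → Fin N → Fin N → M) :
    ∑ q, ∑ k, ∑ p, ∑ j, F q k p j = ∑ p, ∑ j, ∑ q, ∑ k, F q k p j := by
  calc _ = ∑ x : Fin N × Fin N, ∑ y : Fin N × Fin N, F x.1 x.2 y.1 y.2 := by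
        simp only [Fintype.sum_prod_type]
    _ = ∑ y : Fin N × Fin N, ∑ x : Fin N × Fin N, F x.1 x.2 y.1 y.2 := Finset.sum_comm
    _ = _ := by simp only [Fintype.sum_prod_type]

variable (A Γ) in
/-- The map `(ρ, ρ') ↦ ρ ⊗_A ρ'`. -/
def btmulHom : Γ →ₗ[ℂ] Γ →ₗ[ℂ] BalancedTensor A Γ :=
  (TensorProduct.mk ℂ Γ Γ).compr₂ (balancedRel A Γ).mkQ

@[simp] theorem btmulHom_apply (ρ ρ' : Γ) : btmulHom A Γ ρ ρ' = btmul A ρ ρ' := rfl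

theorem btmul_op_smul (a : A) (ρ ρ' : Γ) : btmul A (op a • ρ) ρ' = btmul A ρ (a • ρ') := by
  rw [← sub_eq_zero, btmul, btmul, ← map_sub, Submodule.mkQ_apply,
    Submodule.Quotient.mk_eq_zero]
  exact Submodule.subset_span ⟨a, ρ, ρ', rfl⟩

theorem biAct_btmul (a b : A) (ρ ρ' : Γ) :
    biAct Γ a b (btmul A ρ ρ') = btmul A (a • ρ) (op b • ρ') := rfl

theorem balancedTensor_hom_ext {M : Type*} [AddCommGroup M] [Module ℂ M]
    {f g : BalancedTensor A Γ →ₗ[ℂ] M} (h : ∀ ρ ρ', f (btmul A ρ ρ') = g (btmul A ρ ρ')) :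
    f = g := by
  apply Submodule.linearMap_qext
  ext ρ ρ'
  exact h ρ ρ'

namespace BicovariantCalculus

variable (G : BicovariantCalculus A Γ) {N : ℕ} (ω : Module.Basis (Fin N) ℂ G.leftInvariants)

/-- The coordinates of an element of `Γ ⊗_A Γ` with respect to the left `A`-basis
`ω_q ⊗ ω_k`. -/
def pairCoord (q k : Fin N) : BalancedTensor A Γ →ₗ[ℂ] A :=
  (balancedRel A Γ).liftQ
    (TensorProduct.lift (((opSmul A Γ).flip.compl₂ (G.formCoord ω k)).compr₂ (G.formCoord ω q)))
    (by
      rw [balancedRel, Submodule.span_le]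
      rintro _ ⟨a, ρ, ρ', rfl⟩
      simp [formCoord_smul, mul_smul])

theorem pairCoord_btmul (q k : Fin N) (ρ ρ' : Γ) :
    G.pairCoord ω q k (btmul A ρ ρ') = G.formCoord ω q (op (G.formCoord ω k ρ') • ρ) := rfl

/-- Expand the second factor in the basis, move its coefficient across the balanced tensor sign, and
expand the first factor. -/
theorem sum_pairCoord (w : BalancedTensor A Γ) :
    ∑ q, ∑ k, btmul A (G.pairCoord ω q k w • (ω q : Γ)) (ω k : Γ) = w := by
  have h : ∑ q, ∑ k, (btmulHom A Γ).flip (ω k : Γ) ∘ₗ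
      (Algebra.lsmul ℂ ℂ Γ : A →ₐ[ℂ] _).toLinearMap.flip (ω q : Γ) ∘ₗ G.pairCoord ω q k =
      LinearMap.id := by
    apply balancedTensor_hom_ext
    intro ρ ρ'
    simp only [LinearMap.sum_apply, LinearMap.comp_apply, LinearMap.flip_apply, btmulHom_apply,
      AlgHom.toLinearMap_apply, Algebra.lsmul_coe, pairCoord_btmul, LinearMap.id_apply]
    rw [Finset.sum_comm]
    conv_rhs => rw [← G.sum_formCoord_smul ω ρ', ← btmulHom_apply, map_sum]
    refine Finset.sum_congr rfl fun k _ => ?_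
    simp only [btmulHom_apply, ← btmul_op_smul]
    conv_rhs => rw [← G.sum_formCoord_smul ω (op (G.formCoord ω k ρ') • ρ), ← btmulHom_apply,
      map_sum, LinearMap.sum_apply]
    rfl
  have h2 := LinearMap.congr_fun h w
  simp only [LinearMap.sum_apply] at h2
  exact h2

theorem eq_of_pairCoord {w w' : BalancedTensor A Γ}
    (h : ∀ q k, G.pairCoord ω q k w = G.pairCoord ω q k w') : w = w' := by
  rw [← G.sum_pairCoord ω w, ← G.sum_pairCoord ω w']
  simp only [h]

theorem pairCoord_biAct_left (q k : Fin N) (a : A) (w : BalancedTensor A Γ) :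
    G.pairCoord ω q k (biAct Γ a 1 w) = a * G.pairCoord ω q k w := by
  have h : G.pairCoord ω q k ∘ₗ biAct Γ a 1 = LinearMap.mulLeft ℂ a ∘ₗ G.pairCoord ω q k := by
    apply balancedTensor_hom_ext
    intro ρ ρ'
    simp only [LinearMap.comp_apply, biAct_btmul, pairCoord_btmul, MulOpposite.op_one, one_smul,
      ← smul_comm a, formCoord_smul, LinearMap.mulLeft_apply]
  exact LinearMap.congr_fun h w

/-- Separates the two actions, so that linearity of the braiding can be tested on the left and on
the right independently. -/
theorem biAct_eq (a b : A) (w : BalancedTensor A Γ) :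
    biAct Γ a b w = biAct Γ a 1 (biAct Γ 1 b w) := by
  have h : biAct Γ a b = biAct Γ a 1 ∘ₗ biAct Γ 1 b := by
    apply balancedTensor_hom_ext
    intro ρ ρ'
    simp [biAct_btmul]
  exact LinearMap.congr_fun h w

theorem pairCoord_basis (q k i j : Fin N) : G.pairCoord ω q k (btmul A (ω i : Γ) (ω j : Γ)) =
    if q = i then (if k = j then 1 else 0) else 0 := by
  rw [pairCoord_btmul, formCoord_basis]
  split_ifs <;> simp [formCoord_basis, *]

/-- The left `A`-linear map with matrix `s` in the basis `ω_i ⊗ ω_j`. -/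
def braidOf (s : Fin N → Fin N → Fin N → Fin N → ℂ) :
    BalancedTensor A Γ →ₗ[ℂ] BalancedTensor A Γ :=
  ∑ m, ∑ n, (btmulHom A Γ).flip (ω n : Γ) ∘ₗ
    (Algebra.lsmul ℂ ℂ Γ : A →ₐ[ℂ] _).toLinearMap.flip (ω m : Γ) ∘ₗ
    (∑ q, ∑ k, s m n q k • G.pairCoord ω q k)

theorem pairCoord_smul_basis (q k m n : Fin N) (a : A) :
    G.pairCoord ω q k (btmul A (a • (ω m : Γ)) (ω n : Γ)) =
      if q = m then (if k = n then a else 0) else 0 := by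
  have h : btmul A (a • (ω m : Γ)) (ω n : Γ) = biAct Γ a 1 (btmul A (ω m : Γ) (ω n : Γ)) := by
    simp [biAct_btmul]
  rw [h, pairCoord_biAct_left, pairCoord_basis]
  split_ifs <;> simp

theorem pairCoord_braidOf (s : Fin N → Fin N → Fin N → Fin N → ℂ) (m n : Fin N)
    (w : BalancedTensor A Γ) : G.pairCoord ω m n (G.braidOf ω s w) =
      ∑ q, ∑ k, s m n q k • G.pairCoord ω q k w := by
  simp [braidOf, pairCoord_smul_basis]

end BicovariantCalculus

/-! ### Existence of the braiding -/

namespace Components.IsFrame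

variable {N : ℕ} {D : Components A Γ N} {G : BicovariantCalculus A Γ}
  {ω : Module.Basis (Fin N) ℂ G.leftInvariants} (h : D.IsFrame G ω)

include h

/-- To reach the left, b passes the second basis form and then the first, which produces the product
f_{pq} f_{jk} acting on b. -/
theorem pairCoord_biAct_right (q k : Fin N) (b : A) (w : BalancedTensor A Γ) :
    G.pairCoord ω q k (biAct Γ 1 b w) =
      ∑ p, ∑ j, G.pairCoord ω p j w * leftAct (D.f p q * D.f j k) b := by
  have h1 : G.pairCoord ω q k ∘ₗ biAct Γ 1 b =
      ∑ p, ∑ j, LinearMap.mulRight ℂ (leftAct (D.f p q * D.f j k) b) ∘ₗ G.pairCoord ω p j := by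
    apply balancedTensor_hom_ext
    intro ρ ρ'
    simp only [LinearMap.comp_apply, biAct_btmul, one_smul, G.pairCoord_btmul,
      h.formCoord_op_smul ρ', LinearMap.sum_apply, LinearMap.mulRight_apply]
    rw [Finset.sum_comm]
    rw [show op (∑ j, G.formCoord ω j ρ' * leftAct (D.f j k) b) • ρ =
        ∑ j, op (leftAct (D.f j k) b) • op (G.formCoord ω j ρ') • ρ from ?_]
    · simp only [map_sum, h.formCoord_op_smul _ (leftAct _ b), leftAct_mul]
    · rw [← opSmul_apply, map_sum, LinearMap.sum_apply]
      simp [mul_smul]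
  have h2 := LinearMap.congr_fun h1 w
  simp only [LinearMap.sum_apply] at h2
  exact h2

/-- Left linearity is built in and right linearity is the relation f-f. The exchange property comes
from right invariance of η written in coordinates. -/
theorem braidOf_isBraiding : G.IsBraiding (G.braidOf ω D.s) where
  bimodule a b w := by
    apply G.eq_of_pairCoord ω
    intro m n
    rw [BicovariantCalculus.biAct_eq, BicovariantCalculus.biAct_eq a b, G.pairCoord_braidOf,
      G.pairCoord_biAct_left]
    simp only [G.pairCoord_biAct_left, h.pairCoord_biAct_right, G.pairCoord_braidOf]
    rw [Finset.mul_sum, ← sub_eq_zero]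
    have key : ∀ p j, ∑ q, ∑ k, D.s m n q k • leftAct (D.f p q * D.f j k) b =
        ∑ q, ∑ k, D.s q k p j • leftAct (D.f q m * D.f k n) b := by
      intro p j
      simp only [← leftAct_smul, ← leftAct_sum, h.quadraticRelations.f_f p j m n]
    have e1 : ∑ q, ∑ k, D.s m n q k • (a * ∑ p, ∑ j, G.pairCoord ω p j w *
        leftAct (D.f p q * D.f j k) b) = a * ∑ p, ∑ j, G.pairCoord ω p j w *
          ∑ q, ∑ k, D.s m n q k • leftAct (D.f p q * D.f j k) b := by
      simp only [← mul_smul_comm, ← Finset.mul_sum, Finset.smul_sum]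
      congr 1
      simp only [Finset.mul_sum]
      exact sum_comm_pairs _
    have e2 : ∑ p, a * ∑ j, (∑ q, ∑ k, D.s p j q k • G.pairCoord ω q k w) *
        leftAct (D.f p m * D.f j n) b = a * ∑ p, ∑ j, G.pairCoord ω p j w *
          ∑ q, ∑ k, D.s q k p j • leftAct (D.f q m * D.f k n) b := by
      rw [← Finset.mul_sum]
      congr 1
      simp only [Finset.mul_sum, Finset.sum_mul, smul_mul_assoc, mul_smul_comm]
      exact sum_comm_pairs _
    rw [e1, e2, sub_eq_zero]
    simp only [key]
  swap := by
    intro w hw η hη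
    have hη' : G.coactR η = η ⊗ₜ 1 := hη
    -- For η = ∑ η_k ω_k, right invariance reads ∑ Δ(η_k)(1 ⊗ J_{mk}) = η_m ⊗ 1. This is its slice
    -- by `g`.
    have h1 : ∀ (g : DualAlg A) (m : Fin N), ∑ k, slice A g.ofConv
        (Coalgebra.comul (R := ℂ) (G.formCoord ω k η) * (1 ⊗ₜ D.J m k)) =
          g.ofConv 1 • G.formCoord ω m η := by
      intro g m
      have key : ∀ (s : A ⊗[ℂ] A) (j : Fin N) (c : A), (G.formCoord ω m).rTensor A
          (mulRightTensor A Γ s ((ω j : Γ) ⊗ₜ c)) = if m = j then s * (1 ⊗ₜ c) else 0 := by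
        intro s j c
        induction s with
        | zero => simp
        | add x y hx hy =>
          simp only [map_add, LinearMap.add_apply, hx, hy, add_mul]
          split_ifs <;> simp
        | tmul a b =>
          simp only [mulRightTensor_tmul, LinearMap.rTensor_tmul, G.formCoord_smul,
            G.formCoord_basis]
          split_ifs <;> simp
      have h2 := congrArg (slice A g.ofConv ∘ (G.formCoord ω m).rTensor A) hη'
      conv_lhs at h2 => rw [← G.sum_formCoord_smul ω η]
      simpa [G.coactR_smul, h.J_spec, key] using h2
    -- The slice by f_{in}: its product rule splits off the factor f_{qn}(J_{mk}), which is an entry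
    -- of the braiding matrix, and f_{in}(1) = δ_{in} gives the right side.
    have h2 : ∀ (i m n : Fin N), ∑ q, ∑ k, D.s m n q k • leftAct (D.f i q) (G.formCoord ω k η) =
        if i = n then G.formCoord ω m η else 0 := by
      intro i m n
      have key : ∀ (s : A ⊗[ℂ] A) (c : A), slice A (D.f i n).ofConv (s * (1 ⊗ₜ c)) =
          ∑ q, (D.f q n).ofConv c • slice A (D.f i q).ofConv s := by
        intro s c
        induction s with
        | zero => simp
        | add x y hx hy => simp only [add_mul, map_add, hx, hy, smul_add, Finset.sum_add_distrib]
        | tmul a b =>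
          simp only [Algebra.TensorProduct.tmul_mul_tmul, mul_one, slice_tmul, h.f_mul,
            Finset.sum_smul, ← mul_smul]
          exact Finset.sum_congr rfl fun q _ => by rw [mul_comm]
      have h3 := h1 (D.f i n) m
      simp only [key, h.f_one] at h3
      simp only [h.s_spec, leftAct_eq_slice]
      rw [Finset.sum_comm, h3]
      split_ifs <;> simp
    have h3 : ∀ i, G.braidOf ω D.s (btmul A (ω i : Γ) η) = btmul A η (ω i : Γ) := by
      intro i
      apply G.eq_of_pairCoord ω
      intro m n
      simp only [G.pairCoord_braidOf, G.pairCoord_btmul, h.formCoord_op, h2, G.formCoord_basis]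
      simp only [eq_comm (a := n)]
      split_ifs <;> simp
    have h4 := congrArg Subtype.val (ω.sum_repr ⟨w, hw⟩)
    rw [AddSubmonoidClass.coe_finsetSum] at h4
    change _ = w at h4
    rw [← h4, ← btmulHom_apply, ← btmulHom_apply]
    simp [h3]

theorem sum_op_antipode_J (m j : Fin N) : ∑ k, HopfAlgebra.antipode ℂ (D.J m k) * D.J k j =
    if m = j then 1 else 0 := by
  have h1 := HopfAlgebra.mul_antipode_rTensor_comul_apply (R := ℂ) (D.J m j)
  rw [h.comul_J, h.counit_J] at h1
  simpa [apply_ite (algebraMap ℂ A)] using h1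

theorem sum_J_antipode (m j : Fin N) : ∑ k, D.J m k * HopfAlgebra.antipode ℂ (D.J k j) =
    if m = j then 1 else 0 := by
  have h1 := HopfAlgebra.mul_antipode_lTensor_comul_apply (R := ℂ) (D.J m j)
  rw [h.comul_J, h.counit_J] at h1
  simpa [apply_ite (algebraMap ℂ A)] using h1

end Components.IsFrame

/-! ### Uniqueness of the braiding -/

namespace BicovariantCalculus.IsBraiding

variable {N : ℕ} {D : Components A Γ N} {G : BicovariantCalculus A Γ}
  {ω : Module.Basis (Fin N) ℂ G.leftInvariants}

/-- A braiding is determined by the functionals `f_{ij}` and the matrix `J`. -/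
theorem apply_basis {σ : BalancedTensor A Γ →ₗ[ℂ] BalancedTensor A Γ} (hσ : G.IsBraiding σ)
    (h : D.IsFrame G ω) (i j : Fin N) : σ (btmul A (ω i : Γ) (ω j : Γ)) =
      ∑ k, ∑ l, (D.f i l).ofConv (D.J k j) • btmul A (ω k : Γ) (ω l : Γ) := by
  -- The forms ω_m S(J_{mk}) are right invariant and give back ω_j = η_k J_{kj}. This rewrites ω_i ⊗
  -- ω_j in terms of tensors on which the exchange rule applies.
  let η : Fin N → Γ := fun k => ∑ m, op (HopfAlgebra.antipode ℂ (D.J m k)) • (ω m : Γ)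
  have hη : ∀ j, ∑ k, op (D.J k j) • η k = (ω j : Γ) := by
    intro j
    simp only [η, Finset.smul_sum, smul_smul, ← MulOpposite.op_mul]
    rw [Finset.sum_comm]
    simp only [← Finset.sum_smul, ← Finset.op_sum, h.sum_op_antipode_J]
    rw [Finset.sum_eq_single j]
    · simp
    · intro b _ hb
      simp [hb]
    · simp
  have hinv : ∀ m, η m ∈ G.rightInvariants := by
    intro m
    change G.coactR (η m) = η m ⊗ₜ 1
    -- Writes the coaction of ω_j as (η_k ⊗ 1)Δ(J_{kj}). Multiplying on the right by Δ(S(J_{jm}))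
    -- and summing over j then leaves η_m ⊗ 1.
    have h1 : ∀ j, G.coactR (ω j : Γ) =
        ∑ k, opRightTensor A Γ (Coalgebra.comul (D.J k j)) (η k ⊗ₜ 1) := by
      intro j
      simp only [h.comul_J, map_sum, LinearMap.sum_apply, opRightTensor_tmul, one_mul]
      rw [Finset.sum_comm, h.J_spec]
      simp only [← TensorProduct.sum_tmul, hη]
    have h2 : G.coactR (η m) = ∑ j, opRightTensor A Γ
        (Coalgebra.comul (HopfAlgebra.antipode ℂ (D.J j m))) (G.coactR (ω j : Γ)) := by
      simp only [η, map_sum, G.coactR_op_smul]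
    rw [h2]
    simp only [h1, map_sum, ← opRightTensor_mul, ← Bialgebra.comul_mul]
    rw [Finset.sum_comm]
    simp only [← LinearMap.sum_apply, ← map_sum, h.sum_J_antipode]
    rw [Finset.sum_eq_single m]
    · simp [Algebra.TensorProduct.one_def]
    · intro b _ hb
      simp [hb]
    · simp
  have h1 : btmul A (ω i : Γ) (ω j : Γ) =
      ∑ k, biAct Γ 1 (D.J k j) (btmul A (ω i : Γ) (η k)) := by
    simp only [biAct_btmul, one_smul]
    simp only [← btmulHom_apply]
    rw [← map_sum, hη]
  rw [h1, map_sum]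
  simp only [hσ.bimodule, hσ.swap _ (ω i).2 _ (hinv _)]
  simp only [biAct_btmul, one_smul, h.f_spec, h.leftAct_J]
  -- After the exchange, J_{kj} is moved through ω_i. The entry J_{kt} that comes out is carried
  -- over to η_k, and summing over k restores ω_t.
  have h2 : ∀ k, btmul A (η k) (∑ l, (∑ t, (D.f i l).ofConv (D.J t j) • D.J k t) • (ω l : Γ)) =
      ∑ l, ∑ t, (D.f i l).ofConv (D.J t j) • btmul A (op (D.J k t) • η k) (ω l : Γ) := by
    intro k
    simp only [← btmulHom_apply, map_sum, Finset.sum_smul, smul_assoc, map_smul]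
    simp only [btmulHom_apply, btmul_op_smul]
  simp only [h2]
  rw [Finset.sum_comm, Finset.sum_comm (f := fun k l => (D.f i l).ofConv (D.J k j) • _)]
  refine Finset.sum_congr rfl fun l _ => ?_
  rw [Finset.sum_comm]
  refine Finset.sum_congr rfl fun t _ => ?_
  rw [← Finset.smul_sum, ← hη t, ← btmulHom_apply, map_sum, LinearMap.sum_apply]
  rfl

end BicovariantCalculus.IsBraiding

/-! ### Existence and uniqueness of the components -/

namespace Components

variable {N : ℕ} {D D' : Components A Γ N} {G : BicovariantCalculus A Γ}
  {ω : Module.Basis (Fin N) ℂ G.leftInvariants}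

/-- The pairing with X_i satisfies p(aρ) = ε(a) p(ρ) and is dual to the basis, so it is the
evaluation functional; the matrix of σ is forced by `apply_basis`. -/
theorem IsFor.isFrame (h : D.IsFor G ω) : D.IsFrame G ω := by
  have hX : ∀ i y, (D.X i).ofConv y = G.evalForm ω i (G.d y) := by
    intro i y
    obtain ⟨p, hp, hp'⟩ := h.X_dual i
    have h1 : ∀ (a : A) ρ, p (a • ρ) = Coalgebra.counit (R := ℂ) a * p ρ := by
      intro a ρ
      induction ρ using G.form_induction with
      | add ρ ρ' h1 h2 => simp only [smul_add, map_add, h1, h2, mul_add]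
      | smul_d x y => rw [← mul_smul, hp, hp, Bialgebra.counit_mul, mul_assoc]
    have h2 : p = G.evalForm ω i := by
      ext ρ
      rw [← G.sum_formCoord_smul ω ρ]
      simp [h1, G.evalForm_smul, hp', G.evalForm_basis]
    rw [← h2]
    simpa using (hp 1 y).symm
  -- A frame has the formula for the structure constants built in, which is still to be shown for
  -- `D`. The constants are replaced by that formula so that `apply_basis` becomes available.
  let D₁ : Components A Γ N := { D with s := fun k l i j => (D.f i l).ofConv (D.J k j) }
  have h₁ : D₁.IsFrame G ω := ⟨h.f_spec, h.J_spec, hX, fun _ _ _ _ => rfl⟩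
  refine ⟨h.f_spec, h.J_spec, hX, fun i j k l => ?_⟩
  have h2 := h.braiding.apply_basis h₁ i j
  rw [h.s_spec] at h2
  have h3 := congrArg (Coalgebra.counit (R := ℂ) ∘ G.pairCoord ω k l) h2
  simpa [G.pairCoord_basis] using h3

theorem IsFor.pairCoord_σ (h : D.IsFor G ω) (m n : Fin N) (w : BalancedTensor A Γ) :
    G.pairCoord ω m n (D.σ w) = ∑ q, ∑ k, D.s m n q k • G.pairCoord ω q k w := by
  conv_lhs => rw [← G.sum_pairCoord ω w]
  have h1 : ∀ (a : A) (q k : Fin N), D.σ (btmul A (a • (ω q : Γ)) (ω k : Γ)) =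
      biAct Γ a 1 (∑ m, ∑ n, D.s m n q k • btmul A (ω m : Γ) (ω n : Γ)) := by
    intro a q k
    rw [← h.s_spec, ← h.braiding.bimodule, biAct_btmul]
    simp
  simp only [map_sum, h1, G.pairCoord_biAct_left, map_smul, G.pairCoord_basis]
  simp

/-- Each component is a coordinate of a form that depends only on the calculus and the basis. -/
theorem IsFor.eq (h : D.IsFor G ω) (h' : D'.IsFor G ω) : D = D' := by
  have k := h.isFrame
  have k' := h'.isFrame
  have hf : D.f = D'.f := by
    funext i j
    apply WithConv.ofConv_injective
    ext x
    rw [← k.evalForm_op, ← k'.evalForm_op]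
  have hJ : D.J = D'.J := by
    funext i j
    rw [← k.evalTensor_basis, ← k'.evalTensor_basis]
  have hX : D.X = D'.X := by
    funext i
    apply WithConv.ofConv_injective
    ext y
    rw [k.X_spec, k'.X_spec]
  have hs : D.s = D'.s := by
    funext a b c d
    rw [k.s_spec, k'.s_spec, hf, hJ]
  have hσ : D.σ = D'.σ := by
    refine LinearMap.ext fun w => ?_
    apply G.eq_of_pairCoord ω
    intro m n
    rw [h.pairCoord_σ, h'.pairCoord_σ, hs]
  cases D
  cases D'
  simp only [mk.injEq]
  exact ⟨hf, hJ, hX, hσ, hs⟩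

variable (G ω) in
/-- The components of a calculus in a basis of left invariant forms. -/
def ofCalculus : Components A Γ N where
  f i j := WithConv.toConv (G.evalForm ω j ∘ₗ (opSmul A Γ).flip (ω i : Γ))
  J j i := G.evalTensor ω j (G.coactR (ω i : Γ))
  X i := WithConv.toConv (G.evalForm ω i ∘ₗ G.d)
  σ := G.braidOf ω fun k l i j =>
    G.evalForm ω l (op (G.evalTensor ω k (G.coactR (ω j : Γ))) • (ω i : Γ))
  s k l i j := G.evalForm ω l (op (G.evalTensor ω k (G.coactR (ω j : Γ))) • (ω i : Γ))

variable (G ω) in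
theorem ofCalculus_isFrame : (ofCalculus G ω).IsFrame G ω where
  f_spec i x := by
    conv_lhs => rw [← G.sum_formCoord_smul ω (op x • (ω i : Γ))]
    refine Finset.sum_congr rfl fun j _ => ?_
    congr 1
    -- The left coaction of ω_i x is x₁ ⊗ ω_i x₂. Its coordinates therefore have the form x₁ f(x₂)
    -- with f the evaluation of ω_i x.
    rw [BicovariantCalculus.formCoord, LinearMap.comp_apply, G.coactL_op_smul,
      (G.mem_leftInvariants).1 (ω i).2, leftAct_eq_slice]
    generalize Coalgebra.comul (R := ℂ) x = t
    induction t with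
    | zero => simp
    | add x y hx hy => simp only [map_add, LinearMap.add_apply, hx, hy]
    | tmul a b => simp [ofCalculus]
  J_spec i := G.coactR_basis ω i
  X_spec i y := rfl
  s_spec i j k l := rfl

variable (G ω) in
theorem ofCalculus_isFor : (ofCalculus G ω).IsFor G ω where
  f_spec := (ofCalculus_isFrame G ω).f_spec
  J_spec := (ofCalculus_isFrame G ω).J_spec
  X_mem i := by
    refine ⟨(ofCalculus_isFrame G ω).X_one i, fun x hx => ?_⟩
    change G.evalForm ω i (G.d x) = 0
    -- The invariant part of dx is S(x₁) dx₂, which vanishes on the ideal by definition.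
    have h1 : G.invProj (G.d x) = 0 := by rw [G.invProj_d]; exact hx.2
    have h2 : LinearMap.codRestrict G.leftInvariants G.invProj G.invProj_mem (G.d x) = 0 :=
      Subtype.ext h1
    rw [BicovariantCalculus.evalForm, LinearMap.comp_apply, h2, map_zero]
  X_dual i := ⟨G.evalForm ω i, fun x y => G.evalForm_smul ω i x _, G.evalForm_basis ω i⟩
  braiding := (ofCalculus_isFrame G ω).braidOf_isBraiding
  s_spec i j := by
    apply G.eq_of_pairCoord ω
    intro m n
    change G.pairCoord ω m n (G.braidOf ω (ofCalculus G ω).s _) = _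
    rw [G.pairCoord_braidOf]
    simp [G.pairCoord_basis, apply_ite]

end Components

end

section

variable {A : Type*} [Ring A] [HopfAlgebra ℂ A]
variable {Γ : Type*} [AddCommGroup Γ] [Module ℂ Γ] [Module A Γ] [Module Aᵐᵒᵖ Γ]
  [SMulCommClass A Aᵐᵒᵖ Γ] [IsScalarTower ℂ A Γ] [IsScalarTower ℂ Aᵐᵒᵖ Γ]

/-! ### Operators that satisfy the relations of the quantum Cartan algebra -/

/-- Operators indexed by the generators of the quantum Cartan algebra, with a sign operator. -/
structure CartanOperators (N : ℕ) (M : Type*) [AddCommGroup M] [Module ℂ M] where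
  /-- the operators `X_i` -/
  X : Fin N → Module.End ℂ M
  /-- the operators `f_{ij}` -/
  f : Fin N → Fin N → Module.End ℂ M
  /-- the operators `ξ_i` -/
  xi : Fin N → Module.End ℂ M
  /-- the operator `δ` -/
  del : Module.End ℂ M
  /-- the sign operator -/
  sgn : Module.End ℂ M

namespace CartanOperators

variable {N : ℕ} {M : Type*} [AddCommGroup M] [Module ℂ M]

/-- The quadratic relations between the even operators, and the commutation relations with the sign
operator. -/
structure IsEven (P : CartanOperators N M) (D : Components A Γ N) : Prop where
  f_f : ∀ n m p q v, ∑ i, ∑ j, D.s i j n m • P.f i p (P.f j q v)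
    = ∑ i, ∑ j, D.s p q i j • P.f n i (P.f m j v)
  f_X : ∀ i j k v, ∑ m, ∑ n, D.C m n i • P.f m j (P.f n k v) + P.f i j (P.X k v)
    = ∑ p, ∑ q, D.s j k p q • P.X p (P.f i q v) + ∑ l, D.C j k l • P.f i l v
  sgn_sgn : ∀ v, P.sgn (P.sgn v) = v
  sgn_X : ∀ i v, P.sgn (P.X i v) = P.X i (P.sgn v)
  sgn_f : ∀ i j v, P.sgn (P.f i j v) = P.f i j (P.sgn v)
  sgn_xi : ∀ i v, P.sgn (P.xi i v) = -P.xi i (P.sgn v)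
  sgn_del : ∀ v, P.sgn (P.del v) = -P.del (P.sgn v)

/-- The relations that involve odd operators hold at the vector `v`. -/
structure RelAt (P : CartanOperators N M) (D : Components A Γ N) (v : M) : Prop where
  xi_xi : ∀ a : Fin N → Fin N → ℂ, (∀ k l, ∑ i, ∑ j, a i j * D.s i j k l = a k l) →
    ∑ i, ∑ j, a i j • P.xi i (P.xi j v) = 0
  xi_del : ∀ i, P.xi i (P.del v) + P.del (P.xi i v) = P.X i v
  del_del : P.del (P.del v) = 0
  xi_f : ∀ i j k, P.xi i (P.f k j v) = ∑ n, ∑ m, D.s i j n m • P.f k n (P.xi m v)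
  xi_X : ∀ i j, P.xi i (P.X j v) =
    ∑ k, ∑ l, D.s i j k l • P.X k (P.xi l v) + ∑ k, D.C i j k • P.xi k v
  f_del : ∀ i j, P.f i j (P.del v) = P.del (P.f i j v)
  X_del : ∀ i, P.X i (P.del v) = P.del (P.X i v)

/-- The relations are linear in the vector. It is therefore enough to establish them at pure
tensors, or at generators together with closure under products. -/
theorem RelAt.add {P : CartanOperators N M} {D : Components A Γ N} {v w : M}
    (hv : P.RelAt D v) (hw : P.RelAt D w) : P.RelAt D (v + w) where
  xi_xi a ha := by
    simp only [map_add, smul_add, Finset.sum_add_distrib, hv.xi_xi a ha, hw.xi_xi a ha, add_zero]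
  xi_del i := by
    simp only [map_add, ← hv.xi_del, ← hw.xi_del]; abel
  del_del := by simp only [map_add, hv.del_del, hw.del_del, add_zero]
  xi_f i j k := by
    simp only [map_add, smul_add, Finset.sum_add_distrib, hv.xi_f, hw.xi_f]
  xi_X i j := by
    simp only [map_add, smul_add, Finset.sum_add_distrib, hv.xi_X, hw.xi_X]; abel
  f_del i j := by simp only [map_add, hv.f_del, hw.f_del]
  X_del i := by simp only [map_add, hv.X_del, hw.X_del]

theorem RelAt.zero (P : CartanOperators N M) (D : Components A Γ N) : P.RelAt D 0 where
  xi_xi a ha := by simp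
  xi_del i := by simp
  del_del := by simp
  xi_f i j k := by simp
  xi_X i j := by simp
  f_del i j := by simp
  X_del i := by simp

/-- The action on a tensor square, through the coproduct. -/
def tensor (P : CartanOperators N M) : CartanOperators N (M ⊗[ℂ] M) where
  X i := TensorProduct.map LinearMap.id (P.X i) + ∑ j, TensorProduct.map (P.X j) (P.f j i)
  f i j := ∑ k, TensorProduct.map (P.f i k) (P.f k j)
  xi i := TensorProduct.map P.sgn (P.xi i) + ∑ j, TensorProduct.map (P.xi j) (P.f j i)
  del := TensorProduct.map P.sgn P.del + TensorProduct.map P.del LinearMap.id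
  sgn := TensorProduct.map P.sgn P.sgn

section Tensor

variable (P : CartanOperators N M) (v w : M)

theorem tensor_X_tmul (i : Fin N) : P.tensor.X i (v ⊗ₜ w) =
    v ⊗ₜ P.X i w + ∑ j, P.X j v ⊗ₜ[ℂ] P.f j i w := by
  simp [tensor]

theorem tensor_f_tmul (i j : Fin N) : P.tensor.f i j (v ⊗ₜ w) =
    ∑ k, P.f i k v ⊗ₜ[ℂ] P.f k j w := by
  simp [tensor]

theorem tensor_xi_tmul (i : Fin N) : P.tensor.xi i (v ⊗ₜ w) =
    P.sgn v ⊗ₜ P.xi i w + ∑ j, P.xi j v ⊗ₜ[ℂ] P.f j i w := by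
  simp [tensor]

theorem tensor_del_tmul : P.tensor.del (v ⊗ₜ w) = P.sgn v ⊗ₜ P.del w + P.del v ⊗ₜ[ℂ] w := by
  simp [tensor]

end Tensor

variable {P : CartanOperators N M} {D : Components A Γ N}

/-- The relations with odd operators are inherited by tensor squares. -/
theorem RelAt.tmul (hP : P.IsEven D) {v w : M} (hv : P.RelAt D v) (hw : P.RelAt D w) :
    P.tensor.RelAt D (v ⊗ₜ w) where
  xi_xi a ha := by
    -- The commutation of ξ with f produces the array a contracted with the braiding, which is a
    -- itself. The mixed terms will cancel by this.
    have h1 : ∀ p, ∑ i, ∑ j, a i j • P.xi i (P.f p j w) =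
        ∑ i, ∑ j, a i j • P.f p i (P.xi j w) := by
      intro p
      simp only [hw.xi_f, Finset.smul_sum, smul_smul]
      rw [sum_comm_pairs]
      simp only [← Finset.sum_smul, ha]
    -- The array in the second factor is fixed by the braiding: f-f moves the braiding to the other
    -- pair of indices, where a absorbs it. The first factor is killed by every fixed array.
    have h2 : ∑ p, ∑ q, P.xi p (P.xi q v) ⊗ₜ[ℂ]
        (∑ i, ∑ j, a i j • P.f p i (P.f q j w)) = 0 := by
      refine sum_tmul_eq_zero_of_fixed D.s _ _ hv.xi_xi fun k l => ?_
      simp only [Finset.smul_sum, smul_comm (D.s _ _ _ _) (a _ _)]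
      rw [sum_comm_pairs]
      simp only [← Finset.smul_sum, hP.f_f]
      simp only [Finset.smul_sum, smul_smul]
      rw [sum_comm_pairs]
      simp only [← Finset.sum_smul, ha]
    -- Three groups of terms, according to how many ξ act on the first factor. The minus sign in the
    -- middle group comes from moving the sign operator past ξ.
    have h3 : ∀ i j, P.tensor.xi i (P.tensor.xi j (v ⊗ₜ w)) =
        P.sgn (P.sgn v) ⊗ₜ P.xi i (P.xi j w) +
        (∑ p, P.xi p (P.sgn v) ⊗ₜ[ℂ] (P.f p i (P.xi j w) - P.xi i (P.f p j w)) +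
        ∑ p, ∑ q, P.xi p (P.xi q v) ⊗ₜ[ℂ] P.f p i (P.f q j w)) := by
      intro i j
      simp only [tensor_xi_tmul, map_add, map_sum, hP.sgn_xi, TensorProduct.neg_tmul,
        Finset.sum_add_distrib, Finset.sum_neg_distrib, TensorProduct.tmul_sub,
        Finset.sum_sub_distrib]
      rw [Finset.sum_comm (f := fun x i_1 => P.xi i_1 (P.xi x v) ⊗ₜ[ℂ] _)]
      abel
    simp only [h3, smul_add, Finset.sum_add_distrib, Finset.smul_sum, ← TensorProduct.tmul_smul]
    have e1 : ∑ i, ∑ j, P.sgn (P.sgn v) ⊗ₜ[ℂ] (a i j • P.xi i (P.xi j w)) = 0 := by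
      simp only [← TensorProduct.tmul_sum, hw.xi_xi a ha, TensorProduct.tmul_zero]
    have e2 : ∑ i, ∑ j, ∑ p, P.xi p (P.sgn v) ⊗ₜ[ℂ]
        (a i j • (P.f p i (P.xi j w) - P.xi i (P.f p j w))) = 0 := by
      rw [Finset.sum_congr rfl fun i _ => Finset.sum_comm, Finset.sum_comm]
      simp only [← TensorProduct.tmul_sum, smul_sub, Finset.sum_sub_distrib, h1, sub_self,
        TensorProduct.tmul_zero, Finset.sum_const_zero]
    have e3 : ∑ i, ∑ j, ∑ p, ∑ q, P.xi p (P.xi q v) ⊗ₜ[ℂ] (a i j • P.f p i (P.f q j w)) = 0 := by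
      rw [sum_comm_pairs, ← h2]
      simp only [TensorProduct.tmul_sum]
    rw [e1, e2, e3, add_zero, add_zero]
  xi_del i := by
    simp only [tensor_xi_tmul, tensor_del_tmul, tensor_X_tmul, map_add, map_sum, hP.sgn_xi,
      hP.sgn_del, hP.sgn_sgn, hw.f_del, ← hw.xi_del, ← hv.xi_del, TensorProduct.add_tmul,
      TensorProduct.tmul_add, TensorProduct.neg_tmul, Finset.sum_add_distrib,
      Finset.sum_neg_distrib]
    abel
  del_del := by
    simp only [tensor_del_tmul, map_add, hP.sgn_del, hv.del_del, hw.del_del,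
      TensorProduct.tmul_zero, TensorProduct.zero_tmul, TensorProduct.neg_tmul]
    abel
  xi_f i j k := by
    simp only [tensor_xi_tmul, tensor_f_tmul, map_sum, map_add, hP.sgn_f, hw.xi_f,
      hv.xi_f, Finset.sum_add_distrib, smul_add, Finset.smul_sum]
    congr 1
    · simp only [TensorProduct.tmul_sum, TensorProduct.tmul_smul]
      rw [Finset.sum_comm]
      refine Finset.sum_congr rfl fun n _ => ?_
      rw [Finset.sum_comm]
    · have h1 : ∀ r t, ∑ n, ∑ m, D.s i j n m • P.f r n (P.f t m w) =
          ∑ a, ∑ b, D.s a b r t • P.f a i (P.f b j w) := fun r t => (hP.f_f r t i j w).symm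
      have h2 : ∑ n, ∑ m, ∑ t, ∑ r, D.s i j n m •
          (P.f k r (P.xi t v) ⊗ₜ[ℂ] P.f r n (P.f t m w)) =
          ∑ r, ∑ t, P.f k r (P.xi t v) ⊗ₜ[ℂ] ∑ n, ∑ m, D.s i j n m • P.f r n (P.f t m w) := by
        rw [sum_comm_pairs, Finset.sum_comm]
        simp only [TensorProduct.tmul_sum, TensorProduct.tmul_smul]
      rw [h2]
      simp only [h1, TensorProduct.tmul_sum, TensorProduct.sum_tmul, TensorProduct.tmul_smul,
        TensorProduct.smul_tmul']
      rw [sum_comm_pairs]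
      exact Finset.sum_congr rfl fun _ _ => Finset.sum_congr rfl fun _ _ => Finset.sum_comm
  xi_X i j := by
    have h1 : P.tensor.xi i (P.tensor.X j (v ⊗ₜ w)) =
        P.sgn v ⊗ₜ P.xi i (P.X j w) + ∑ m, P.X m (P.sgn v) ⊗ₜ[ℂ] P.xi i (P.f m j w) +
        (∑ m, P.xi m v ⊗ₜ[ℂ] P.f m i (P.X j w) +
        ∑ m, ∑ n, P.xi m (P.X n v) ⊗ₜ[ℂ] P.f m i (P.f n j w)) := by
      simp only [tensor_xi_tmul, tensor_X_tmul, map_add, map_sum, hP.sgn_X,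
        Finset.sum_add_distrib]
      rw [Finset.sum_comm (f := fun x i_1 => P.xi i_1 (P.X x v) ⊗ₜ[ℂ] _)]
      abel
    have h2 : ∀ k l, P.tensor.X k (P.tensor.xi l (v ⊗ₜ w)) =
        P.sgn v ⊗ₜ P.X k (P.xi l w) + ∑ m, P.X m (P.sgn v) ⊗ₜ[ℂ] P.f m k (P.xi l w) +
        (∑ m, P.xi m v ⊗ₜ[ℂ] P.X k (P.f m l w) +
        ∑ m, ∑ n, P.X m (P.xi n v) ⊗ₜ[ℂ] P.f m k (P.f n l w)) := by
      intro k l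
      simp only [tensor_xi_tmul, tensor_X_tmul, map_add, map_sum, Finset.sum_add_distrib]
      rw [Finset.sum_comm (f := fun x i_1 => P.X i_1 (P.xi x v) ⊗ₜ[ℂ] _)]
    -- The relation f-X solved for f X. The last sum, quadratic in f, cancels the inhomogeneous
    -- terms that the relation ξ-X at `v` contributes in `h4`.
    have h3 : ∀ m, P.f m i (P.X j w) =
        ∑ k, ∑ l, D.s i j k l • P.X k (P.f m l w) + ∑ l, D.C i j l • P.f m l w -
          ∑ p, ∑ n, D.C p n m • P.f p i (P.f n j w) := by
      intro m
      rw [← hP.f_X m i j w]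
      abel
    -- The relation ξ-X at `v` creates a braiding matrix on the first factor; f-f transfers it to
    -- the indices i, j.
    have h4 : ∑ m, ∑ n, P.xi m (P.X n v) ⊗ₜ[ℂ] P.f m i (P.f n j w) =
        ∑ k, ∑ l, P.X k (P.xi l v) ⊗ₜ[ℂ] (∑ a, ∑ b, D.s i j a b • P.f k a (P.f l b w)) +
        ∑ r, P.xi r v ⊗ₜ[ℂ] ∑ m, ∑ n, D.C m n r • P.f m i (P.f n j w) := by
      simp only [hv.xi_X, TensorProduct.add_tmul, Finset.sum_add_distrib, TensorProduct.sum_tmul,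
        TensorProduct.smul_tmul, ← hP.f_f]
      congr 1
      · rw [sum_comm_pairs]
        simp only [TensorProduct.tmul_sum]
      · rw [Finset.sum_congr rfl fun m _ => Finset.sum_comm, Finset.sum_comm]
        simp only [TensorProduct.tmul_sum]
    have h5 : ∀ F : Fin N → Fin N → Fin N → M ⊗[ℂ] M,
        ∑ k, ∑ l, ∑ m, F k l m = ∑ m, ∑ k, ∑ l, F k l m := by
      intro F
      rw [Finset.sum_congr rfl fun k _ => Finset.sum_comm, Finset.sum_comm]
    rw [h1, h4]
    simp only [h2]
    simp only [h3, hw.xi_f, hw.xi_X, tensor_xi_tmul, smul_add, Finset.sum_add_distrib,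
      TensorProduct.tmul_add, TensorProduct.tmul_sub, Finset.sum_sub_distrib, Finset.smul_sum]
    rw [h5, h5 (fun k l m => _ • P.xi m v ⊗ₜ[ℂ] _), sum_comm_pairs,
      Finset.sum_comm (f := fun k m => _ • P.xi m v ⊗ₜ[ℂ] _)]
    simp only [TensorProduct.tmul_sum, TensorProduct.tmul_smul]
    abel
  f_del i j := by
    simp only [tensor_f_tmul, tensor_del_tmul, map_add, map_sum, hP.sgn_f, hv.f_del, hw.f_del,
      Finset.sum_add_distrib]
  X_del i := by
    simp only [tensor_X_tmul, tensor_del_tmul, map_add, map_sum, hP.sgn_X, hv.X_del, hw.X_del,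
      hw.f_del, Finset.sum_add_distrib]
    abel

end CartanOperators

end

section

variable {A : Type*} [Ring A] [HopfAlgebra ℂ A]
variable {Γ : Type*} [AddCommGroup Γ] [Module ℂ Γ] [Module A Γ] [Module Aᵐᵒᵖ Γ]
  [SMulCommClass A Aᵐᵒᵖ Γ] [IsScalarTower ℂ A Γ] [IsScalarTower ℂ Aᵐᵒᵖ Γ]

/-! ### The coproduct of the even subalgebra -/

/-- The left action of functionals as an algebra homomorphism. -/
def leftActHom : DualAlg A →ₐ[ℂ] Module.End ℂ A where
  toFun := leftAct
  map_one' := LinearMap.ext leftAct_one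
  map_mul' f g := LinearMap.ext (leftAct_mul f g)
  map_zero' := by ext x; simpa using leftAct_smul (0 : ℂ) (0 : DualAlg A) x
  map_add' f g := LinearMap.ext (leftAct_add f g)
  commutes' c := by
    ext x
    rw [Algebra.algebraMap_eq_smul_one, leftAct_smul, leftAct_one]
    simp

@[simp] theorem leftActHom_apply (h : DualAlg A) (x : A) : leftActHom h x = leftAct h x := rfl

/-- A tensor over an algebra of functionals is determined by its values. -/
theorem eq_of_apply_apply {U : Submodule ℂ (DualAlg A)} {z z' : U ⊗[ℂ] U}
    (h : ∀ x y : A, TensorProduct.lift (LinearMap.mk₂ ℂ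
      (fun u v : U => (u : DualAlg A).ofConv x * (v : DualAlg A).ofConv y)
      (fun _ _ _ => by simp [add_mul]) (fun _ _ _ => by simp [mul_assoc])
      (fun _ _ _ => by simp [mul_add]) (fun _ _ _ => by simp [mul_left_comm])) z =
      TensorProduct.lift (LinearMap.mk₂ ℂ
      (fun u v : U => (u : DualAlg A).ofConv x * (v : DualAlg A).ofConv y)
      (fun _ _ _ => by simp [add_mul]) (fun _ _ _ => by simp [mul_assoc])
      (fun _ _ _ => by simp [mul_add]) (fun _ _ _ => by simp [mul_left_comm])) z') : z = z' := by
  let ev (x : A) : U →ₗ[ℂ] ℂ :=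
    { toFun := fun u => (u : DualAlg A).ofConv x
      map_add' := fun _ _ => by simp
      map_smul' := fun _ _ => by simp }
  apply eq_of_slice
  intro g
  -- Evaluating a slice at x means slicing in the other leg first and then applying `g`. The
  -- comparison therefore reduces to evaluations in both legs.
  have key : ∀ (x : A) (t : U ⊗[ℂ] U), ev x (slice U g t) =
      g (TensorProduct.lid ℂ U ((ev x).rTensor U t)) := by
    intro x t
    induction t with
    | zero => simp
    | tmul u v => simp [mul_comm]
    | add x y hx hy => simp only [map_add, hx, hy]
  have key2 : ∀ (x y : A) (t : U ⊗[ℂ] U), ev y (TensorProduct.lid ℂ U ((ev x).rTensor U t)) =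
      TensorProduct.lift (LinearMap.mk₂ ℂ
      (fun u v : U => (u : DualAlg A).ofConv x * (v : DualAlg A).ofConv y)
      (fun _ _ _ => by simp [add_mul]) (fun _ _ _ => by simp [mul_assoc])
      (fun _ _ _ => by simp [mul_add]) (fun _ _ _ => by simp [mul_left_comm])) t := by
    intro x y t
    induction t with
    | zero => simp
    | tmul u v => simp; rfl
    | add x y hx hy => simp only [map_add, hx, hy]
  apply Subtype.ext
  apply WithConv.ofConv_injective
  ext x
  change ev x _ = ev x _
  rw [key, key]
  congr 1
  apply Subtype.ext
  apply WithConv.ofConv_injective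
  ext y
  change ev y _ = ev y _
  rw [key2, key2, h]

namespace Components

variable {N : ℕ} (D : Components A Γ N)

/-- The even generator `X_i` of the algebra of functionals. -/
def uX (i : Fin N) : D.evenEval.range := ⟨D.X i, FreeAlgebra.ι ℂ (.X i), by simp [evenEval]⟩

/-- The even generator `f_{ij}` of the algebra of functionals. -/
def uf (i j : Fin N) : D.evenEval.range := ⟨D.f i j, FreeAlgebra.ι ℂ (.f i j), by simp [evenEval]⟩

@[simp] theorem evenEval_X (i : Fin N) : D.evenEval (FreeAlgebra.ι ℂ (.X i)) = D.X i :=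
  FreeAlgebra.lift_ι_apply _ _

@[simp] theorem evenEval_f (i j : Fin N) : D.evenEval (FreeAlgebra.ι ℂ (.f i j)) = D.f i j :=
  FreeAlgebra.lift_ι_apply _ _

theorem evenEval_rangeRestrict_X (i : Fin N) :
    D.evenEval.rangeRestrict (FreeAlgebra.ι ℂ (.X i)) = D.uX i :=
  Subtype.ext (D.evenEval_X i)

theorem evenEval_rangeRestrict_f (i j : Fin N) :
    D.evenEval.rangeRestrict (FreeAlgebra.ι ℂ (.f i j)) = D.uf i j :=
  Subtype.ext (D.evenEval_f i j)

theorem evenAlg_le_range : D.evenAlg ≤ D.evenEval.range := by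
  refine Algebra.adjoin_le ?_
  rintro _ (⟨i, rfl⟩ | ⟨p, rfl⟩)
  · exact (D.uX i).2
  · exact (D.uf p.1 p.2).2

/-- The coproduct of a polynomial in the even generators. -/
def evenComul : FreeAlgebra ℂ (EvenGen N) →ₐ[ℂ] D.evenEval.range ⊗[ℂ] D.evenEval.range :=
  FreeAlgebra.lift ℂ fun g => match g with
    | .X i => 1 ⊗ₜ D.uX i + ∑ j, D.uX j ⊗ₜ D.uf j i
    | .f i j => ∑ k, D.uf i k ⊗ₜ D.uf k j

theorem evenComul_X (i : Fin N) : D.evenComul (FreeAlgebra.ι ℂ (.X i)) =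
    1 ⊗ₜ D.uX i + ∑ j, D.uX j ⊗ₜ[ℂ] D.uf j i := FreeAlgebra.lift_ι_apply _ _

theorem evenComul_f (i j : Fin N) : D.evenComul (FreeAlgebra.ι ℂ (.f i j)) =
    ∑ k, D.uf i k ⊗ₜ[ℂ] D.uf k j := FreeAlgebra.lift_ι_apply _ _

variable {D} {G : BicovariantCalculus A Γ} {ω : Module.Basis (Fin N) ℂ G.leftInvariants}

theorem IsFrame.leftAct_X_mul (h : D.IsFrame G ω) (j : Fin N) (x y : A) :
    leftAct (D.X j) (x * y) =
      x * leftAct (D.X j) y + ∑ k, leftAct (D.X k) x * leftAct (D.f k j) y := by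
  rw [← h.formCoord_d, G.leibniz, map_add, h.formCoord_op_smul, G.formCoord_smul, h.formCoord_d,
    add_comm]
  simp only [h.formCoord_d]

/-- The action of a tensor of functionals on a tensor. -/
def leftActTensor : D.evenEval.range ⊗[ℂ] D.evenEval.range →ₐ[ℂ] Module.End ℂ (A ⊗[ℂ] A) :=
  (Module.endTensorEndAlgHom (R := ℂ) (S := ℂ) (A := ℂ) (M := A) (N := A)).comp
    (Algebra.TensorProduct.map (leftActHom.comp D.evenEval.range.val)
      (leftActHom.comp D.evenEval.range.val))

theorem leftActTensor_tmul (u v : D.evenEval.range) (x y : A) :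
    leftActTensor (u ⊗ₜ[ℂ] v) (x ⊗ₜ y) = leftAct (u : DualAlg A) x ⊗ₜ leftAct (v : DualAlg A) y := by
  simp [leftActTensor, Module.endTensorEndAlgHom_apply]

/-- The algebra `A` is a module algebra for polynomials in the generators: h ▷ (xy) = (h₁ ▷ x)(h₂ ▷
y). It holds for the generators, and general tensors `t` are allowed so that products of polynomials
can be treated by composition. -/
theorem IsFrame.mul_leftActTensor (h : D.IsFrame G ω) (p : FreeAlgebra ℂ (EvenGen N))
    (t : A ⊗[ℂ] A) : LinearMap.mul' ℂ A (leftActTensor (D.evenComul p) t) =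
      leftAct (D.evenEval p) (LinearMap.mul' ℂ A t) := by
  induction p using FreeAlgebra.induction generalizing t with
  | grade0 c =>
    simp only [AlgHom.commutes, Module.algebraMap_end_apply, map_smul]
    rw [← leftActHom_apply, AlgHom.commutes, Module.algebraMap_end_apply]
  | mul p q hp hq => rw [map_mul, map_mul, map_mul, Module.End.mul_apply, hp, hq, leftAct_mul]
  | add p q hp hq =>
    rw [map_add, map_add, map_add, LinearMap.add_apply, map_add, hp, hq, leftAct_add]
  | grade1 g =>
    induction t with
    | zero => simp
    | add x y hx hy => simp only [map_add, hx, hy]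
    | tmul x y =>
      rcases g with i | ⟨i, j⟩
      · simp only [evenComul_X, evenEval_X, map_add, map_sum, LinearMap.add_apply,
          LinearMap.sum_apply, leftActTensor_tmul, LinearMap.mul'_apply, h.leftAct_X_mul]
        simp [uX, uf, leftAct_one]
      · simp only [evenComul_f, evenEval_f, map_sum, LinearMap.sum_apply, leftActTensor_tmul,
          LinearMap.mul'_apply, h.leftAct_f_mul]
        simp [uf]

/-- The coproduct descends from polynomials to functionals. Its value at (x, y) is ε((h₁ ▷ x)(h₂ ▷
y)) = h(xy), and tensors of functionals are separated by such values. No presentation of 𝒰 is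
needed. -/
theorem IsFrame.evenComul_congr (h : D.IsFrame G ω) {p q : FreeAlgebra ℂ (EvenGen N)}
    (hpq : D.evenEval p = D.evenEval q) : D.evenComul p = D.evenComul q := by
  refine eq_of_apply_apply (U := Subalgebra.toSubmodule D.evenEval.range) fun x y => ?_
  have key : ∀ t : D.evenEval.range ⊗[ℂ] D.evenEval.range, TensorProduct.lift (LinearMap.mk₂ ℂ
      (fun u v : D.evenEval.range => (u : DualAlg A).ofConv x * (v : DualAlg A).ofConv y)
      (fun _ _ _ => by simp [add_mul]) (fun _ _ _ => by simp [mul_assoc])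
      (fun _ _ _ => by simp [mul_add]) (fun _ _ _ => by simp [mul_left_comm])) t =
      Coalgebra.counit (R := ℂ) (LinearMap.mul' ℂ A (leftActTensor t (x ⊗ₜ y))) := by
    intro t
    induction t with
    | zero => simp
    | add x y hx hy => simp only [map_add, LinearMap.add_apply, hx, hy]
    | tmul u v => simp [leftActTensor_tmul, counit_leftAct]
  refine (key _).trans (Eq.trans ?_ (key _).symm)
  rw [h.mul_leftActTensor, h.mul_leftActTensor, hpq]

end Components

/-! ### Representations of the quantum Cartan algebra -/

namespace CartanOperators

variable {N : ℕ} {M : Type*} [AddCommGroup M] [Module ℂ M] (P : CartanOperators N M)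

/-- The evaluation of noncommutative polynomials at a family of operators. -/
def eval : FreeAlgebra ℂ (CartanGen N) →ₐ[ℂ] Module.End ℂ M :=
  FreeAlgebra.lift ℂ fun g => match g with
    | .even (.X i) => P.X i
    | .even (.f i j) => P.f i j
    | .xi i => P.xi i
    | .del => P.del

@[simp] theorem eval_gX (i : Fin N) : P.eval (Components.gX i) = P.X i :=
  FreeAlgebra.lift_ι_apply _ _
@[simp] theorem eval_gf (i j : Fin N) : P.eval (Components.gf i j) = P.f i j :=
  FreeAlgebra.lift_ι_apply _ _
@[simp] theorem eval_gxi (i : Fin N) : P.eval (Components.gxi i) = P.xi i :=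
  FreeAlgebra.lift_ι_apply _ _
@[simp] theorem eval_gdel : P.eval (Components.gdel N) = P.del :=
  FreeAlgebra.lift_ι_apply _ _

variable {P} {D : Components A Γ N}

theorem eval_rel
    (heven : ∀ p q, D.evenEval p = D.evenEval q →
      P.eval (Components.evenIncl N p) = P.eval (Components.evenIncl N q))
    (hrel : ∀ v, P.RelAt D v) ⦃x y : FreeAlgebra ℂ (CartanGen N)⦄ (h : D.CartanRel x y) :
    P.eval x = P.eval y := by
  cases h with
  | even p q h => exact heven p q h
  | xi_xi a ha => ext v; simpa using (hrel v).xi_xi a ha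
  | xi_del i => ext v; simpa using (hrel v).xi_del i
  | del_del => ext v; simpa using (hrel v).del_del
  | xi_f i j k => ext v; simpa using (hrel v).xi_f i j k
  | xi_X i j => ext v; simpa [sub_eq_iff_eq_add, add_comm] using (hrel v).xi_X i j
  | f_del i j => ext v; simpa using (hrel v).f_del i j
  | X_del i => ext v; simpa using (hrel v).X_del i

/-- The representation of the quantum Cartan algebra given by operators that satisfy its
relations. -/
def lift (heven : ∀ p q, D.evenEval p = D.evenEval q →
      P.eval (Components.evenIncl N p) = P.eval (Components.evenIncl N q))
    (hrel : ∀ v, P.RelAt D v) : D.CartanAlg →ₐ[ℂ] Module.End ℂ M :=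
  RingQuot.liftAlgHom ℂ ⟨P.eval, eval_rel heven hrel⟩

section Lift

variable (heven : ∀ p q, D.evenEval p = D.evenEval q →
      P.eval (Components.evenIncl N p) = P.eval (Components.evenIncl N q))
    (hrel : ∀ v, P.RelAt D v)

theorem lift_toCartan (p : FreeAlgebra ℂ (CartanGen N)) :
    lift heven hrel (D.toCartan p) = P.eval p :=
  RingQuot.liftAlgHom_mkAlgHom_apply _ _ (eval_rel heven hrel) p

@[simp] theorem lift_cX (i : Fin N) : lift heven hrel (D.cX i) = P.X i :=
  (lift_toCartan heven hrel _).trans (P.eval_gX i)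
@[simp] theorem lift_cf (i j : Fin N) : lift heven hrel (D.cf i j) = P.f i j :=
  (lift_toCartan heven hrel _).trans (P.eval_gf i j)
@[simp] theorem lift_cxi (i : Fin N) : lift heven hrel (D.cxi i) = P.xi i :=
  (lift_toCartan heven hrel _).trans (P.eval_gxi i)
@[simp] theorem lift_cdel : lift heven hrel D.cdel = P.del :=
  (lift_toCartan heven hrel _).trans P.eval_gdel

end Lift

end CartanOperators

namespace Components

variable {N : ℕ} (D : Components A Γ N)

theorem toCartan_evenIncl_congr {p q : FreeAlgebra ℂ (EvenGen N)}
    (h : D.evenEval p = D.evenEval q) :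
    D.toCartan (evenIncl N p) = D.toCartan (evenIncl N q) :=
  RingQuot.mkAlgHom_rel ℂ (CartanRel.even p q h)

/-- The homomorphism of the algebra of functionals to the quantum Cartan algebra. -/
def evenMap : D.evenEval.range →ₐ[ℂ] D.CartanAlg where
  -- Any polynomial that represents `u` will do: the defining relation `CartanRel.even` makes its
  -- image independent of the choice.
  toFun u := D.toCartan (evenIncl N u.2.choose)
  map_one' := by
    rw [D.toCartan_evenIncl_congr (q := 1), map_one, map_one]
    rw [map_one]; exact (1 : D.evenEval.range).2.choose_spec
  map_zero' := by
    rw [D.toCartan_evenIncl_congr (q := 0), map_zero, map_zero]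
    rw [map_zero]; exact (0 : D.evenEval.range).2.choose_spec
  map_mul' u v := by
    rw [← map_mul, ← map_mul]
    apply D.toCartan_evenIncl_congr
    rw [map_mul]
    refine (u * v).2.choose_spec.trans ?_
    exact congrArg₂ (· * ·) u.2.choose_spec.symm v.2.choose_spec.symm
  map_add' u v := by
    rw [← map_add, ← map_add]
    apply D.toCartan_evenIncl_congr
    rw [map_add]
    refine (u + v).2.choose_spec.trans ?_
    exact congrArg₂ (· + ·) u.2.choose_spec.symm v.2.choose_spec.symm
  commutes' c := by
    rw [D.toCartan_evenIncl_congr (q := algebraMap ℂ _ c), AlgHom.commutes, AlgHom.commutes]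
    rw [AlgHom.commutes]; exact (algebraMap ℂ D.evenEval.range c).2.choose_spec

theorem evenMap_eq {u : D.evenEval.range} {p : FreeAlgebra ℂ (EvenGen N)}
    (h : D.evenEval p = u) : D.evenMap u = D.toCartan (evenIncl N p) :=
  D.toCartan_evenIncl_congr (u.2.choose_spec.trans h.symm)

theorem evenMap_rangeRestrict (p : FreeAlgebra ℂ (EvenGen N)) :
    D.evenMap (D.evenEval.rangeRestrict p) = D.toCartan (evenIncl N p) := D.evenMap_eq rfl

@[simp] theorem evenMap_uX (i : Fin N) : D.evenMap (D.uX i) = D.cX i := by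
  rw [← evenEval_rangeRestrict_X, evenMap_rangeRestrict]
  simp [evenIncl, cX]

@[simp] theorem evenMap_uf (i j : Fin N) : D.evenMap (D.uf i j) = D.cf i j := by
  rw [← evenEval_rangeRestrict_f, evenMap_rangeRestrict]
  simp [evenIncl, cf]

theorem parity_evenMap (u : D.evenEval.range) : D.parity (D.evenMap u) = D.evenMap u := by
  obtain ⟨p, hp⟩ := u.2
  rw [D.evenMap_eq hp, parity_toCartan, freeParity_evenIncl]

@[simp] theorem parity_cX (i : Fin N) : D.parity (D.cX i) = D.cX i := by
  rw [cX, parity_toCartan]; simp [freeParity]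
@[simp] theorem parity_cf (i j : Fin N) : D.parity (D.cf i j) = D.cf i j := by
  rw [cf, parity_toCartan]; simp [freeParity]
@[simp] theorem parity_cxi (i : Fin N) : D.parity (D.cxi i) = -D.cxi i := by
  rw [cxi, parity_toCartan]; simp [freeParity]
@[simp] theorem parity_cdel : D.parity D.cdel = -D.cdel := by
  rw [cdel, parity_toCartan]; simp [freeParity]

theorem toCartan_surjective : Function.Surjective D.toCartan :=
  RingQuot.mkAlgHom_surjective ℂ D.CartanRel

/-- Induction on the quantum Cartan algebra by left multiplication with generators. -/
theorem cartan_induction_left {p : D.CartanAlg → Prop} (one : p 1)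
    (add : ∀ x y, p x → p y → p (x + y)) (smul : ∀ (c : ℂ) x, p x → p (c • x))
    (cX : ∀ i x, p x → p (D.cX i * x)) (cf : ∀ i j x, p x → p (D.cf i j * x))
    (cxi : ∀ i x, p x → p (D.cxi i * x)) (cdel : ∀ x, p x → p (D.cdel * x)) (x : D.CartanAlg) :
    p x := by
  obtain ⟨y, rfl⟩ := D.toCartan_surjective x
  have key : ∀ y : FreeAlgebra ℂ (CartanGen N), ∀ x, p x → p (D.toCartan y * x) := by
    intro y
    induction y using FreeAlgebra.induction with
    | grade0 c =>
      intro x hx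
      rw [AlgHom.commutes, ← Algebra.smul_def]
      exact smul c x hx
    | grade1 g =>
      rcases g with (i | ⟨i, j⟩) | i | _
      · exact cX i
      · exact cf i j
      · exact cxi i
      · exact cdel
    | mul a b ha hb =>
      intro x hx
      rw [map_mul, mul_assoc]
      exact ha _ (hb _ hx)
    | add a b ha hb =>
      intro x hx
      rw [map_add, add_mul]
      exact add _ _ (ha _ hx) (hb _ hx)
  simpa using key y 1 one

/-- Homomorphisms from the quantum Cartan algebra are determined by the generators. -/
theorem cartan_hom_ext {B : Type*} [Ring B] [Algebra ℂ B] {φ ψ : D.CartanAlg →ₐ[ℂ] B}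
    (hX : ∀ i, φ (D.cX i) = ψ (D.cX i)) (hf : ∀ i j, φ (D.cf i j) = ψ (D.cf i j))
    (hxi : ∀ i, φ (D.cxi i) = ψ (D.cxi i)) (hdel : φ D.cdel = ψ D.cdel) : φ = ψ := by
  ext x
  induction x using D.cartan_induction_left with
  | one => simp
  | add x y hx hy => simp only [map_add, hx, hy]
  | smul c x hx => simp only [map_smul, hx]
  | cX i x hx => rw [map_mul, map_mul, hx, hX]
  | cf i j x hx => rw [map_mul, map_mul, hx, hf]
  | cxi i x hx => rw [map_mul, map_mul, hx, hxi]
  | cdel x hx => rw [map_mul, map_mul, hx, hdel]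

/-! #### Relations in the quantum Cartan algebra -/

theorem toCartan_rel {x y : FreeAlgebra ℂ (CartanGen N)} (h : D.CartanRel x y) :
    D.toCartan x = D.toCartan y := RingQuot.mkAlgHom_rel ℂ h

theorem cxi_cxi (a : Fin N → Fin N → ℂ) (ha : ∀ k l, ∑ i, ∑ j, a i j * D.s i j k l = a k l) :
    ∑ i, ∑ j, a i j • (D.cxi i * D.cxi j) = 0 := by
  simpa [cxi] using D.toCartan_rel (CartanRel.xi_xi a ha)

theorem cxi_cdel (i : Fin N) : D.cxi i * D.cdel + D.cdel * D.cxi i = D.cX i := by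
  simpa [cxi, cdel, cX] using
    D.toCartan_rel (CartanRel.xi_del i)

theorem cdel_cdel : D.cdel * D.cdel = 0 := by
  simpa [cdel] using D.toCartan_rel CartanRel.del_del

theorem cxi_cf (i j k : Fin N) :
    D.cxi i * D.cf k j = ∑ n, ∑ m, D.s i j n m • (D.cf k n * D.cxi m) := by
  simpa [cxi, cf] using
    D.toCartan_rel (CartanRel.xi_f i j k)

theorem cxi_cX (i j : Fin N) : D.cxi i * D.cX j =
    ∑ k, ∑ l, D.s i j k l • (D.cX k * D.cxi l) + ∑ k, D.C i j k • D.cxi k := by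
  simpa [cxi, cX, sub_eq_iff_eq_add, add_comm] using
    D.toCartan_rel (CartanRel.xi_X i j)

theorem cf_cdel (i j : Fin N) : D.cf i j * D.cdel = D.cdel * D.cf i j := by
  simpa [cdel, cf] using
    D.toCartan_rel (CartanRel.f_del i j)

theorem cX_cdel (i : Fin N) : D.cX i * D.cdel = D.cdel * D.cX i := by
  simpa [cdel, cX] using
    D.toCartan_rel (CartanRel.X_del i)

variable {D}

/-- The quadratic relations between even generators hold in 𝒰 and are carried over by the
homomorphism `evenMap`. -/
theorem QuadraticRelations.cf_cf (h : D.QuadraticRelations) (n m p q : Fin N) :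
    ∑ i, ∑ j, D.s i j n m • (D.cf i p * D.cf j q)
      = ∑ i, ∑ j, D.s p q i j • (D.cf n i * D.cf m j) := by
  have := congrArg D.evenMap (a₁ := ∑ i, ∑ j, D.s i j n m • (D.uf i p * D.uf j q))
    (a₂ := ∑ i, ∑ j, D.s p q i j • (D.uf n i * D.uf m j))
    (Subtype.ext (by simpa [uf] using h.f_f n m p q))
  simpa using this

theorem QuadraticRelations.cf_cX (h : D.QuadraticRelations) (i j k : Fin N) :
    ∑ m, ∑ n, D.C m n i • (D.cf m j * D.cf n k) + D.cf i j * D.cX k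
      = ∑ p, ∑ q, D.s j k p q • (D.cX p * D.cf i q) + ∑ l, D.C j k l • D.cf i l := by
  have := congrArg D.evenMap
    (a₁ := ∑ m, ∑ n, D.C m n i • (D.uf m j * D.uf n k) + D.uf i j * D.uX k)
    (a₂ := ∑ p, ∑ q, D.s j k p q • (D.uX p * D.uf i q) + ∑ l, D.C j k l • D.uf i l)
    (Subtype.ext (by simpa [uf, uX] using h.f_X i j k))
  simpa using this

/-! ### The action of the quantum Cartan algebra on its tensor square -/

variable (D)

/-- Left multiplication by the generators of the quantum Cartan algebra. -/
def cartanOps : CartanOperators N D.CartanAlg where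
  X i := LinearMap.mulLeft ℂ (D.cX i)
  f i j := LinearMap.mulLeft ℂ (D.cf i j)
  xi i := LinearMap.mulLeft ℂ (D.cxi i)
  del := LinearMap.mulLeft ℂ D.cdel
  sgn := D.parity.toLinearMap

variable {D}

theorem QuadraticRelations.cartanOps_isEven (h : D.QuadraticRelations) :
    D.cartanOps.IsEven D where
  f_f n m p q v := by
    simpa [cartanOps, Finset.sum_mul, mul_assoc] using congrArg (· * v) (h.cf_cf n m p q)
  f_X i j k v := by
    simpa [cartanOps, Finset.sum_mul, add_mul, mul_assoc] using congrArg (· * v) (h.cf_cX i j k)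
  sgn_sgn v := D.parity_parity v
  sgn_X i v := by simp [cartanOps]
  sgn_f i j v := by simp [cartanOps]
  sgn_xi i v := by simp [cartanOps]
  sgn_del v := by simp [cartanOps]

theorem cartanOps_relAt (v : D.CartanAlg) : D.cartanOps.RelAt D v where
  xi_xi a ha := by
    simpa [cartanOps, Finset.sum_mul, mul_assoc] using congrArg (· * v) (D.cxi_cxi a ha)
  xi_del i := by
    simpa [cartanOps, add_mul, mul_assoc] using congrArg (· * v) (D.cxi_cdel i)
  del_del := by
    simpa [cartanOps, mul_assoc] using congrArg (· * v) D.cdel_cdel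
  xi_f i j k := by
    simpa [cartanOps, Finset.sum_mul, mul_assoc] using congrArg (· * v) (D.cxi_cf i j k)
  xi_X i j := by
    simpa [cartanOps, Finset.sum_mul, add_mul, mul_assoc] using congrArg (· * v) (D.cxi_cX i j)
  f_del i j := by
    simpa [cartanOps, mul_assoc] using congrArg (· * v) (D.cf_cdel i j)
  X_del i := by
    simpa [cartanOps, mul_assoc] using congrArg (· * v) (D.cX_cdel i)

/-- The tensor square of the algebra of functionals acts on the tensor square of the quantum Cartan
algebra. -/
def evenActTensor :
    D.evenEval.range ⊗[ℂ] D.evenEval.range →ₐ[ℂ] Module.End ℂ (D.CartanAlg ⊗[ℂ] D.CartanAlg) :=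
  (Module.endTensorEndAlgHom (R := ℂ) (S := ℂ) (A := ℂ) (M := D.CartanAlg) (N := D.CartanAlg)).comp
    (Algebra.TensorProduct.map ((Algebra.lmul ℂ _).comp D.evenMap)
      ((Algebra.lmul ℂ _).comp D.evenMap))

/-- The even operators on the tensor square factor through the coproduct of polynomials, so by
`evenComul_congr` they respect all relations of 𝒰. -/
theorem evenActTensor_evenComul (p : FreeAlgebra ℂ (EvenGen N)) :
    evenActTensor (D.evenComul p) = D.cartanOps.tensor.eval (evenIncl N p) := by
  have h : evenActTensor.comp D.evenComul = D.cartanOps.tensor.eval.comp (evenIncl N) := by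
    apply FreeAlgebra.hom_ext
    funext g
    rcases g with i | ⟨i, j⟩
    · refine TensorProduct.ext' fun x y => ?_
      have : D.cartanOps.tensor.eval (evenIncl N (FreeAlgebra.ι ℂ (.X i))) =
        D.cartanOps.tensor.X i := by simp [evenIncl]
      simp [evenComul_X, evenActTensor, Module.endTensorEndAlgHom_apply, this,
        CartanOperators.tensor_X_tmul]
      simp [cartanOps]
    · refine TensorProduct.ext' fun x y => ?_
      have : D.cartanOps.tensor.eval (evenIncl N (FreeAlgebra.ι ℂ (.f i j))) =
        D.cartanOps.tensor.f i j := by simp [evenIncl]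
      simp [evenComul_f, evenActTensor, Module.endTensorEndAlgHom_apply, this,
        CartanOperators.tensor_f_tmul]
      simp [cartanOps]
  exact DFunLike.congr_fun h p

theorem QuadraticRelations.tensor_relAt (h : D.QuadraticRelations)
    (t : D.CartanAlg ⊗[ℂ] D.CartanAlg) : D.cartanOps.tensor.RelAt D t := by
  induction t with
  | zero => exact .zero _ _
  | add x y hx hy => exact hx.add hy
  | tmul x y => exact (cartanOps_relAt x).tmul h.cartanOps_isEven (cartanOps_relAt y)

/-- The representation of the quantum Cartan algebra on its tensor square. -/
def IsFrame.tensorRep (h : D.IsFrame G ω) :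
    D.CartanAlg →ₐ[ℂ] Module.End ℂ (D.CartanAlg ⊗[ℂ] D.CartanAlg) :=
  CartanOperators.lift (P := D.cartanOps.tensor)
    (fun p q hpq => by
      rw [← evenActTensor_evenComul, ← evenActTensor_evenComul, h.evenComul_congr hpq])
    h.quadraticRelations.tensor_relAt

end Components

end

section

variable {A : Type*} [Ring A] [HopfAlgebra ℂ A]
variable {Γ : Type*} [AddCommGroup Γ] [Module ℂ Γ] [Module A Γ] [Module Aᵐᵒᵖ Γ]
  [SMulCommClass A Aᵐᵒᵖ Γ] [IsScalarTower ℂ A Γ] [IsScalarTower ℂ Aᵐᵒᵖ Γ]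

/-! ### The coproduct of the even subalgebra -/
namespace Components

variable {N : ℕ} {D : Components A Γ N} {G : BicovariantCalculus A Γ}
  {ω : Module.Basis (Fin N) ℂ G.leftInvariants}

/-! ### The coproduct of the quantum Cartan algebra -/

/-- Expresses multiplication in the graded tensor product by an operator on the plain one. The sign
rule is known for homogeneous factors only, so the factor that passes b is split into its even and
odd parts. -/
theorem of_tmul_mul_of_even (a : D.CartanAlg) {b : D.CartanAlg} (hb : D.parity b = b)
    (t : D.CartanAlg ⊗[ℂ] D.CartanAlg) :
    GradedTensorProduct.of ℂ D.grading D.grading (a ⊗ₜ b) *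
      GradedTensorProduct.of ℂ D.grading D.grading t =
    GradedTensorProduct.of ℂ D.grading D.grading
      (TensorProduct.map (LinearMap.mulLeft ℂ a) (LinearMap.mulLeft ℂ b) t) := by
  have hb' : b ∈ D.grading 0 := mem_parityGrading_zero.2 hb
  induction t with
  | zero => simp
  | add x y hx hy => simp only [LinearMap.map_add, LinearEquiv.map_add, mul_add, hx, hy]
  | tmul a' b' =>
    have h0 : (1 / 2 : ℂ) • (a' + D.parity a') ∈ D.grading 0 :=
      mem_parityGrading_zero.2 (by simp [parity_parity, add_comm])
    have h1 : (1 / 2 : ℂ) • (a' - D.parity a') ∈ D.grading 1 :=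
      mem_parityGrading_one.2 (by simp [parity_parity, ← smul_neg])
    have ha : a' = (1 / 2 : ℂ) • (a' + D.parity a') + (1 / 2 : ℂ) • (a' - D.parity a') := by
      module
    conv_lhs => rw [ha, TensorProduct.add_tmul, map_add, mul_add,
      GradedTensorProduct.tmul_zero_coe_mul_coe_tmul _ _ a ⟨b, hb'⟩ ⟨_, h0⟩ b',
      GradedTensorProduct.tmul_zero_coe_mul_coe_tmul _ _ a ⟨b, hb'⟩ ⟨_, h1⟩ b', ← map_add,
      ← TensorProduct.add_tmul, ← mul_add, ← ha]
    rfl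

/-- Passing an odd b changes the sign of the odd part, which is the parity automorphism. -/
theorem of_tmul_mul_of_odd (a : D.CartanAlg) {b : D.CartanAlg} (hb : D.parity b = -b)
    (t : D.CartanAlg ⊗[ℂ] D.CartanAlg) :
    GradedTensorProduct.of ℂ D.grading D.grading (a ⊗ₜ b) *
      GradedTensorProduct.of ℂ D.grading D.grading t =
    GradedTensorProduct.of ℂ D.grading D.grading
      (TensorProduct.map (LinearMap.mulLeft ℂ a ∘ₗ D.parity.toLinearMap)
        (LinearMap.mulLeft ℂ b) t) := by
  have hb' : b ∈ D.grading 1 := mem_parityGrading_one.2 hb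
  induction t with
  | zero => simp
  | add x y hx hy => simp only [LinearMap.map_add, LinearEquiv.map_add, mul_add, hx, hy]
  | tmul a' b' =>
    have h0 : (1 / 2 : ℂ) • (a' + D.parity a') ∈ D.grading 0 :=
      mem_parityGrading_zero.2 (by simp [parity_parity, add_comm])
    have h1 : (1 / 2 : ℂ) • (a' - D.parity a') ∈ D.grading 1 :=
      mem_parityGrading_one.2 (by simp [parity_parity, ← smul_neg])
    have ha : a' = (1 / 2 : ℂ) • (a' + D.parity a') + (1 / 2 : ℂ) • (a' - D.parity a') := by
      module
    have hp : D.parity a' =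
        (1 / 2 : ℂ) • (a' + D.parity a') - (1 / 2 : ℂ) • (a' - D.parity a') := by
      module
    have e1 : GradedTensorProduct.of ℂ D.grading D.grading (a ⊗ₜ b) *
        GradedTensorProduct.of ℂ D.grading D.grading (((1 / 2 : ℂ) • (a' - D.parity a')) ⊗ₜ b') =
        -GradedTensorProduct.of ℂ D.grading D.grading
          ((a * ((1 / 2 : ℂ) • (a' - D.parity a'))) ⊗ₜ (b * b')) := by
      rw [GradedTensorProduct.tmul_coe_mul_coe_tmul _ _ a ⟨b, hb'⟩ ⟨_, h1⟩ b', mul_one, uzpow_one,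
        Units.neg_smul, one_smul]
    have e0 := GradedTensorProduct.tmul_coe_mul_zero_coe_tmul (R := ℂ) _ _ a
      (⟨b, hb'⟩ : D.grading 1) (⟨_, h0⟩ : D.grading 0) b'
    conv_lhs => rw [ha, TensorProduct.add_tmul, map_add, mul_add, e1]
    refine (congrArg (· + _) e0).trans ?_
    rw [← sub_eq_add_neg, ← map_sub, ← TensorProduct.sub_tmul, ← mul_sub, ← hp]
    rfl

theorem of_tensor_X (i : Fin N) (t : D.CartanAlg ⊗[ℂ] D.CartanAlg) :
    GradedTensorProduct.of ℂ D.grading D.grading (D.cartanOps.tensor.X i t) =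
      GradedTensorProduct.of ℂ D.grading D.grading (1 ⊗ₜ D.cX i + ∑ j, D.cX j ⊗ₜ D.cf j i) *
        GradedTensorProduct.of ℂ D.grading D.grading t := by
  simp only [map_add, map_sum, add_mul, Finset.sum_mul, of_tmul_mul_of_even, parity_cX, parity_cf,
    CartanOperators.tensor, LinearMap.add_apply, LinearMap.sum_apply]
  simp [cartanOps, LinearMap.mulLeft_one]

theorem of_tensor_f (i j : Fin N) (t : D.CartanAlg ⊗[ℂ] D.CartanAlg) :
    GradedTensorProduct.of ℂ D.grading D.grading (D.cartanOps.tensor.f i j t) =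
      GradedTensorProduct.of ℂ D.grading D.grading (∑ k, D.cf i k ⊗ₜ D.cf k j) *
        GradedTensorProduct.of ℂ D.grading D.grading t := by
  simp only [map_sum, Finset.sum_mul, of_tmul_mul_of_even, parity_cf,
    CartanOperators.tensor, LinearMap.sum_apply]
  simp [cartanOps]

theorem of_tensor_xi (i : Fin N) (t : D.CartanAlg ⊗[ℂ] D.CartanAlg) :
    GradedTensorProduct.of ℂ D.grading D.grading (D.cartanOps.tensor.xi i t) =
      GradedTensorProduct.of ℂ D.grading D.grading (1 ⊗ₜ D.cxi i + ∑ j, D.cxi j ⊗ₜ D.cf j i) *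
        GradedTensorProduct.of ℂ D.grading D.grading t := by
  simp only [map_add, map_sum, add_mul, Finset.sum_mul, of_tmul_mul_of_even, parity_cf,
    of_tmul_mul_of_odd _ (D.parity_cxi _),
    CartanOperators.tensor, LinearMap.add_apply, LinearMap.sum_apply]
  simp [cartanOps, LinearMap.mulLeft_one]

theorem of_tensor_del (t : D.CartanAlg ⊗[ℂ] D.CartanAlg) :
    GradedTensorProduct.of ℂ D.grading D.grading (D.cartanOps.tensor.del t) =
      GradedTensorProduct.of ℂ D.grading D.grading (1 ⊗ₜ D.cdel + D.cdel ⊗ₜ 1) *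
        GradedTensorProduct.of ℂ D.grading D.grading t := by
  simp only [map_add, add_mul, of_tmul_mul_of_odd _ D.parity_cdel,
    of_tmul_mul_of_even _ (map_one D.parity), CartanOperators.tensor, LinearMap.add_apply]
  simp [cartanOps, LinearMap.mulLeft_one]

namespace IsFrame

variable (h : D.IsFrame G ω)
include h

@[simp] theorem tensorRep_cX (i : Fin N) : h.tensorRep (D.cX i) = D.cartanOps.tensor.X i :=
  CartanOperators.lift_cX _ _ i
@[simp] theorem tensorRep_cf (i j : Fin N) : h.tensorRep (D.cf i j) = D.cartanOps.tensor.f i j :=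
  CartanOperators.lift_cf _ _ i j
@[simp] theorem tensorRep_cxi (i : Fin N) : h.tensorRep (D.cxi i) = D.cartanOps.tensor.xi i :=
  CartanOperators.lift_cxi _ _ i
@[simp] theorem tensorRep_cdel : h.tensorRep D.cdel = D.cartanOps.tensor.del :=
  CartanOperators.lift_cdel _ _

/-- Each generator acts by left multiplication with its coproduct in the graded tensor product,
hence so does every element. This makes x ↦ x·(1 ⊗ 1) multiplicative. -/
theorem of_tensorRep (x : D.CartanAlg) (t : D.CartanAlg ⊗[ℂ] D.CartanAlg) :
    GradedTensorProduct.of ℂ D.grading D.grading (h.tensorRep x t) =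
      GradedTensorProduct.of ℂ D.grading D.grading (h.tensorRep x 1) *
        GradedTensorProduct.of ℂ D.grading D.grading t := by
  induction x using D.cartan_induction_left generalizing t with
  | one => simp
  | add x y hx hy => simp only [map_add, LinearMap.add_apply, add_mul, hx t, hy t]
  | smul c x hx => rw [map_smul, LinearMap.smul_apply, map_smul, hx t, LinearMap.smul_apply,
      map_smul, smul_mul_assoc]
  | cX i x hx =>
    rw [map_mul, Module.End.mul_apply, Module.End.mul_apply, tensorRep_cX, of_tensor_X,
      of_tensor_X, hx t, mul_assoc]
  | cf i j x hx =>
    rw [map_mul, Module.End.mul_apply, Module.End.mul_apply, tensorRep_cf, of_tensor_f,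
      of_tensor_f, hx t, mul_assoc]
  | cxi i x hx =>
    rw [map_mul, Module.End.mul_apply, Module.End.mul_apply, tensorRep_cxi, of_tensor_xi,
      of_tensor_xi, hx t, mul_assoc]
  | cdel x hx =>
    rw [map_mul, Module.End.mul_apply, Module.End.mul_apply, tensorRep_cdel, of_tensor_del,
      of_tensor_del, hx t, mul_assoc]

/-- The coproduct of the quantum Cartan algebra. -/
def cartanComul : D.CartanAlg →ₐ[ℂ] GradedTensorProduct ℂ D.grading D.grading :=
  AlgHom.ofLinearMap
    ((GradedTensorProduct.of ℂ D.grading D.grading).toLinearMap ∘ₗ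
      LinearMap.applyₗ 1 ∘ₗ h.tensorRep.toLinearMap)
    (by simp)
    (fun x y => by
      change GradedTensorProduct.of ℂ D.grading D.grading (h.tensorRep (x * y) 1) = _
      rw [map_mul, Module.End.mul_apply, h.of_tensorRep]
      rfl)

/-- Shows that the coproduct is even, which is needed for the grading axiom and for the sign
operators in the proof of coassociativity. -/
theorem tensorRep_parity (x : D.CartanAlg) (t : D.CartanAlg ⊗[ℂ] D.CartanAlg) :
    h.tensorRep (D.parity x) (TensorProduct.map D.parity.toLinearMap D.parity.toLinearMap t) =
      TensorProduct.map D.parity.toLinearMap D.parity.toLinearMap (h.tensorRep x t) := by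
  induction x using D.cartan_induction_left generalizing t with
  | one => simp
  | add x y hx hy => simp only [map_add, LinearMap.add_apply, hx t, hy t]
  | smul c x hx => simp only [map_smul, LinearMap.smul_apply, hx t]
  | cX i x hx =>
    rw [map_mul, map_mul, map_mul, Module.End.mul_apply, Module.End.mul_apply, hx t, parity_cX,
      tensorRep_cX]
    induction h.tensorRep x t with
    | zero => simp only [LinearMap.map_zero]
    | add u v hu hv => simp only [LinearMap.map_add, hu, hv]
    | tmul a b =>
      simp only [TensorProduct.map_tmul, CartanOperators.tensor_X_tmul, map_add, map_sum]
      simp [cartanOps]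
  | cf i j x hx =>
    rw [map_mul, map_mul, map_mul, Module.End.mul_apply, Module.End.mul_apply, hx t, parity_cf,
      tensorRep_cf]
    induction h.tensorRep x t with
    | zero => simp only [LinearMap.map_zero]
    | add u v hu hv => simp only [LinearMap.map_add, hu, hv]
    | tmul a b =>
      simp only [TensorProduct.map_tmul, CartanOperators.tensor_f_tmul, map_sum]
      simp [cartanOps]
  | cxi i x hx =>
    rw [map_mul, map_mul, map_mul, Module.End.mul_apply, Module.End.mul_apply, hx t, parity_cxi,
      map_neg, tensorRep_cxi, LinearMap.neg_apply]
    induction h.tensorRep x t with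
    | zero => simp
    | add u v hu hv => simp only [LinearMap.map_add, neg_add, hu, hv]
    | tmul a b =>
      simp only [TensorProduct.map_tmul, CartanOperators.tensor_xi_tmul, map_add, map_sum]
      simp [cartanOps, TensorProduct.tmul_neg, TensorProduct.neg_tmul, add_comm]
  | cdel x hx =>
    rw [map_mul, map_mul, map_mul, Module.End.mul_apply, Module.End.mul_apply, hx t, parity_cdel,
      map_neg, tensorRep_cdel, LinearMap.neg_apply]
    induction h.tensorRep x t with
    | zero => simp
    | add u v hu hv => simp only [LinearMap.map_add, neg_add, hu, hv]
    | tmul a b =>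
      simp only [TensorProduct.map_tmul, CartanOperators.tensor_del_tmul, map_add]
      simp [cartanOps, TensorProduct.tmul_neg, TensorProduct.neg_tmul, add_comm]

/-- The coproduct of the quantum Cartan algebra, with values in the plain tensor product. -/
def cartanComulLinear : D.CartanAlg →ₗ[ℂ] D.CartanAlg ⊗[ℂ] D.CartanAlg :=
  LinearMap.applyₗ 1 ∘ₗ h.tensorRep.toLinearMap

theorem cartanComulLinear_one : h.cartanComulLinear 1 = 1 ⊗ₜ 1 := by
  simp [cartanComulLinear, Algebra.TensorProduct.one_def]

theorem cartanComulLinear_cX (i : Fin N) (x : D.CartanAlg) :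
    h.cartanComulLinear (D.cX i * x) = D.cartanOps.tensor.X i (h.cartanComulLinear x) := by
  simp [cartanComulLinear]

theorem cartanComulLinear_cf (i j : Fin N) (x : D.CartanAlg) :
    h.cartanComulLinear (D.cf i j * x) = D.cartanOps.tensor.f i j (h.cartanComulLinear x) := by
  simp [cartanComulLinear]

theorem cartanComulLinear_cxi (i : Fin N) (x : D.CartanAlg) :
    h.cartanComulLinear (D.cxi i * x) = D.cartanOps.tensor.xi i (h.cartanComulLinear x) := by
  simp [cartanComulLinear]

theorem cartanComulLinear_cdel (x : D.CartanAlg) :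
    h.cartanComulLinear (D.cdel * x) = D.cartanOps.tensor.del (h.cartanComulLinear x) := by
  simp [cartanComulLinear]

theorem cartanComulLinear_parity (x : D.CartanAlg) : h.cartanComulLinear (D.parity x) =
    TensorProduct.map D.parity.toLinearMap D.parity.toLinearMap (h.cartanComulLinear x) := by
  have := h.tensorRep_parity x 1
  rw [Algebra.TensorProduct.one_def, TensorProduct.map_tmul] at this
  simpa [cartanComulLinear, Algebra.TensorProduct.one_def] using this

end IsFrame

end Components

end

section

variable {A : Type*} [Ring A] [HopfAlgebra ℂ A]
variable {Γ : Type*} [AddCommGroup Γ] [Module ℂ Γ] [Module A Γ] [Module Aᵐᵒᵖ Γ]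
  [SMulCommClass A Aᵐᵒᵖ Γ] [IsScalarTower ℂ A Γ] [IsScalarTower ℂ Aᵐᵒᵖ Γ]

/-! ### The coproduct of the even subalgebra -/
namespace Components

variable {N : ℕ} {D : Components A Γ N} {G : BicovariantCalculus A Γ}
  {ω : Module.Basis (Fin N) ℂ G.leftInvariants}

namespace IsFrame

/-! ### Coassociativity and the counit -/

section Coassoc

variable (h : D.IsFrame G ω)
include h

/-- The inductive step of coassociativity: Δ ⊗ id and id ⊗ Δ both carry the operator of X_i on the
square to the same operator `T` on the cube. -/
theorem coassoc_X (i : Fin N) (t : D.CartanAlg ⊗[ℂ] D.CartanAlg)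
    (ht : TensorProduct.assoc ℂ _ _ _ (h.cartanComulLinear.rTensor _ t) =
      h.cartanComulLinear.lTensor _ t) :
    TensorProduct.assoc ℂ _ _ _ (h.cartanComulLinear.rTensor _ (D.cartanOps.tensor.X i t)) =
      h.cartanComulLinear.lTensor _ (D.cartanOps.tensor.X i t) := by
  let T := TensorProduct.map (LinearMap.id (R := ℂ) (M := D.CartanAlg)) (D.cartanOps.tensor.X i) +
    ∑ j, TensorProduct.map (D.cartanOps.X j) (D.cartanOps.tensor.f j i)
  have h1 : ∀ t, h.cartanComulLinear.lTensor _ (D.cartanOps.tensor.X i t) =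
      T (h.cartanComulLinear.lTensor _ t) := by
    intro t
    induction t with
    | zero => simp only [LinearMap.map_zero]
    | add x y hx hy => simp only [LinearMap.map_add, hx, hy]
    | tmul a b =>
      simp [CartanOperators.tensor_X_tmul, T]
      simp [cartanOps, cartanComulLinear_cX, cartanComulLinear_cf]
  have h2 : ∀ t, TensorProduct.assoc ℂ _ _ _
      (h.cartanComulLinear.rTensor _ (D.cartanOps.tensor.X i t)) =
      T (TensorProduct.assoc ℂ _ _ _ (h.cartanComulLinear.rTensor _ t)) := by
    intro t
    induction t with
    | zero => simp only [LinearMap.map_zero, LinearEquiv.map_zero]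
    | add x y hx hy => simp only [LinearMap.map_add, LinearEquiv.map_add, hx, hy]
    | tmul a b =>
      have e : ∀ j, h.cartanComulLinear (D.cartanOps.X j a) =
        D.cartanOps.tensor.X j (h.cartanComulLinear a) := fun j => h.cartanComulLinear_cX j a
      simp only [CartanOperators.tensor_X_tmul, map_add, map_sum, LinearMap.rTensor_tmul, e]
      induction h.cartanComulLinear a with
      | zero => simp
      | add u v hu hv =>
        rw [TensorProduct.add_tmul, TensorProduct.add_tmul, map_add, map_add, map_add, ← hu, ← hv]
        simp only [map_add, TensorProduct.add_tmul, Finset.sum_add_distrib]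
        abel
      | tmul u v =>
        simp only [CartanOperators.tensor_X_tmul, CartanOperators.tensor_f_tmul, T,
          TensorProduct.add_tmul, TensorProduct.sum_tmul, map_add, map_sum,
          TensorProduct.assoc_tmul, LinearMap.add_apply, LinearMap.sum_apply,
          TensorProduct.map_tmul, TensorProduct.tmul_add, TensorProduct.tmul_sum,
          Finset.sum_add_distrib, LinearMap.id_apply]
        rw [Finset.sum_comm, add_assoc]
  rw [h1, h2, ht]

theorem coassoc_f (i j : Fin N) (t : D.CartanAlg ⊗[ℂ] D.CartanAlg)
    (ht : TensorProduct.assoc ℂ _ _ _ (h.cartanComulLinear.rTensor _ t) =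
      h.cartanComulLinear.lTensor _ t) :
    TensorProduct.assoc ℂ _ _ _ (h.cartanComulLinear.rTensor _ (D.cartanOps.tensor.f i j t)) =
      h.cartanComulLinear.lTensor _ (D.cartanOps.tensor.f i j t) := by
  let T := ∑ k, TensorProduct.map (D.cartanOps.f i k) (D.cartanOps.tensor.f k j)
  have h1 : ∀ t, h.cartanComulLinear.lTensor _ (D.cartanOps.tensor.f i j t) =
      T (h.cartanComulLinear.lTensor _ t) := by
    intro t
    induction t with
    | zero => simp only [LinearMap.map_zero]
    | add x y hx hy => simp only [LinearMap.map_add, hx, hy]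
    | tmul a b =>
      simp [CartanOperators.tensor_f_tmul, T]
      simp [cartanOps, cartanComulLinear_cf]
  have h2 : ∀ t, TensorProduct.assoc ℂ _ _ _
      (h.cartanComulLinear.rTensor _ (D.cartanOps.tensor.f i j t)) =
      T (TensorProduct.assoc ℂ _ _ _ (h.cartanComulLinear.rTensor _ t)) := by
    intro t
    induction t with
    | zero => simp only [LinearMap.map_zero, LinearEquiv.map_zero]
    | add x y hx hy => simp only [LinearMap.map_add, LinearEquiv.map_add, hx, hy]
    | tmul a b =>
      have e : ∀ k, h.cartanComulLinear (D.cartanOps.f i k a) =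
        D.cartanOps.tensor.f i k (h.cartanComulLinear a) := fun k => h.cartanComulLinear_cf i k a
      simp only [CartanOperators.tensor_f_tmul, map_sum, LinearMap.rTensor_tmul, e]
      induction h.cartanComulLinear a with
      | zero => simp
      | add u v hu hv =>
        rw [TensorProduct.add_tmul, map_add, map_add, ← hu, ← hv]
        simp only [map_add, TensorProduct.add_tmul, Finset.sum_add_distrib]
      | tmul u v =>
        simp only [CartanOperators.tensor_f_tmul, T,
          TensorProduct.sum_tmul, map_sum,
          TensorProduct.assoc_tmul, LinearMap.sum_apply,
          TensorProduct.map_tmul, TensorProduct.tmul_sum]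
        rw [Finset.sum_comm]
  rw [h1, h2, ht]

theorem coassoc_xi (i : Fin N) (t : D.CartanAlg ⊗[ℂ] D.CartanAlg)
    (ht : TensorProduct.assoc ℂ _ _ _ (h.cartanComulLinear.rTensor _ t) =
      h.cartanComulLinear.lTensor _ t) :
    TensorProduct.assoc ℂ _ _ _ (h.cartanComulLinear.rTensor _ (D.cartanOps.tensor.xi i t)) =
      h.cartanComulLinear.lTensor _ (D.cartanOps.tensor.xi i t) := by
  let T := TensorProduct.map D.cartanOps.sgn (D.cartanOps.tensor.xi i) +
    ∑ j, TensorProduct.map (D.cartanOps.xi j) (D.cartanOps.tensor.f j i)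
  have h1 : ∀ t, h.cartanComulLinear.lTensor _ (D.cartanOps.tensor.xi i t) =
      T (h.cartanComulLinear.lTensor _ t) := by
    intro t
    induction t with
    | zero => simp only [LinearMap.map_zero]
    | add x y hx hy => simp only [LinearMap.map_add, hx, hy]
    | tmul a b =>
      simp [CartanOperators.tensor_xi_tmul, T]
      simp [cartanOps, cartanComulLinear_cxi, cartanComulLinear_cf]
  have h2 : ∀ t, TensorProduct.assoc ℂ _ _ _
      (h.cartanComulLinear.rTensor _ (D.cartanOps.tensor.xi i t)) =
      T (TensorProduct.assoc ℂ _ _ _ (h.cartanComulLinear.rTensor _ t)) := by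
    intro t
    induction t with
    | zero => simp only [LinearMap.map_zero, LinearEquiv.map_zero]
    | add x y hx hy => simp only [LinearMap.map_add, LinearEquiv.map_add, hx, hy]
    | tmul a b =>
      have e : ∀ j, h.cartanComulLinear (D.cartanOps.xi j a) =
        D.cartanOps.tensor.xi j (h.cartanComulLinear a) := fun j => h.cartanComulLinear_cxi j a
      -- The sign operator of the first leg has to become the sign operators of two legs; this is
      -- evenness of the coproduct.
      have e' : h.cartanComulLinear (D.cartanOps.sgn a) =
        TensorProduct.map D.cartanOps.sgn D.cartanOps.sgn (h.cartanComulLinear a) :=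
        h.cartanComulLinear_parity a
      simp only [CartanOperators.tensor_xi_tmul, map_add, map_sum, LinearMap.rTensor_tmul, e, e']
      induction h.cartanComulLinear a with
      | zero => simp
      | add u v hu hv =>
        rw [TensorProduct.add_tmul, map_add, map_add, map_add, ← hu, ← hv]
        simp only [map_add, TensorProduct.add_tmul, Finset.sum_add_distrib]
        abel
      | tmul u v =>
        simp only [CartanOperators.tensor_xi_tmul, CartanOperators.tensor_f_tmul, T,
          TensorProduct.add_tmul, TensorProduct.sum_tmul, map_add, map_sum,
          TensorProduct.assoc_tmul, LinearMap.add_apply, LinearMap.sum_apply,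
          TensorProduct.map_tmul, TensorProduct.tmul_add, TensorProduct.tmul_sum,
          Finset.sum_add_distrib]
        rw [Finset.sum_comm, add_assoc]
  rw [h1, h2, ht]

theorem coassoc_del (t : D.CartanAlg ⊗[ℂ] D.CartanAlg)
    (ht : TensorProduct.assoc ℂ _ _ _ (h.cartanComulLinear.rTensor _ t) =
      h.cartanComulLinear.lTensor _ t) :
    TensorProduct.assoc ℂ _ _ _ (h.cartanComulLinear.rTensor _ (D.cartanOps.tensor.del t)) =
      h.cartanComulLinear.lTensor _ (D.cartanOps.tensor.del t) := by
  let T := TensorProduct.map D.cartanOps.sgn D.cartanOps.tensor.del +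
    TensorProduct.map D.cartanOps.del LinearMap.id
  have h1 : ∀ t, h.cartanComulLinear.lTensor _ (D.cartanOps.tensor.del t) =
      T (h.cartanComulLinear.lTensor _ t) := by
    intro t
    induction t with
    | zero => simp only [LinearMap.map_zero]
    | add x y hx hy => simp only [LinearMap.map_add, hx, hy]
    | tmul a b =>
      simp [CartanOperators.tensor_del_tmul, T]
      simp [cartanOps, cartanComulLinear_cdel]
  have h2 : ∀ t, TensorProduct.assoc ℂ _ _ _
      (h.cartanComulLinear.rTensor _ (D.cartanOps.tensor.del t)) =
      T (TensorProduct.assoc ℂ _ _ _ (h.cartanComulLinear.rTensor _ t)) := by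
    intro t
    induction t with
    | zero => simp only [LinearMap.map_zero, LinearEquiv.map_zero]
    | add x y hx hy => simp only [LinearMap.map_add, LinearEquiv.map_add, hx, hy]
    | tmul a b =>
      have e : h.cartanComulLinear (D.cartanOps.del a) =
        D.cartanOps.tensor.del (h.cartanComulLinear a) := h.cartanComulLinear_cdel a
      have e' : h.cartanComulLinear (D.cartanOps.sgn a) =
        TensorProduct.map D.cartanOps.sgn D.cartanOps.sgn (h.cartanComulLinear a) :=
        h.cartanComulLinear_parity a
      simp only [CartanOperators.tensor_del_tmul, map_add, LinearMap.rTensor_tmul, e, e']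
      induction h.cartanComulLinear a with
      | zero => simp
      | add u v hu hv =>
        rw [TensorProduct.add_tmul, map_add (TensorProduct.assoc ℂ _ _ _), map_add T, ← hu, ← hv]
        simp only [map_add, TensorProduct.add_tmul]
        abel
      | tmul u v =>
        simp only [CartanOperators.tensor_del_tmul, T,
          TensorProduct.add_tmul, map_add,
          TensorProduct.assoc_tmul, LinearMap.add_apply,
          TensorProduct.map_tmul, TensorProduct.tmul_add, LinearMap.id_apply]
        abel
  rw [h1, h2, ht]

theorem cartanComulLinear_coassoc (x : D.CartanAlg) :
    TensorProduct.assoc ℂ _ _ _ (h.cartanComulLinear.rTensor _ (h.cartanComulLinear x)) =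
      h.cartanComulLinear.lTensor _ (h.cartanComulLinear x) := by
  induction x using D.cartan_induction_left with
  | one => simp [cartanComulLinear_one]
  | add x y hx hy => simp only [LinearMap.map_add, LinearEquiv.map_add, hx, hy]
  | smul c x hx => simp only [map_smul, hx]
  | cX i x hx => rw [cartanComulLinear_cX]; exact h.coassoc_X i _ hx
  | cf i j x hx => rw [cartanComulLinear_cf]; exact h.coassoc_f i j _ hx
  | cxi i x hx => rw [cartanComulLinear_cxi]; exact h.coassoc_xi i _ hx
  | cdel x hx => rw [cartanComulLinear_cdel]; exact h.coassoc_del _ hx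

end Coassoc

/-- The operators on scalars that define the counit. -/
def counitOps (N : ℕ) : CartanOperators N ℂ where
  X _ := 0
  f i j := if i = j then 1 else 0
  xi _ := 0
  del := 0
  sgn := LinearMap.id

variable (h : D.IsFrame G ω)
include h

/-- On even polynomials the counit is evaluation of the functional at 1, so it depends only on the
functional. -/
theorem counitOps_eval (p : FreeAlgebra ℂ (EvenGen N)) :
    (counitOps N).eval (evenIncl N p) = (D.evenEval p).ofConv 1 • LinearMap.id := by
  induction p using FreeAlgebra.induction with
  | grade0 c =>
    rw [AlgHom.commutes, AlgHom.commutes, AlgHom.commutes, Algebra.algebraMap_eq_smul_one,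
      Algebra.algebraMap_eq_smul_one, WithConv.ofConv_smul, LinearMap.smul_apply, dual_one_apply]
    simp [Module.End.one_eq_id]
  | grade1 g =>
    rcases g with i | ⟨i, j⟩
    · have : evenIncl N (FreeAlgebra.ι ℂ (.X i)) = gX i := FreeAlgebra.lift_ι_apply _ _
      rw [this, CartanOperators.eval_gX, evenEval_X, h.X_one, zero_smul]; rfl
    · have : evenIncl N (FreeAlgebra.ι ℂ (.f i j)) = gf i j := FreeAlgebra.lift_ι_apply _ _
      rw [this, CartanOperators.eval_gf, evenEval_f, h.f_one, ite_smul, one_smul, zero_smul]; rfl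
  | mul p q hp hq =>
    rw [map_mul, map_mul, map_mul, hp, hq, dual_mul_apply, Bialgebra.comul_one,
      Algebra.TensorProduct.one_def]
    ext
    simp [mul_comm]
  | add p q hp hq =>
    rw [map_add, map_add, map_add, hp, hq, WithConv.ofConv_add, LinearMap.add_apply, add_smul]

theorem counitOps_relAt (v : ℂ) : (counitOps N).RelAt D v := by
  constructor <;> intros <;> simp [counitOps]

/-- The counit of the quantum Cartan algebra. -/
def cartanCounit : D.CartanAlg →ₐ[ℂ] ℂ :=
  AlgHom.ofLinearMap
    (LinearMap.applyₗ 1 ∘ₗ (CartanOperators.lift (P := (counitOps N))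
      (fun p q hpq => by rw [h.counitOps_eval, h.counitOps_eval, hpq])
      h.counitOps_relAt).toLinearMap)
    (by simp)
    (fun x y => by
      simp only [LinearMap.comp_apply, AlgHom.toLinearMap_apply, map_mul,
        LinearMap.applyₗ_apply_apply, Module.End.mul_apply]
      -- Endomorphisms of ℂ are scalars, so a representation on ℂ is a character.
      have key : ∀ u v : Module.End ℂ ℂ, u (v 1) = u 1 * v 1 := fun u v => by
        conv_lhs => rw [← mul_one (v 1), ← smul_eq_mul, map_smul, smul_eq_mul, mul_comm]
      exact key _ _)

@[simp] theorem cartanCounit_cX (i : Fin N) : h.cartanCounit (D.cX i) = 0 := by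
  simp [cartanCounit]; rfl
@[simp] theorem cartanCounit_cf (i j : Fin N) :
    h.cartanCounit (D.cf i j) = if i = j then 1 else 0 := by
  simp [cartanCounit, counitOps]; split <;> rfl
@[simp] theorem cartanCounit_cxi (i : Fin N) : h.cartanCounit (D.cxi i) = 0 := by
  simp [cartanCounit]; rfl
@[simp] theorem cartanCounit_cdel : h.cartanCounit D.cdel = 0 := by
  simp [cartanCounit]; rfl

@[simp] theorem cartanCounit_parity (x : D.CartanAlg) :
    h.cartanCounit (D.parity x) = h.cartanCounit x := by
  have : h.cartanCounit.comp D.parity = h.cartanCounit := by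
    apply D.cartan_hom_ext <;> simp
  exact DFunLike.congr_fun this x

theorem cartanCounit_left (x : D.CartanAlg) : TensorProduct.lid ℂ _
    (h.cartanCounit.toLinearMap.rTensor _ (h.cartanComulLinear x)) = x := by
  -- Contraction with the counit should turn the operator `F` of a generator into left
  -- multiplication by that generator; pure tensors suffice.
  have key : ∀ (F : D.CartanAlg ⊗[ℂ] D.CartanAlg →ₗ[ℂ] D.CartanAlg ⊗[ℂ] D.CartanAlg)
      (g : D.CartanAlg), (∀ a b, TensorProduct.lid ℂ _ (h.cartanCounit.toLinearMap.rTensor _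
        (F (a ⊗ₜ b))) = h.cartanCounit a • (g * b)) → ∀ t,
      TensorProduct.lid ℂ _ (h.cartanCounit.toLinearMap.rTensor _ (F t)) =
        g * TensorProduct.lid ℂ _ (h.cartanCounit.toLinearMap.rTensor _ t) := by
    intro F g hF t
    induction t with
    | zero => simp
    | add x y hx hy => simp only [map_add, hx, hy, mul_add]
    | tmul a b => simp [hF]
  induction x using D.cartan_induction_left with
  | one => simp [cartanComulLinear_one]
  | add x y hx hy => simp only [LinearMap.map_add, LinearEquiv.map_add, hx, hy]
  | smul c x hx => simp only [map_smul, hx]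
  | cX i x hx =>
    rw [cartanComulLinear_cX, key _ (D.cX i), hx]
    intro a b
    rw [CartanOperators.tensor_X_tmul]
    simp [cartanOps]
  | cf i j x hx =>
    rw [cartanComulLinear_cf, key _ (D.cf i j), hx]
    intro a b
    rw [CartanOperators.tensor_f_tmul]
    simp [cartanOps]
  | cxi i x hx =>
    rw [cartanComulLinear_cxi, key _ (D.cxi i), hx]
    intro a b
    rw [CartanOperators.tensor_xi_tmul]
    simp [cartanOps]
  | cdel x hx =>
    rw [cartanComulLinear_cdel, key _ D.cdel, hx]
    intro a b
    rw [CartanOperators.tensor_del_tmul]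
    simp [cartanOps]

theorem cartanCounit_right (x : D.CartanAlg) : TensorProduct.rid ℂ _
    (h.cartanCounit.toLinearMap.lTensor _ (h.cartanComulLinear x)) = x := by
  have key : ∀ (F : D.CartanAlg ⊗[ℂ] D.CartanAlg →ₗ[ℂ] D.CartanAlg ⊗[ℂ] D.CartanAlg)
      (g : D.CartanAlg), (∀ a b, TensorProduct.rid ℂ _ (h.cartanCounit.toLinearMap.lTensor _
        (F (a ⊗ₜ b))) = h.cartanCounit b • (g * a)) → ∀ t,
      TensorProduct.rid ℂ _ (h.cartanCounit.toLinearMap.lTensor _ (F t)) =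
        g * TensorProduct.rid ℂ _ (h.cartanCounit.toLinearMap.lTensor _ t) := by
    intro F g hF t
    induction t with
    | zero => simp
    | add x y hx hy => simp only [map_add, hx, hy, mul_add]
    | tmul a b => simp [hF]
  induction x using D.cartan_induction_left with
  | one => simp [cartanComulLinear_one]
  | add x y hx hy => simp only [LinearMap.map_add, LinearEquiv.map_add, hx, hy]
  | smul c x hx => simp only [map_smul, hx]
  | cX i x hx =>
    rw [cartanComulLinear_cX, key _ (D.cX i), hx]
    intro a b
    rw [CartanOperators.tensor_X_tmul]
    simp [cartanOps]
  | cf i j x hx =>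
    rw [cartanComulLinear_cf, key _ (D.cf i j), hx]
    intro a b
    rw [CartanOperators.tensor_f_tmul]
    simp [cartanOps]
  | cxi i x hx =>
    rw [cartanComulLinear_cxi, key _ (D.cxi i), hx]
    intro a b
    rw [CartanOperators.tensor_xi_tmul]
    simp [cartanOps]
  | cdel x hx =>
    rw [cartanComulLinear_cdel, key _ D.cdel, hx]
    intro a b
    rw [CartanOperators.tensor_del_tmul]
    simp [cartanOps]

end IsFrame

end Components

end

section

variable {A : Type*} [Ring A] [HopfAlgebra ℂ A]
variable {Γ : Type*} [AddCommGroup Γ] [Module ℂ Γ] [Module A Γ] [Module Aᵐᵒᵖ Γ]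
  [SMulCommClass A Aᵐᵒᵖ Γ] [IsScalarTower ℂ A Γ] [IsScalarTower ℂ Aᵐᵒᵖ Γ]

/-! ### The coproduct of the even subalgebra -/
namespace Components

variable {N : ℕ} {D : Components A Γ N} {G : BicovariantCalculus A Γ}
  {ω : Module.Basis (Fin N) ℂ G.leftInvariants}

/-! ### The antipode of the quantum Cartan algebra -/

section FunctionalAntipode

variable (h : D.IsFrame G ω)
include h

/-- Evaluate f_{ij} on x₁ S(x₂) = ε(x) 1 and use the matrix product rule. The entries f ∘ S form the
inverse matrix. -/
theorem IsFrame.sum_f_mul_antipode (i j : Fin N) :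
    ∑ k, D.f i k * dualAntipode (D.f k j) = if i = j then 1 else 0 := by
  apply WithConv.ofConv_injective
  ext x
  have key : ∀ t : A ⊗[ℂ] A, ∑ k, LinearMap.mul' ℂ ℂ (TensorProduct.map (D.f i k).ofConv
      (dualAntipode (D.f k j)).ofConv t) =
      (D.f i j).ofConv (LinearMap.mul' ℂ A ((HopfAlgebra.antipode ℂ).lTensor A t)) := by
    intro t
    induction t with
    | zero => simp
    | tmul a b => simp [h.f_mul, dualAntipode_apply]
    | add x y hx hy => simp only [map_add, ← hx, ← hy, Finset.sum_add_distrib]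
  have e := key (Coalgebra.comul x)
  rw [HopfAlgebra.mul_antipode_lTensor_comul_apply, Algebra.algebraMap_eq_smul_one, map_smul,
    h.f_one] at e
  simp only [← dual_mul_apply] at e
  rw [WithConv.ofConv_sum, LinearMap.sum_apply, e]
  split <;> simp

theorem IsFrame.sum_antipode_mul_f (i j : Fin N) :
    ∑ k, dualAntipode (D.f i k) * D.f k j = if i = j then 1 else 0 := by
  apply WithConv.ofConv_injective
  ext x
  have key : ∀ t : A ⊗[ℂ] A, ∑ k, LinearMap.mul' ℂ ℂ (TensorProduct.map
      (dualAntipode (D.f i k)).ofConv (D.f k j).ofConv t) =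
      (D.f i j).ofConv (LinearMap.mul' ℂ A ((HopfAlgebra.antipode ℂ).rTensor A t)) := by
    intro t
    induction t with
    | zero => simp
    | tmul a b => simp [h.f_mul, dualAntipode_apply]
    | add x y hx hy => simp only [map_add, ← hx, ← hy, Finset.sum_add_distrib]
  have e := key (Coalgebra.comul x)
  rw [HopfAlgebra.mul_antipode_rTensor_comul_apply, Algebra.algebraMap_eq_smul_one, map_smul,
    h.f_one] at e
  simp only [← dual_mul_apply] at e
  rw [WithConv.ofConv_sum, LinearMap.sum_apply, e]
  split <;> simp

/-- Evaluate X_i on x₁ S(x₂) = ε(x) 1, where X_i(1) = 0, with the twisted Leibniz rule. Hence X_i ∘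
S lies in 𝒰 as soon as the f ∘ S do. -/
theorem IsFrame.dualAntipode_X (i : Fin N) :
    dualAntipode (D.X i) = -∑ j, D.X j * dualAntipode (D.f j i) := by
  rw [eq_neg_iff_add_eq_zero]
  apply WithConv.ofConv_injective
  ext x
  have key : ∀ t : A ⊗[ℂ] A,
      (dualAntipode (D.X i)).ofConv (TensorProduct.lid ℂ A (Coalgebra.counit.rTensor A t)) +
      ∑ k, LinearMap.mul' ℂ ℂ (TensorProduct.map (D.X k).ofConv
      (dualAntipode (D.f k i)).ofConv t) =
      (D.X i).ofConv (LinearMap.mul' ℂ A ((HopfAlgebra.antipode ℂ).lTensor A t)) := by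
    intro t
    induction t with
    | zero => simp
    | tmul a b => simp [h.X_mul, dualAntipode_apply]
    | add x y hx hy =>
      simp only [map_add, ← hx, ← hy, Finset.sum_add_distrib]
      abel
  have e := key (Coalgebra.comul x)
  rw [HopfAlgebra.mul_antipode_lTensor_comul_apply, Algebra.algebraMap_eq_smul_one, map_smul,
    h.X_one, smul_zero, Coalgebra.rTensor_counit_comul] at e
  simp only [← dual_mul_apply, TensorProduct.lid_tmul, one_smul] at e
  rw [WithConv.ofConv_add, WithConv.ofConv_sum, LinearMap.add_apply, LinearMap.sum_apply, e]
  rfl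

end FunctionalAntipode

variable (hS : D.SCompatible)

/-- The element `f_{ij} ∘ S` of the algebra of functionals. -/
def uSf (i j : Fin N) : D.evenEval.range := ⟨dualAntipode (D.f i j), D.evenAlg_le_range (hS i j)⟩

/-- The antipode of `f_{ij}` in the quantum Cartan algebra. -/
def cSf (i j : Fin N) : D.CartanAlg := D.evenMap (D.uSf hS i j)

theorem evenMap_neg (u : D.evenEval.range) : D.evenMap (-u) = -D.evenMap u := by
  have e : -u + u = 0 := neg_add_cancel u
  rw [eq_neg_iff_add_eq_zero, ← map_add]
  exact (congrArg D.evenMap e).trans (map_zero _)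

@[simp] theorem parity_cSf (i j : Fin N) : D.parity (D.cSf hS i j) = D.cSf hS i j :=
  D.parity_evenMap _

/-- The antipode of `X_i`, up to sign. -/
def cSX (i : Fin N) : D.CartanAlg := ∑ j, D.cX j * D.cSf hS j i

/-- The antipode of `ξ_i`, up to sign. -/
def cSxi (i : Fin N) : D.CartanAlg := ∑ j, D.cxi j * D.cSf hS j i

/-- δ commutes with the even generators; the general form is needed for the elements f ∘ S. -/
theorem evenMap_mul_cdel (u : D.evenEval.range) : D.evenMap u * D.cdel = D.cdel * D.evenMap u := by
  obtain ⟨p, hp⟩ := u.2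
  rw [D.evenMap_eq hp]
  clear hp
  induction p using FreeAlgebra.induction with
  | grade0 c => simp only [AlgHom.commutes, Algebra.commutes]
  | grade1 g =>
    rcases g with i | ⟨i, j⟩
    · have : evenIncl N (FreeAlgebra.ι ℂ (.X i)) = gX i := FreeAlgebra.lift_ι_apply _ _
      rw [this]; exact D.cX_cdel i
    · have : evenIncl N (FreeAlgebra.ι ℂ (.f i j)) = gf i j := FreeAlgebra.lift_ι_apply _ _
      rw [this]; exact D.cf_cdel i j
  | mul p q hp hq => rw [map_mul, map_mul, mul_assoc, hq, ← mul_assoc, hp, mul_assoc]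
  | add p q hp hq => rw [map_add, map_add, add_mul, mul_add, hp, hq]

namespace IsFrame

variable (h : D.IsFrame G ω)
include h

theorem sum_cf_cSf (i j : Fin N) : ∑ k, D.cf i k * D.cSf hS k j = if i = j then 1 else 0 := by
  have := congrArg D.evenMap (a₁ := ∑ k, D.uf i k * D.uSf hS k j) (a₂ := if i = j then 1 else 0)
    (Subtype.ext (by
      rw [apply_ite Subtype.val]
      simpa [uf, uSf] using h.sum_f_mul_antipode i j))
  rw [map_sum, apply_ite D.evenMap] at this
  simpa [cSf] using this

theorem sum_cSf_cf (i j : Fin N) : ∑ k, D.cSf hS i k * D.cf k j = if i = j then 1 else 0 := by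
  have := congrArg D.evenMap (a₁ := ∑ k, D.uSf hS i k * D.uf k j) (a₂ := if i = j then 1 else 0)
    (Subtype.ext (by
      rw [apply_ite Subtype.val]
      simpa [uf, uSf] using h.sum_antipode_mul_f i j))
  rw [map_sum, apply_ite D.evenMap] at this
  simpa [cSf] using this

-- The transposed antipode reverses products, so stability of 𝒰 need only be tested on generators.
include hS in
theorem dualAntipode_mem (p : FreeAlgebra ℂ (EvenGen N)) :
    dualAntipode (D.evenEval p) ∈ D.evenEval.range := by
  induction p using FreeAlgebra.induction with
  | grade0 c =>
    rw [AlgHom.commutes, Algebra.algebraMap_eq_smul_one]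
    exact D.evenEval.range.smul_mem (dualAntipode_one (A := A) ▸ one_mem _) c
  | grade1 g =>
    rcases g with i | ⟨i, j⟩
    · rw [evenEval_X, h.dualAntipode_X]
      exact neg_mem (sum_mem fun j _ => mul_mem (D.uX j).2 (D.uSf hS j i).2)
    · rw [evenEval_f]
      exact (D.uSf hS i j).2
  | mul p q hp hq => rw [map_mul, dualAntipode_mul]; exact mul_mem hq hp
  | add p q hp hq => rw [map_add]; exact add_mem hp hq

/-- The relation f-f after the transposed antipode, which reverses each product. -/
theorem cSf_cSf (n m p q : Fin N) :
    ∑ i, ∑ j, D.s i j n m • (D.cSf hS j q * D.cSf hS i p)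
      = ∑ i, ∑ j, D.s p q i j • (D.cSf hS m j * D.cSf hS n i) := by
  have e := congrArg dualAntipodeLinear (h.quadraticRelations.f_f n m p q)
  simp only [map_sum, map_smul] at e
  simp only [dualAntipodeLinear_apply, dualAntipode_mul] at e
  have := congrArg D.evenMap
    (a₁ := ∑ i, ∑ j, D.s i j n m • (D.uSf hS j q * D.uSf hS i p))
    (a₂ := ∑ i, ∑ j, D.s p q i j • (D.uSf hS m j * D.uSf hS n i))
    (Subtype.ext (by simpa [uSf] using e))
  simpa [cSf] using this

theorem cSX_cSf (i j k : Fin N) :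
    ∑ m, ∑ n, D.C m n i • (D.cSf hS n k * D.cSf hS m j) - D.cSX hS k * D.cSf hS i j
      = -∑ p, ∑ q, D.s j k p q • (D.cSf hS i q * D.cSX hS p) + ∑ l, D.C j k l • D.cSf hS i l := by
  have e := congrArg dualAntipodeLinear (h.quadraticRelations.f_X i j k)
  simp only [map_add, map_sum, map_smul] at e
  simp only [dualAntipodeLinear_apply, dualAntipode_mul, h.dualAntipode_X] at e
  have := congrArg D.evenMap
    (a₁ := ∑ m, ∑ n, D.C m n i • (D.uSf hS n k * D.uSf hS m j) +
      -(∑ r, D.uX r * D.uSf hS r k) * D.uSf hS i j)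
    (a₂ := ∑ p, ∑ q, D.s j k p q • (D.uSf hS i q * -(∑ r, D.uX r * D.uSf hS r p)) +
      ∑ l, D.C j k l • D.uSf hS i l)
    (Subtype.ext (by simpa [uSf, uX] using e))
  simpa [cSf, cSX, sub_eq_add_neg, evenMap_neg] using this

/-- The relation ξ-f multiplied on both sides by the inverse matrix S(f). -/
theorem cSf_cxi (l r i : Fin N) : D.cSf hS l r * D.cxi i =
    ∑ j, ∑ m, D.s i j l m • (D.cxi m * D.cSf hS j r) := by
  have e1 : ∑ j, ∑ k, D.cSf hS l k * (D.cxi i * D.cf k j) * D.cSf hS j r =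
      D.cSf hS l r * D.cxi i := by
    rw [Finset.sum_comm]
    simp only [mul_assoc, ← Finset.mul_sum, h.sum_cf_cSf]
    simp
  have e2 : ∀ j m, ∑ k, ∑ n, D.s i j n m • (D.cSf hS l k * (D.cf k n * D.cxi m)) =
      D.s i j l m • D.cxi m := by
    intro j m
    rw [Finset.sum_comm]
    simp only [← mul_assoc, ← Finset.smul_sum, ← Finset.sum_mul, h.sum_cSf_cf]
    simp
  rw [← e1]
  refine Finset.sum_congr rfl fun j _ => ?_
  simp only [D.cxi_cf, Finset.mul_sum, Finset.sum_mul, mul_smul_comm, smul_mul_assoc]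
  rw [Finset.sum_congr rfl fun k _ => Finset.sum_comm, Finset.sum_comm]
  refine Finset.sum_congr rfl fun m _ => ?_
  rw [← smul_mul_assoc, ← e2]
  simp only [Finset.sum_mul, smul_mul_assoc]

theorem cSf_cSxi (k j i : Fin N) : D.cSf hS k j * D.cSxi hS i =
    ∑ n, ∑ m, D.s i j n m • (D.cSxi hS m * D.cSf hS k n) := by
  have e : D.cSf hS k j * D.cSxi hS i = ∑ m, D.cxi m *
      ∑ p, ∑ q, D.s p q k m • (D.cSf hS q j * D.cSf hS p i) := by
    simp only [cSxi, Finset.mul_sum, ← mul_assoc, h.cSf_cxi, Finset.sum_mul, smul_mul_assoc,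
      mul_smul_comm]
    rw [Finset.sum_congr rfl fun k _ => Finset.sum_comm, Finset.sum_comm]
  rw [e]
  simp only [h.cSf_cSf, cSxi, Finset.mul_sum, Finset.sum_mul, Finset.smul_sum, mul_smul_comm,
    mul_assoc]
  rw [Finset.sum_comm]
  exact Finset.sum_congr rfl fun _ _ => Finset.sum_comm

/-- All ξ are collected on the left. Their coefficients, quadratic in S(f), form an array fixed by
the braiding by `cSf_cSf`, so the quadratic relations between the ξ apply. -/
theorem sum_cSxi_cSxi (a : Fin N → Fin N → ℂ)
    (ha : ∀ k l, ∑ i, ∑ j, a i j * D.s i j k l = a k l) :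
    ∑ i, ∑ j, a i j • (D.cSxi hS j * D.cSxi hS i) = 0 := by
  have e : ∀ i j, D.cSxi hS j * D.cSxi hS i = ∑ q, ∑ m, (D.cxi q * D.cxi m) *
      ∑ k, ∑ l, D.s i j k l • (D.cSf hS m l * D.cSf hS q k) := by
    intro i j
    have e1 : ∀ q, D.cSf hS q j * D.cSxi hS i = ∑ m, D.cxi m *
        ∑ k, ∑ l, D.s i j k l • (D.cSf hS m l * D.cSf hS q k) := by
      intro q
      rw [h.cSf_cSxi]
      simp only [cSxi, Finset.mul_sum, Finset.sum_mul, Finset.smul_sum, mul_smul_comm, mul_assoc]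
      rw [Finset.sum_congr rfl fun _ _ => Finset.sum_comm, Finset.sum_comm]
    rw [cSxi]
    simp only [Finset.sum_mul, mul_assoc, e1, Finset.mul_sum]
  have e3 := congrArg (LinearMap.mul' ℂ D.CartanAlg) (sum_tmul_eq_zero_of_fixed D.s
    (fun i j => D.cxi i * D.cxi j)
    (fun q m => ∑ i, ∑ j, a i j • (D.cSf hS m j * D.cSf hS q i)) D.cxi_cxi fun q m => by
      simp only [Finset.smul_sum, smul_comm (D.s _ _ _ _) (a _ _)]
      rw [sum_comm_pairs]
      simp only [← Finset.smul_sum, h.cSf_cSf]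
      simp only [Finset.smul_sum, smul_smul]
      rw [sum_comm_pairs]
      simp only [← Finset.sum_smul, ha])
  simp only [map_sum, LinearMap.mul'_apply, map_zero] at e3
  rw [← e3]
  have e4 : ∀ i j, a i j • (D.cSxi hS j * D.cSxi hS i) = ∑ q, ∑ m, (D.cxi q * D.cxi m) *
      (a i j • ∑ k, ∑ l, D.s i j k l • (D.cSf hS m l * D.cSf hS q k)) := by
    intro i j
    rw [e]
    simp only [Finset.smul_sum, Finset.mul_sum, mul_smul_comm]
  simp only [e4]
  rw [sum_comm_pairs]
  simp only [← Finset.mul_sum]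
  refine Finset.sum_congr rfl fun q _ => Finset.sum_congr rfl fun m _ => ?_
  congr 1
  simp only [Finset.smul_sum, smul_smul]
  rw [sum_comm_pairs]
  simp only [← Finset.sum_smul, ha]

/-- The relation ξ-X in reversed order. Moving S(f) past ξ creates a braided X ξ, which is replaced
by ξ X minus a linear term; the rest is the antipode of the relation f-X. -/
theorem cSX_cSxi (i j : Fin N) : D.cSX hS j * D.cSxi hS i =
    ∑ k, ∑ l, D.s i j k l • (D.cSxi hS l * D.cSX hS k) - ∑ k, D.C i j k • D.cSxi hS k := by
  -- The bracket is the braided product of X and ξ, by the relation ξ-X of the algebra.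
  have e1 : D.cSX hS j * D.cSxi hS i = ∑ p, ∑ r, (D.cxi p * D.cX r - ∑ k, D.C p r k • D.cxi k) *
      (D.cSf hS r j * D.cSf hS p i) := by
    have e : ∀ p r, D.cxi p * D.cX r - ∑ k, D.C p r k • D.cxi k =
        ∑ q, ∑ m, D.s p r q m • (D.cX q * D.cxi m) := fun p r => by rw [D.cxi_cX]; abel
    simp only [e, cSX, cSxi, Finset.sum_mul, Finset.mul_sum]
    have e' : ∀ q p, D.cX q * D.cSf hS q j * (D.cxi p * D.cSf hS p i) =
        ∑ r, ∑ m, D.s p r q m • (D.cX q * D.cxi m) * (D.cSf hS r j * D.cSf hS p i) := by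
      intro q p
      rw [mul_assoc, ← mul_assoc (D.cSf hS q j), h.cSf_cxi]
      simp only [Finset.sum_mul, Finset.mul_sum, smul_mul_assoc, mul_smul_comm, mul_assoc]
    simp only [e']
    exact Finset.sum_congr rfl fun p _ => Finset.sum_comm
  have e2 : ∀ p, D.cSX hS j * D.cSf hS p i - ∑ m, ∑ n, D.C m n p • (D.cSf hS n j * D.cSf hS m i) =
      ∑ k, ∑ l, D.s i j k l • (D.cSf hS p l * D.cSX hS k) - ∑ l, D.C i j l • D.cSf hS p l := by
    intro p
    rw [← neg_inj, neg_sub, neg_sub, h.cSX_cSf]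
    abel
  have e3 : D.cSX hS j * D.cSxi hS i = ∑ p, D.cxi p * (D.cSX hS j * D.cSf hS p i -
      ∑ m, ∑ n, D.C m n p • (D.cSf hS n j * D.cSf hS m i)) := by
    rw [e1]
    simp only [sub_mul, mul_sub, Finset.sum_sub_distrib]
    congr 1
    · simp only [cSX, Finset.sum_mul, Finset.mul_sum, mul_assoc]
    · simp only [Finset.sum_mul, Finset.mul_sum, smul_mul_assoc, mul_smul_comm]
      rw [Finset.sum_congr rfl fun _ _ => Finset.sum_comm, Finset.sum_comm]
  rw [e3]
  simp only [e2, mul_sub, Finset.sum_sub_distrib, cSxi, Finset.sum_mul, Finset.mul_sum,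
    mul_smul_comm, Finset.smul_sum, mul_assoc]
  congr 1
  · rw [Finset.sum_comm]
    exact Finset.sum_congr rfl fun _ _ => Finset.sum_comm
  · rw [Finset.sum_comm]

end IsFrame

/-! ### Construction of the antipode -/

/-- The operators of right multiplication that define the antipode; the factor `i` on the odd
generators turns a graded antihomomorphism into an antihomomorphism. -/
def antipodeOps : CartanOperators N D.CartanAlg where
  X i := LinearMap.mulRight ℂ (-D.cSX hS i)
  f i j := LinearMap.mulRight ℂ (D.cSf hS i j)
  xi i := LinearMap.mulRight ℂ (Complex.I • D.cSxi hS i)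
  del := LinearMap.mulRight ℂ (Complex.I • D.cdel)
  sgn := LinearMap.id

theorem cSf_cdel (i j : Fin N) : D.cSf hS i j * D.cdel = D.cdel * D.cSf hS i j :=
  D.evenMap_mul_cdel _

theorem cSX_cdel (i : Fin N) : D.cSX hS i * D.cdel = D.cdel * D.cSX hS i := by
  simp only [cSX, Finset.sum_mul, Finset.mul_sum, mul_assoc, cSf_cdel]
  simp only [← mul_assoc, cX_cdel]

namespace IsFrame

variable (h : D.IsFrame G ω)
include h

theorem antipodeOps_relAt (v : D.CartanAlg) : (antipodeOps hS).RelAt D v where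
  xi_xi a ha := by
    have := congrArg (v * ·) (h.sum_cSxi_cSxi hS a ha)
    simp only [Finset.mul_sum, mul_smul_comm, mul_zero, ← mul_assoc] at this
    simp [antipodeOps, smul_smul, this]
  xi_del i := by
    -- The anticommutator of ξ and δ multiplied by S(f), which commutes with δ. The two factors i
    -- turn it into the required -`cSX`.
    have e : D.cdel * D.cSxi hS i + D.cSxi hS i * D.cdel = D.cSX hS i := by
      simp only [cSxi, cSX, Finset.mul_sum, Finset.sum_mul, mul_assoc, cSf_cdel,
        ← Finset.sum_add_distrib, ← D.cxi_cdel, add_mul]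
      exact Finset.sum_congr rfl fun j _ => add_comm _ _
    change v * (Complex.I • D.cdel) * (Complex.I • D.cSxi hS i) +
      v * (Complex.I • D.cSxi hS i) * (Complex.I • D.cdel) = v * -D.cSX hS i
    rw [← e]
    simp [smul_smul, mul_assoc, mul_add, add_comm]
  del_del := by simp [antipodeOps, mul_assoc, D.cdel_cdel]
  xi_f i j k := by
    simp only [antipodeOps, LinearMap.mulRight_apply, mul_assoc, mul_smul_comm, smul_mul_assoc,
      h.cSf_cSxi, Finset.mul_sum, Finset.smul_sum, smul_comm Complex.I]
  xi_X i j := by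
    simp only [antipodeOps, LinearMap.mulRight_apply, mul_assoc, mul_smul_comm, smul_mul_assoc,
      neg_mul, h.cSX_cSxi, Finset.mul_sum, Finset.smul_sum, smul_comm Complex.I, mul_neg, mul_sub,
      smul_neg, smul_sub, Finset.sum_neg_distrib]
    abel
  f_del i j := by simp [antipodeOps, mul_assoc, cSf_cdel]
  X_del i := by simp [antipodeOps, mul_assoc, cSX_cdel]

/-- On even polynomials the construction is right multiplication by the image of h ∘ S, hence
depends only on the functional h. -/
theorem antipodeOps_eval (p : FreeAlgebra ℂ (EvenGen N)) :
    (antipodeOps hS).eval (evenIncl N p) =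
      LinearMap.mulRight ℂ (D.evenMap ⟨dualAntipode (D.evenEval p), h.dualAntipode_mem hS p⟩) := by
  induction p using FreeAlgebra.induction with
  | grade0 c =>
    have : (⟨dualAntipode (D.evenEval (algebraMap ℂ _ c)), h.dualAntipode_mem hS _⟩ :
        D.evenEval.range) = algebraMap ℂ _ c := by
      apply Subtype.ext
      change dualAntipode _ = algebraMap ℂ (DualAlg A) c
      rw [AlgHom.commutes, Algebra.algebraMap_eq_smul_one]
      exact congrArg (fun f : DualAlg A => c • f) dualAntipode_one
    rw [this, AlgHom.commutes, AlgHom.commutes, AlgHom.commutes]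
    ext v
    simp [Algebra.algebraMap_eq_smul_one]
  | grade1 g =>
    rcases g with i | ⟨i, j⟩
    · have e : evenIncl N (FreeAlgebra.ι ℂ (.X i)) = gX i := FreeAlgebra.lift_ι_apply _ _
      rw [e, CartanOperators.eval_gX]
      have : (⟨dualAntipode (D.evenEval (FreeAlgebra.ι ℂ (.X i))), h.dualAntipode_mem hS _⟩ :
          D.evenEval.range) = -∑ j, D.uX j * D.uSf hS j i := by
        apply Subtype.ext
        simp [h.dualAntipode_X, uX, uSf]
      rw [this]
      simp [antipodeOps, cSX, cSf, evenMap_neg]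
    · have e : evenIncl N (FreeAlgebra.ι ℂ (.f i j)) = gf i j := FreeAlgebra.lift_ι_apply _ _
      rw [e, CartanOperators.eval_gf]
      have : (⟨dualAntipode (D.evenEval (FreeAlgebra.ι ℂ (.f i j))), h.dualAntipode_mem hS _⟩ :
          D.evenEval.range) = D.uSf hS i j := by
        apply Subtype.ext
        simp [uSf]
      rw [this]
      rfl
  | mul p q hp hq =>
    have : (⟨dualAntipode (D.evenEval (p * q)), h.dualAntipode_mem hS _⟩ : D.evenEval.range) =
        ⟨dualAntipode (D.evenEval q), h.dualAntipode_mem hS _⟩ *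
        ⟨dualAntipode (D.evenEval p), h.dualAntipode_mem hS _⟩ := by
      apply Subtype.ext
      simp [dualAntipode_mul]
    rw [this, map_mul, map_mul, map_mul, hp, hq, LinearMap.mulRight_mul]
    rfl
  | add p q hp hq =>
    have : (⟨dualAntipode (D.evenEval (p + q)), h.dualAntipode_mem hS _⟩ : D.evenEval.range) =
        ⟨dualAntipode (D.evenEval p), h.dualAntipode_mem hS _⟩ +
        ⟨dualAntipode (D.evenEval q), h.dualAntipode_mem hS _⟩ := by
      apply Subtype.ext
      change dualAntipode (D.evenEval (p + q)) = dualAntipode _ + dualAntipode _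
      rw [map_add]
      rfl
    rw [this, map_add, map_add, map_add, hp, hq]
    ext v
    simp [mul_add]

/-- The representation by right multiplications that defines the antipode. -/
def antipodeRep : D.CartanAlg →ₐ[ℂ] Module.End ℂ D.CartanAlg :=
  CartanOperators.lift (P := antipodeOps hS)
    (fun p q hpq => by
      have e : (⟨dualAntipode (D.evenEval p), h.dualAntipode_mem hS p⟩ : D.evenEval.range) =
        ⟨dualAntipode (D.evenEval q), h.dualAntipode_mem hS q⟩ :=
        Subtype.ext (congrArg dualAntipode hpq)
      rw [h.antipodeOps_eval, h.antipodeOps_eval, e])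
    (h.antipodeOps_relAt hS)

/-- The antihomomorphism that agrees with the antipode up to factors `i` on odd elements. -/
def twistedAntipode : D.CartanAlg →ₗ[ℂ] D.CartanAlg :=
  LinearMap.applyₗ 1 ∘ₗ (h.antipodeRep hS).toLinearMap

/-- Every operator in the image is a right multiplication, so it is determined by its value at 1.
Composition of right multiplications reverses the order. -/
theorem antipodeRep_apply (x v : D.CartanAlg) :
    h.antipodeRep hS x v = v * h.twistedAntipode hS x := by
  change _ = v * h.antipodeRep hS x 1
  induction x using D.cartan_induction_left generalizing v with
  | one => simp
  | add x y hx hy => simp only [map_add, LinearMap.add_apply, mul_add, hx v, hy v]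
  | smul c x hx => simp only [map_smul, LinearMap.smul_apply, hx v, mul_smul_comm]
  | cX i x hx =>
    simp only [map_mul, Module.End.mul_apply, hx v]
    simp [antipodeRep, antipodeOps, mul_assoc]
  | cf i j x hx =>
    simp only [map_mul, Module.End.mul_apply, hx v]
    simp [antipodeRep, antipodeOps, mul_assoc]
  | cxi i x hx =>
    simp only [map_mul, Module.End.mul_apply, hx v]
    simp [antipodeRep, antipodeOps, mul_assoc]
  | cdel x hx =>
    simp only [map_mul, Module.End.mul_apply, hx v]
    simp [antipodeRep, antipodeOps, mul_assoc]

theorem twistedAntipode_mul (x y : D.CartanAlg) :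
    h.twistedAntipode hS (x * y) = h.twistedAntipode hS y * h.twistedAntipode hS x := by
  rw [← antipodeRep_apply]
  simp [twistedAntipode]

theorem twistedAntipode_one : h.twistedAntipode hS 1 = 1 := by simp [twistedAntipode]
theorem twistedAntipode_cX (i : Fin N) : h.twistedAntipode hS (D.cX i) = -D.cSX hS i := by
  simp [twistedAntipode, antipodeRep, antipodeOps]
theorem twistedAntipode_cf (i j : Fin N) : h.twistedAntipode hS (D.cf i j) = D.cSf hS i j := by
  simp [twistedAntipode, antipodeRep, antipodeOps]
theorem twistedAntipode_cxi (i : Fin N) :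
    h.twistedAntipode hS (D.cxi i) = Complex.I • D.cSxi hS i := by
  simp [twistedAntipode, antipodeRep, antipodeOps]
theorem twistedAntipode_cdel : h.twistedAntipode hS D.cdel = Complex.I • D.cdel := by
  simp [twistedAntipode, antipodeRep, antipodeOps]

theorem twistedAntipode_parity (x : D.CartanAlg) :
    h.twistedAntipode hS (D.parity x) = D.parity (h.twistedAntipode hS x) := by
  induction x using D.cartan_induction_left with
  | one => simp [twistedAntipode_one]
  | add x y hx hy => simp only [map_add, hx, hy]
  | smul c x hx => simp only [map_smul, hx]
  | cX i x hx => simp [twistedAntipode_mul, hx, twistedAntipode_cX, cSX]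
  | cf i j x hx => simp [twistedAntipode_mul, hx, twistedAntipode_cf]
  | cxi i x hx => simp [twistedAntipode_mul, hx, twistedAntipode_cxi, cSxi]
  | cdel x hx => simp [twistedAntipode_mul, hx, twistedAntipode_cdel]

/-- The antipode of the quantum Cartan algebra. -/
def cartanAntipode : D.CartanAlg →ₗ[ℂ] D.CartanAlg :=
  -- The coefficients make this T on even and i T on odd elements, T being the twisted antipode. As
  -- T carries a factor i on ξ and δ, the result is -`cSxi` and -δ there, and S(xy) acquires the
  -- sign (-1)^{|x||y|}.
  ((1 + Complex.I) / 2) • h.twistedAntipode hS +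
    ((1 - Complex.I) / 2) • (h.twistedAntipode hS ∘ₗ D.parity.toLinearMap)

theorem cartanAntipode_parity (x : D.CartanAlg) :
    h.cartanAntipode hS (D.parity x) = D.parity (h.cartanAntipode hS x) := by
  simp [cartanAntipode, twistedAntipode_parity]

theorem cartanAntipode_one : h.cartanAntipode hS 1 = 1 := by
  simp only [cartanAntipode, LinearMap.add_apply, LinearMap.smul_apply, LinearMap.comp_apply,
    AlgHom.toLinearMap_apply, map_one, twistedAntipode_one]
  module

theorem cartanAntipode_cX_mul (i : Fin N) (x : D.CartanAlg) :
    h.cartanAntipode hS (D.cX i * x) = -(h.cartanAntipode hS x * D.cSX hS i) := by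
  simp only [cartanAntipode, LinearMap.add_apply, LinearMap.smul_apply, LinearMap.comp_apply,
    AlgHom.toLinearMap_apply, map_mul, twistedAntipode_mul, twistedAntipode_cX, parity_cX, mul_neg,
    add_mul, smul_mul_assoc]
  module

theorem cartanAntipode_cf_mul (i j : Fin N) (x : D.CartanAlg) :
    h.cartanAntipode hS (D.cf i j * x) = h.cartanAntipode hS x * D.cSf hS i j := by
  simp only [cartanAntipode, LinearMap.add_apply, LinearMap.smul_apply, LinearMap.comp_apply,
    AlgHom.toLinearMap_apply, map_mul, twistedAntipode_mul, twistedAntipode_cf, parity_cf,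
    add_mul, smul_mul_assoc]

/-- The graded rule S(yx) = (-1)^{|x|} S(x) S(y) for odd y, with S(y) = -η; the parity automorphism
avoids assuming x homogeneous. -/
theorem cartanAntipode_odd {y η : D.CartanAlg} (hy : D.parity y = -y)
    (hη : h.twistedAntipode hS y = Complex.I • η) (x : D.CartanAlg) :
    h.cartanAntipode hS (y * x) = -(h.cartanAntipode hS (D.parity x) * η) := by
  simp only [cartanAntipode, LinearMap.add_apply, LinearMap.smul_apply, LinearMap.comp_apply,
    AlgHom.toLinearMap_apply, map_mul, twistedAntipode_mul, hη, hy, parity_parity, map_neg,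
    add_mul, smul_mul_assoc, mul_smul_comm, mul_neg]
  match_scalars
  · linear_combination (1 / 2 : ℂ) * Complex.I_mul_I
  · linear_combination (1 / 2 : ℂ) * Complex.I_mul_I

theorem cartanAntipode_cxi_mul (i : Fin N) (x : D.CartanAlg) :
    h.cartanAntipode hS (D.cxi i * x) = -(h.cartanAntipode hS (D.parity x) * D.cSxi hS i) :=
  h.cartanAntipode_odd hS (D.parity_cxi i) (h.twistedAntipode_cxi hS i) x

theorem cartanAntipode_cdel_mul (x : D.CartanAlg) :
    h.cartanAntipode hS (D.cdel * x) = -(h.cartanAntipode hS (D.parity x) * D.cdel) :=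
  h.cartanAntipode_odd hS D.parity_cdel (h.twistedAntipode_cdel hS) x

end IsFrame

end Components

end

/-! ### The antipode axioms and uniqueness of the graded Hopf structure -/

section

variable {A : Type*} [Ring A] [HopfAlgebra ℂ A]
variable {Γ : Type*} [AddCommGroup Γ] [Module ℂ Γ] [Module A Γ] [Module Aᵐᵒᵖ Γ]
  [SMulCommClass A Aᵐᵒᵖ Γ] [IsScalarTower ℂ A Γ] [IsScalarTower ℂ Aᵐᵒᵖ Γ]

/-! ### The coproduct of the even subalgebra -/
namespace Components

variable {N : ℕ} {D : Components A Γ N} {G : BicovariantCalculus A Γ}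
  {ω : Module.Basis (Fin N) ℂ G.leftInvariants}

theorem tmul_mem_iSup {i : ZMod 2} (j k : ZMod 2) (hjk : j + k = i) {a b : D.CartanAlg}
    (ha : a ∈ D.grading j) (hb : b ∈ D.grading k) :
    a ⊗ₜ[ℂ] b ∈ ⨆ j, LinearMap.range (TensorProduct.map (D.grading j).subtype
      (D.grading (i - j)).subtype) := by
  obtain rfl : k = i - j := eq_sub_of_add_eq' hjk
  exact Submodule.mem_iSup_of_mem j ⟨⟨a, ha⟩ ⊗ₜ ⟨b, hb⟩, by simp⟩

/-- The average of t and its signed parity transform projects onto the eigenspace. On a pure tensor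
it is a sum of products of even and odd parts whose degrees add up to i. -/
theorem mem_iSup_of_map_parity (i : ZMod 2) {t : D.CartanAlg ⊗[ℂ] D.CartanAlg}
    (ht : TensorProduct.map D.parity.toLinearMap D.parity.toLinearMap t =
      ((-1 : ℂ) ^ i.val) • t) :
    t ∈ ⨆ j, LinearMap.range (TensorProduct.map (D.grading j).subtype
      (D.grading (i - j)).subtype) := by
  have h0 : ∀ a, (1 / 2 : ℂ) • (a + D.parity a) ∈ D.grading 0 := fun a =>
    mem_parityGrading_zero.2 (by simp [parity_parity, add_comm])
  have h1 : ∀ a, (1 / 2 : ℂ) • (a - D.parity a) ∈ D.grading 1 := fun a =>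
    mem_parityGrading_one.2 (by simp [parity_parity, ← smul_neg])
  have hsq : ((-1 : ℂ) ^ i.val) * ((-1 : ℂ) ^ i.val) = 1 := by
    rw [← mul_pow]; simp
  have key : ∀ t : D.CartanAlg ⊗[ℂ] D.CartanAlg, (1 / 2 : ℂ) • (t + ((-1 : ℂ) ^ i.val) •
      TensorProduct.map D.parity.toLinearMap D.parity.toLinearMap t) ∈
      ⨆ j, LinearMap.range (TensorProduct.map (D.grading j).subtype
        (D.grading (i - j)).subtype) := by
    intro t
    induction t with
    | zero => simp
    | add x y hx hy =>
      convert add_mem hx hy using 1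
      rw [map_add]
      module
    | tmul a b =>
      rw [TensorProduct.map_tmul, AlgHom.toLinearMap_apply, AlgHom.toLinearMap_apply]
      obtain rfl | rfl : i = 0 ∨ i = 1 :=
        (by decide : ∀ i : ZMod 2, i = 0 ∨ i = 1) i
      · have e : (1 / 2 : ℂ) • (a ⊗ₜ b + (-1 : ℂ) ^ (0 : ZMod 2).val •
            D.parity a ⊗ₜ[ℂ] D.parity b) =
            ((1 / 2 : ℂ) • (a + D.parity a)) ⊗ₜ ((1 / 2 : ℂ) • (b + D.parity b)) +
            ((1 / 2 : ℂ) • (a - D.parity a)) ⊗ₜ ((1 / 2 : ℂ) • (b - D.parity b)) := by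
          simp only [TensorProduct.smul_tmul, TensorProduct.tmul_smul, TensorProduct.add_tmul,
            TensorProduct.tmul_add, TensorProduct.sub_tmul, TensorProduct.tmul_sub, ZMod.val_zero]
          module
        rw [e]
        exact add_mem (tmul_mem_iSup 0 0 rfl (h0 a) (h0 b)) (tmul_mem_iSup 1 1 rfl (h1 a) (h1 b))
      · have e : (1 / 2 : ℂ) • (a ⊗ₜ b + (-1 : ℂ) ^ (1 : ZMod 2).val •
            D.parity a ⊗ₜ[ℂ] D.parity b) =
            ((1 / 2 : ℂ) • (a + D.parity a)) ⊗ₜ ((1 / 2 : ℂ) • (b - D.parity b)) +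
            ((1 / 2 : ℂ) • (a - D.parity a)) ⊗ₜ ((1 / 2 : ℂ) • (b + D.parity b)) := by
          have hv : (1 : ZMod 2).val = 1 := rfl
          simp only [TensorProduct.smul_tmul, TensorProduct.tmul_smul, TensorProduct.add_tmul,
            TensorProduct.tmul_add, TensorProduct.sub_tmul, TensorProduct.tmul_sub, hv]
          module
        rw [e]
        exact add_mem (tmul_mem_iSup 0 1 rfl (h0 a) (h1 b)) (tmul_mem_iSup 1 0 rfl (h1 a) (h0 b))
  have := key t
  rw [ht, smul_smul, hsq, one_smul] at this
  convert this using 1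
  module

namespace IsFrame

variable (hS : D.SCompatible) (h : D.IsFrame G ω)
include h

theorem cartanAntipode_left (x : D.CartanAlg) : LinearMap.mul' ℂ _
    ((h.cartanAntipode hS).rTensor _ (h.cartanComulLinear x)) =
      algebraMap ℂ _ (h.cartanCounit x) := by
  have key : ∀ (F : D.CartanAlg ⊗[ℂ] D.CartanAlg →ₗ[ℂ] D.CartanAlg ⊗[ℂ] D.CartanAlg)
      (c : ℂ), (∀ a b, LinearMap.mul' ℂ _ ((h.cartanAntipode hS).rTensor _
        (F (a ⊗ₜ b))) = c • (h.cartanAntipode hS a * b)) → ∀ t,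
      LinearMap.mul' ℂ _ ((h.cartanAntipode hS).rTensor _ (F t)) =
        c • LinearMap.mul' ℂ _ ((h.cartanAntipode hS).rTensor _ t) := by
    intro F g hF t
    induction t with
    | zero => simp
    | add x y hx hy => simp only [map_add, hx, hy, smul_add]
    | tmul a b => simp [hF]
  -- The matrices S(f) and f cancel in the middle. The two terms of the coproduct of X_i therefore
  -- contribute opposite amounts, in agreement with ε(X_i) = 0.
  have e1 : ∀ i b, ∑ j, D.cSX hS j * (D.cf j i * b) = D.cX i * b := by
    intro i b
    simp only [cSX, Finset.sum_mul]
    rw [Finset.sum_comm]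
    simp only [mul_assoc, ← Finset.mul_sum]
    simp only [← mul_assoc (D.cSf hS _ _), ← Finset.sum_mul, h.sum_cSf_cf]
    simp
  have e2 : ∀ i b, ∑ j, D.cSxi hS j * (D.cf j i * b) = D.cxi i * b := by
    intro i b
    simp only [cSxi, Finset.sum_mul]
    rw [Finset.sum_comm]
    simp only [mul_assoc, ← Finset.mul_sum]
    simp only [← mul_assoc (D.cSf hS _ _), ← Finset.sum_mul, h.sum_cSf_cf]
    simp
  induction x using D.cartan_induction_left with
  | one => simp [cartanComulLinear_one, cartanAntipode_one]
  | add x y hx hy => simp only [map_add, hx, hy]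
  | smul c x hx => simp only [map_smul, hx, Algebra.algebraMap_eq_smul_one, smul_assoc]
  | cX i x hx =>
    rw [cartanComulLinear_cX, key _ 0, map_mul]
    · simp
    intro a b
    rw [CartanOperators.tensor_X_tmul]
    simp [cartanOps, cartanAntipode_cX_mul, mul_assoc, ← Finset.mul_sum, e1]
  | cf i j x hx =>
    rw [cartanComulLinear_cf, key _ (if i = j then 1 else 0), hx, map_mul]
    · simp only [cartanCounit_cf]; split <;> simp
    intro a b
    rw [CartanOperators.tensor_f_tmul]
    simp only [cartanOps, map_sum, LinearMap.rTensor_tmul, LinearMap.mul'_apply,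
      LinearMap.mulLeft_apply, cartanAntipode_cf_mul, mul_assoc, ← Finset.mul_sum]
    simp only [← mul_assoc (D.cSf hS _ _), ← Finset.sum_mul, h.sum_cSf_cf]
    split <;> simp
  | cxi i x hx =>
    rw [cartanComulLinear_cxi, key _ 0, map_mul]
    · simp
    intro a b
    rw [CartanOperators.tensor_xi_tmul]
    simp [cartanOps, cartanAntipode_cxi_mul, mul_assoc, ← Finset.mul_sum, e2]
  | cdel x hx =>
    rw [cartanComulLinear_cdel, key _ 0, map_mul]
    · simp
    intro a b
    rw [CartanOperators.tensor_del_tmul]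
    simp [cartanOps, cartanAntipode_cdel_mul, mul_assoc]

theorem cartanAntipode_right (x : D.CartanAlg) : LinearMap.mul' ℂ _
    ((h.cartanAntipode hS).lTensor _ (h.cartanComulLinear x)) =
      algebraMap ℂ _ (h.cartanCounit x) := by
  -- On this side the new factors surround a S(b) rather than meet between its factors. They are
  -- collected in an operator `L`, which is evaluated only when the induction hypothesis has made
  -- the inside a scalar.
  have key : ∀ (F : D.CartanAlg ⊗[ℂ] D.CartanAlg →ₗ[ℂ] D.CartanAlg ⊗[ℂ] D.CartanAlg)
      (L : D.CartanAlg →ₗ[ℂ] D.CartanAlg), (∀ a b, LinearMap.mul' ℂ _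
        ((h.cartanAntipode hS).lTensor _ (F (a ⊗ₜ b))) = L (a * h.cartanAntipode hS b)) → ∀ t,
      LinearMap.mul' ℂ _ ((h.cartanAntipode hS).lTensor _ (F t)) =
        L (LinearMap.mul' ℂ _ ((h.cartanAntipode hS).lTensor _ t)) := by
    intro F g hF t
    induction t with
    | zero => simp
    | add x y hx hy => simp only [map_add, hx, hy]
    | tmul a b => simp [hF]
  induction x using D.cartan_induction_left with
  | one => simp [cartanComulLinear_one, cartanAntipode_one]
  | add x y hx hy => simp only [map_add, hx, hy]
  | smul c x hx => simp only [map_smul, hx, Algebra.algebraMap_eq_smul_one, smul_assoc]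
  | cX i x hx =>
    rw [cartanComulLinear_cX, key _ (LinearMap.mulRight ℂ (-D.cSX hS i) +
      ∑ j, LinearMap.mulLeft ℂ (D.cX j) ∘ₗ LinearMap.mulRight ℂ (D.cSf hS j i)), hx, map_mul]
    · simp [cSX, Algebra.algebraMap_eq_smul_one]
    intro a b
    rw [CartanOperators.tensor_X_tmul]
    simp [cartanOps, cartanAntipode_cX_mul, cartanAntipode_cf_mul, mul_assoc]
  | cf i j x hx =>
    rw [cartanComulLinear_cf, key _
      (∑ k, LinearMap.mulLeft ℂ (D.cf i k) ∘ₗ LinearMap.mulRight ℂ (D.cSf hS k j)), hx, map_mul]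
    · simp only [Algebra.algebraMap_eq_smul_one, map_smul, LinearMap.sum_apply,
        LinearMap.comp_apply, LinearMap.mulRight_apply, LinearMap.mulLeft_apply, one_mul,
        h.sum_cf_cSf, cartanCounit_cf]
      split <;> simp
    intro a b
    rw [CartanOperators.tensor_f_tmul]
    simp [cartanOps, cartanAntipode_cf_mul, mul_assoc]
  | cxi i x hx =>
    rw [cartanComulLinear_cxi, key _ (LinearMap.mulRight ℂ (-D.cSxi hS i) ∘ₗ D.parity.toLinearMap +
      ∑ j, LinearMap.mulLeft ℂ (D.cxi j) ∘ₗ LinearMap.mulRight ℂ (D.cSf hS j i)), hx, map_mul]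
    · simp [cSxi, Algebra.algebraMap_eq_smul_one]
    intro a b
    rw [CartanOperators.tensor_xi_tmul]
    simp [cartanOps, cartanAntipode_cxi_mul, cartanAntipode_cf_mul, mul_assoc,
      cartanAntipode_parity]
  | cdel x hx =>
    rw [cartanComulLinear_cdel, key _ (LinearMap.mulRight ℂ (-D.cdel) ∘ₗ D.parity.toLinearMap +
      LinearMap.mulLeft ℂ D.cdel), hx, map_mul]
    · simp [Algebra.algebraMap_eq_smul_one]
    intro a b
    rw [CartanOperators.tensor_del_tmul]
    simp [cartanOps, cartanAntipode_cdel_mul, mul_assoc, cartanAntipode_parity]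

/-- The `ℤ/2`-graded Hopf algebra structure of the quantum Cartan algebra. -/
def cartanHopf : SuperHopf D.grading where
  comulHom := h.cartanComul
  counit := h.cartanCounit
  antipode := h.cartanAntipode hS
  coassoc := LinearMap.ext h.cartanComulLinear_coassoc
  counit_left := h.cartanCounit_left
  counit_right := h.cartanCounit_right
  antipode_left := h.cartanAntipode_left hS
  antipode_right := h.cartanAntipode_right hS
  comul_mem i x hx := by
    apply mem_iSup_of_map_parity
    have e := h.cartanComulLinear_parity x
    rw [mem_parityGrading.1 hx, map_smul] at e
    exact e.symm
  counit_odd x hx := by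
    have e := h.cartanCounit_parity x
    rw [mem_parityGrading_one.1 hx, map_neg] at e
    exact self_eq_neg.1 e.symm
  antipode_mem i x hx := by
    have e := h.cartanAntipode_parity hS x
    rw [mem_parityGrading.1 hx, map_smul] at e
    exact mem_parityGrading.2 e.symm

theorem cartanHopf_isCartanHopf : D.IsCartanHopf (h.cartanHopf hS) := by
  have ef : ∀ i j, h.cartanAntipode hS (D.cf i j) = D.cSf hS i j := fun i j => by
    simpa [cartanAntipode_one] using h.cartanAntipode_cf_mul hS i j 1
  have eX : ∀ i, h.cartanAntipode hS (D.cX i) = -D.cSX hS i := fun i => by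
    simpa [cartanAntipode_one] using h.cartanAntipode_cX_mul hS i 1
  have exi : ∀ i, h.cartanAntipode hS (D.cxi i) = -D.cSxi hS i := fun i => by
    simpa [cartanAntipode_one] using h.cartanAntipode_cxi_mul hS i 1
  have edel : h.cartanAntipode hS D.cdel = -D.cdel := by
    simpa [cartanAntipode_one] using h.cartanAntipode_cdel_mul hS 1
  refine ⟨fun i => ?_, fun i j => ?_, fun i => ?_, ?_, h.cartanCounit_cX, h.cartanCounit_cf,
    h.cartanCounit_cxi, h.cartanCounit_cdel, fun i j q hq => ?_, fun i => ?_, fun i => ?_, edel⟩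
  · have := h.cartanComulLinear_cX i 1
    rw [mul_one, cartanComulLinear_one, CartanOperators.tensor_X_tmul] at this
    simp only [cartanOps] at this
    simp only [LinearMap.mulLeft_apply, mul_one] at this
    exact this
  · have := h.cartanComulLinear_cf i j 1
    rw [mul_one, cartanComulLinear_one, CartanOperators.tensor_f_tmul] at this
    simp only [cartanOps] at this
    simp only [LinearMap.mulLeft_apply, mul_one] at this
    exact this
  · have := h.cartanComulLinear_cxi i 1
    rw [mul_one, cartanComulLinear_one, CartanOperators.tensor_xi_tmul] at this
    simp only [cartanOps] at this
    simp only [LinearMap.mulLeft_apply, mul_one, AlgHom.toLinearMap_apply, map_one] at this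
    exact this
  · have := h.cartanComulLinear_cdel 1
    rw [mul_one, cartanComulLinear_one, CartanOperators.tensor_del_tmul] at this
    simp only [cartanOps] at this
    simp only [LinearMap.mulLeft_apply, mul_one, AlgHom.toLinearMap_apply, map_one] at this
    exact this
  · exact (ef i j).trans (D.evenMap_eq hq)
  · refine (eX i).trans ?_
    simp only [cartanHopf, ef, cSX]
  · refine (exi i).trans ?_
    simp only [cartanHopf, ef, cSxi]

end IsFrame

theorem IsCartanHopf.comulHom_eq {H H' : SuperHopf D.grading} (hH : D.IsCartanHopf H)
    (hH' : D.IsCartanHopf H') : H.comulHom = H'.comulHom := by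
  apply D.cartan_hom_ext
  · intro i
    exact (hH.comul_X i).trans (hH'.comul_X i).symm
  · intro i j
    exact (hH.comul_f i j).trans (hH'.comul_f i j).symm
  · intro i
    exact (hH.comul_xi i).trans (hH'.comul_xi i).symm
  · exact hH.comul_del.trans hH'.comul_del.symm

theorem IsCartanHopf.counit_eq {H H' : SuperHopf D.grading} (hH : D.IsCartanHopf H)
    (hH' : D.IsCartanHopf H') : H.counit = H'.counit := by
  apply D.cartan_hom_ext
  · intro i
    exact (hH.counit_X i).trans (hH'.counit_X i).symm
  · intro i j
    exact (hH.counit_f i j).trans (hH'.counit_f i j).symm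
  · intro i
    exact (hH.counit_xi i).trans (hH'.counit_xi i).symm
  · exact hH.counit_del.trans hH'.counit_del.symm

end Components

/-- A `ℤ/2`-graded Hopf algebra structure is determined by its coproduct and counit. -/
theorem SuperHopf.ext_of_comulHom {B : Type*} [Ring B] [Algebra ℂ B]
    {𝒜 : ZMod 2 → Submodule ℂ B} [GradedAlgebra 𝒜] {H H' : SuperHopf 𝒜}
    (hc : H.comulHom = H'.comulHom) (he : H.counit = H'.counit) : H = H' := by
  -- Coassociativity and the counit axioms contain no signs, so the plain coproduct gives an
  -- ordinary coalgebra. An antipode is then a two-sided convolution inverse of the identity.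
  let _ : Coalgebra ℂ B :=
    { comul := H.comul
      counit := H.counit.toLinearMap
      coassoc := H.coassoc
      rTensor_counit_comp_comul := by
        ext x
        apply (TensorProduct.lid ℂ B).injective
        exact (H.counit_left x).trans (by simp)
      lTensor_counit_comp_comul := by
        ext x
        apply (TensorProduct.rid ℂ B).injective
        exact (H.counit_right x).trans (by simp) }
  have h1 : (WithConv.toConv H.antipode : WithConv (B →ₗ[ℂ] B)) *
      WithConv.toConv LinearMap.id = 1 := by
    apply WithConv.ofConv_injective
    ext x
    exact H.antipode_left x
  have h2 : (WithConv.toConv LinearMap.id : WithConv (B →ₗ[ℂ] B)) *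
      WithConv.toConv H'.antipode = 1 := by
    apply WithConv.ofConv_injective
    ext x
    have := H'.antipode_right x
    rw [← hc, ← he] at this
    exact this
  have ha : H.antipode = H'.antipode :=
    congrArg WithConv.ofConv (left_inv_eq_right_inv h1 h2)
  cases H
  cases H'
  simp only at hc he ha
  subst hc he ha
  rfl

theorem Components.IsFrame.existsUnique_cartanHopf {N : ℕ} {D : Components A Γ N}
    {G : BicovariantCalculus A Γ} {ω : Module.Basis (Fin N) ℂ G.leftInvariants}
    (h : D.IsFrame G ω) (hS : D.SCompatible) :
    ∃! H : SuperHopf D.grading, D.IsCartanHopf H :=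
  ⟨h.cartanHopf hS, h.cartanHopf_isCartanHopf hS, fun _ hH =>
    SuperHopf.ext_of_comulHom (hH.comulHom_eq (h.cartanHopf_isCartanHopf hS))
      (hH.counit_eq (h.cartanHopf_isCartanHopf hS))⟩

end

section

variable {A : Type*} [Ring A] [HopfAlgebra ℂ A]
variable {Γ : Type*} [AddCommGroup Γ] [Module ℂ Γ] [Module A Γ] [Module Aᵐᵒᵖ Γ]
  [SMulCommClass A Aᵐᵒᵖ Γ] [IsScalarTower ℂ A Γ] [IsScalarTower ℂ Aᵐᵒᵖ Γ]

/-! ### The coproduct of the even subalgebra -/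
/-! ### The exterior algebra: generators, universal property, degrees -/

namespace Ext

variable (σ : BalancedTensor A Γ →ₗ[ℂ] BalancedTensor A Γ)

variable (A Γ) in
theorem _root_.QCartan.toTensorAlg_rel {x y : TensorAlgebra ℂ (A × Γ)} (h : TensorRel A Γ x y) :
    toTensorAlg A Γ x = toTensorAlg A Γ y := RingQuot.mkAlgHom_rel ℂ h

theorem scalar_one : scalar σ 1 = 1 := by
  have := toTensorAlg_rel A Γ TensorRel.one
  rw [map_one] at this
  exact (congrArg (proj σ) this).trans (map_one _)

theorem scalar_mul (a b : A) : scalar σ (a * b) = scalar σ a * scalar σ b := by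
  have := toTensorAlg_rel A Γ (TensorRel.mul a b)
  rw [map_mul] at this
  exact (congrArg (proj σ) this).symm.trans (map_mul _ _ _)

theorem form_smul (a : A) (ρ : Γ) : form σ (a • ρ) = scalar σ a * form σ ρ := by
  have := toTensorAlg_rel A Γ (TensorRel.left a ρ)
  rw [map_mul] at this
  exact (congrArg (proj σ) this).symm.trans (map_mul _ _ _)

theorem form_op_smul (a : A) (ρ : Γ) : form σ (op a • ρ) = form σ ρ * scalar σ a := by
  have := toTensorAlg_rel A Γ (TensorRel.right a ρ)
  rw [map_mul] at this
  exact (congrArg (proj σ) this).symm.trans (map_mul _ _ _)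

/-- The inclusion of the `0`-forms as an algebra homomorphism. -/
def scalarHom : A →ₐ[ℂ] Ext σ :=
  AlgHom.ofLinearMap (scalar σ) (scalar_one σ) (scalar_mul σ)

@[simp] theorem scalarHom_apply (a : A) : scalarHom σ a = scalar σ a := rfl

theorem mul_form_form_eq_zero {t : Γ ⊗[ℂ] Γ}
    (ht : σ ((balancedRel A Γ).mkQ t) = (balancedRel A Γ).mkQ t) :
    LinearMap.mul' ℂ (Ext σ) (TensorProduct.map (form σ) (form σ) t) = 0 := by
  have h1 : proj σ (tensorSquare A Γ ((balancedRel A Γ).mkQ t)) = proj σ 0 :=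
    RingQuot.mkAlgHom_rel ℂ (ExteriorRel.ker _
      (by rw [LinearMap.mem_ker, LinearMap.sub_apply, LinearMap.id_apply, ht, sub_self]))
  rw [map_zero] at h1
  rw [← h1]
  change _ = proj σ (LinearMap.mul' ℂ _ (TensorProduct.map (tensorForm A Γ) (tensorForm A Γ) t))
  clear ht h1
  induction t with
  | zero => simp
  | add x y hx hy => simp only [map_add, hx, hy]
  | tmul ρ ρ' => simp [form]

variable {σ}

section Lift

variable {B : Type*} [Ring B] [Algebra ℂ B] {α : A →ₐ[ℂ] B} {φ : Γ →ₗ[ℂ] B}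
  (hl : ∀ a ρ, φ (a • ρ) = α a * φ ρ) (hr : ∀ a ρ, φ (op a • ρ) = φ ρ * α a)

/-- The universal property of the tensor algebra of a bimodule. -/
def tensorLift : BimoduleTensorAlg A Γ →ₐ[ℂ] B :=
  RingQuot.liftAlgHom ℂ ⟨TensorAlgebra.lift ℂ (LinearMap.coprod α.toLinearMap φ), by
    rintro _ _ (_ | ⟨a, b⟩ | ⟨a, ρ⟩ | ⟨a, ρ⟩)
    · simp
    · simp
    · simp [hl]
    · simp [hr]⟩

theorem tensorLift_tensorScalar (a : A) : tensorLift hl hr (tensorScalar A Γ a) = α a := by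
  refine (RingQuot.liftAlgHom_mkAlgHom_apply _ _ _ _).trans ?_
  simp

theorem tensorLift_tensorForm (ρ : Γ) : tensorLift hl hr (tensorForm A Γ ρ) = φ ρ := by
  refine (RingQuot.liftAlgHom_mkAlgHom_apply _ _ _ _).trans ?_
  simp

variable (hk : ∀ t : Γ ⊗[ℂ] Γ, σ ((balancedRel A Γ).mkQ t) = (balancedRel A Γ).mkQ t →
    LinearMap.mul' ℂ B (TensorProduct.map φ φ t) = 0)

include hk in
theorem tensorLift_rel ⦃x y : BimoduleTensorAlg A Γ⦄ (h : ExteriorRel σ x y) :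
    tensorLift hl hr x = tensorLift hl hr y := by
  obtain ⟨w, hw⟩ := h
  obtain ⟨t, rfl⟩ := (balancedRel A Γ).mkQ_surjective w
  rw [map_zero, ← hk t]
  · change tensorLift hl hr (LinearMap.mul' ℂ _
      (TensorProduct.map (tensorForm A Γ) (tensorForm A Γ) t)) = _
    clear hw
    induction t with
    | zero => simp
    | add x y hx hy => simp only [map_add, hx, hy]
    | tmul ρ ρ' => simp [tensorLift_tensorForm]
  · rw [LinearMap.mem_ker, LinearMap.sub_apply, sub_eq_zero] at hw
    exact hw.symm

/-- The universal property of the exterior algebra. -/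
def lift : Ext σ →ₐ[ℂ] B := RingQuot.liftAlgHom ℂ ⟨tensorLift hl hr, tensorLift_rel hl hr hk⟩

theorem lift_scalar (a : A) : lift hl hr hk (scalar σ a) = α a :=
  (RingQuot.liftAlgHom_mkAlgHom_apply _ _ _ _).trans (tensorLift_tensorScalar hl hr a)

theorem lift_form (ρ : Γ) : lift hl hr hk (form σ ρ) = φ ρ :=
  (RingQuot.liftAlgHom_mkAlgHom_apply _ _ _ _).trans (tensorLift_tensorForm hl hr ρ)

end Lift

/-- The exterior algebra is generated by the `0`-forms and the `1`-forms. -/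
theorem induction {p : Ext σ → Prop} (scalar : ∀ a, p (scalar σ a)) (form : ∀ ρ, p (form σ ρ))
    (mul : ∀ x y, p x → p y → p (x * y)) (add : ∀ x y, p x → p y → p (x + y)) (x : Ext σ) :
    p x := by
  obtain ⟨y, rfl⟩ := RingQuot.mkAlgHom_surjective ℂ (ExteriorRel σ) x
  obtain ⟨z, rfl⟩ := RingQuot.mkAlgHom_surjective ℂ (TensorRel A Γ) y
  change p (proj σ (toTensorAlg A Γ z))
  induction z using TensorAlgebra.induction with
  | algebraMap c =>
    have := scalar (algebraMap ℂ A c)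
    rw [← scalarHom_apply, AlgHom.commutes] at this
    rwa [AlgHom.commutes, AlgHom.commutes]
  | ι v =>
    have := add _ _ (scalar v.1) (form v.2)
    have e : Ext.scalar σ v.1 + Ext.form σ v.2 =
        proj σ (toTensorAlg A Γ (TensorAlgebra.ι ℂ v)) := by
      simp only [Ext.scalar, Ext.form, tensorScalar, tensorForm, LinearMap.comp_apply,
        AlgHom.toLinearMap_apply, ← map_add]
      simp
    rwa [e] at this
  | mul a b ha hb => rw [map_mul, map_mul]; exact mul _ _ ha hb
  | add a b ha hb => rw [map_add, map_add]; exact add _ _ ha hb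

theorem hom_ext {B : Type*} [Ring B] [Algebra ℂ B] {φ ψ : Ext σ →ₐ[ℂ] B}
    (hs : ∀ a, φ (scalar σ a) = ψ (scalar σ a)) (hf : ∀ ρ, φ (form σ ρ) = ψ (form σ ρ)) :
    φ = ψ := by
  ext x
  induction x using Ext.induction with
  | scalar a => exact hs a
  | form ρ => exact hf ρ
  | mul x y hx hy => rw [map_mul, map_mul, hx, hy]
  | add x y hx hy => rw [map_add, map_add, hx, hy]

/-! #### Degrees -/

theorem degree_zero : degree σ 0 = LinearMap.range (scalar σ) := by
  rw [degree, pow_zero, mul_one]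

theorem scalar_mem (a : A) : scalar σ a ∈ degree σ 0 := by
  rw [degree_zero]; exact ⟨a, rfl⟩

theorem one_le_range_scalar : (1 : Submodule ℂ (Ext σ)) ≤ LinearMap.range (scalar σ) := by
  rw [Submodule.one_le]
  exact ⟨1, scalar_one σ⟩

theorem range_scalar_mul_range_scalar :
    LinearMap.range (scalar σ) * LinearMap.range (scalar σ) = LinearMap.range (scalar σ) := by
  apply le_antisymm
  · rw [Submodule.mul_le]
    rintro _ ⟨a, rfl⟩ _ ⟨b, rfl⟩
    exact ⟨a * b, scalar_mul σ a b⟩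
  · exact (mul_one (LinearMap.range (scalar σ))).symm.le.trans
      (mul_le_mul' le_rfl one_le_range_scalar)

theorem range_scalar_mul_range_form :
    LinearMap.range (scalar σ) * LinearMap.range (form σ) = LinearMap.range (form σ) := by
  apply le_antisymm
  · rw [Submodule.mul_le]
    rintro _ ⟨a, rfl⟩ _ ⟨ρ, rfl⟩
    exact ⟨a • ρ, form_smul σ a ρ⟩
  · exact (one_mul (LinearMap.range (form σ))).symm.le.trans
      (mul_le_mul' one_le_range_scalar le_rfl)

theorem range_form_mul_range_scalar :
    LinearMap.range (form σ) * LinearMap.range (scalar σ) = LinearMap.range (form σ) := by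
  apply le_antisymm
  · rw [Submodule.mul_le]
    rintro _ ⟨ρ, rfl⟩ _ ⟨a, rfl⟩
    exact ⟨op a • ρ, form_op_smul σ a ρ⟩
  · exact (mul_one (LinearMap.range (form σ))).symm.le.trans
      (mul_le_mul' le_rfl one_le_range_scalar)

/-- Coefficients are absorbed by one-forms from both sides, so a one-form can be split off on the
left. This is the basis of all inductions on the degree. -/
theorem degree_succ (n : ℕ) : degree σ (n + 1) = LinearMap.range (form σ) * degree σ n := by
  rw [degree, degree, pow_succ', ← mul_assoc, ← mul_assoc, range_scalar_mul_range_form,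
    range_form_mul_range_scalar]

theorem scalar_mul_mem {n : ℕ} (a : A) {x : Ext σ} (hx : x ∈ degree σ n) :
    scalar σ a * x ∈ degree σ n := by
  have : LinearMap.range (scalar σ) * degree σ n = degree σ n := by
    rw [degree, ← mul_assoc, range_scalar_mul_range_scalar]
  rw [← this]
  exact Submodule.mul_mem_mul ⟨a, rfl⟩ hx

theorem form_mul_mem {n : ℕ} (ρ : Γ) {x : Ext σ} (hx : x ∈ degree σ n) :
    form σ ρ * x ∈ degree σ (n + 1) := by
  rw [degree_succ]
  exact Submodule.mul_mem_mul ⟨ρ, rfl⟩ hx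

theorem form_mem (ρ : Γ) : form σ ρ ∈ degree σ 1 := by
  have := form_mul_mem ρ (scalar_mem (σ := σ) 1)
  rwa [scalar_one, mul_one] at this

/-- Induction on homogeneous forms. -/
theorem degree_induction {p : ℕ → Ext σ → Prop} (scalar : ∀ a, p 0 (scalar σ a))
    (form_mul : ∀ n ρ x, x ∈ degree σ n → p n x → p (n + 1) (form σ ρ * x))
    (add : ∀ n x y, p n x → p n y → p n (x + y)) (n : ℕ) {x : Ext σ} (hx : x ∈ degree σ n) :
    p n x := by
  induction n generalizing x with
  | zero =>
    rw [degree_zero] at hx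
    obtain ⟨a, rfl⟩ := hx
    exact scalar a
  | succ n ih =>
    rw [degree_succ] at hx
    induction hx using Submodule.mul_induction_on' with
    | mem_mul_mem m hm y hy =>
      obtain ⟨ρ, rfl⟩ := hm
      exact form_mul n ρ y hy (ih hy)
    | add x _ y _ hx hy => exact add _ _ _ hx hy

theorem degree_mul_mem {m n : ℕ} {x y : Ext σ} (hx : x ∈ degree σ m) (hy : y ∈ degree σ n) :
    x * y ∈ degree σ (m + n) := by
  refine degree_induction (p := fun m x => x * y ∈ degree σ (m + n)) (fun a => ?_)
    (fun m ρ x _ ih => ?_) (fun m x x' hx hx' => ?_) m hx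
  · rw [zero_add]
    exact scalar_mul_mem a hy
  · rw [mul_assoc, Nat.add_right_comm]
    exact form_mul_mem ρ ih
  · rw [add_mul]
    exact add_mem hx hx'

/-- Every form is a sum of homogeneous forms. -/
theorem iSup_degree : ⨆ n, degree σ n = ⊤ := by
  rw [eq_top_iff]
  rintro x -
  induction x using Ext.induction with
  | scalar a => exact Submodule.mem_iSup_of_mem 0 (scalar_mem a)
  | form ρ => exact Submodule.mem_iSup_of_mem 1 (form_mem ρ)
  | add x y hx hy => exact add_mem hx hy
  | mul x y hx hy =>
    induction hx using Submodule.iSup_induction' with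
    | zero => simp
    | add x x' _ _ hx hx' => rw [add_mul]; exact add_mem hx hx'
    | mem m x hx =>
      induction hy using Submodule.iSup_induction' with
      | zero => simp
      | add y y' _ _ hy hy' => rw [mul_add]; exact add_mem hy hy'
      | mem n y hy => exact Submodule.mem_iSup_of_mem (m + n) (degree_mul_mem hx hy)

theorem homogeneous_induction {p : Ext σ → Prop} (mem : ∀ n, ∀ x ∈ degree σ n, p x)
    (add : ∀ x y, p x → p y → p (x + y)) (x : Ext σ) : p x := by
  have hx : x ∈ ⨆ n, degree σ n := by rw [iSup_degree]; trivial
  induction hx using Submodule.iSup_induction' with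
  | zero => exact mem 0 0 (zero_mem _)
  | add x y _ _ hx hy => exact add _ _ hx hy
  | mem n x hx => exact mem n x hx

/-! #### The sign automorphism -/

variable (σ) in
/-- The automorphism `α ↦ (-1)^|α| α` of the exterior algebra. -/
def sign : Ext σ →ₐ[ℂ] Ext σ :=
  lift (α := scalarHom σ) (φ := -form σ) (fun a ρ => by simp [form_smul])
    (fun a ρ => by simp [form_op_smul]) fun t ht => by
      rw [← mul_form_form_eq_zero σ ht]
      congr 1
      clear ht
      induction t with
      | zero => simp
      | add x y hx hy => simp only [map_add, hx, hy]
      | tmul ρ ρ' => simp [TensorProduct.tmul_neg, TensorProduct.neg_tmul]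

@[simp] theorem sign_scalar (a : A) : sign σ (scalar σ a) = scalar σ a := lift_scalar _ _ _ a
@[simp] theorem sign_form (ρ : Γ) : sign σ (form σ ρ) = -form σ ρ := lift_form _ _ _ ρ

theorem sign_of_mem {n : ℕ} {x : Ext σ} (hx : x ∈ degree σ n) : sign σ x = (-1 : ℂ) ^ n • x := by
  refine degree_induction (p := fun n x => sign σ x = (-1 : ℂ) ^ n • x) (fun a => by simp)
    (fun n ρ x _ ih => ?_) (fun n x y hx hy => ?_) n hx
  · rw [map_mul, ih, sign_form, pow_succ, mul_neg_one, neg_smul, neg_mul, mul_smul_comm]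
  · rw [map_add, hx, hy, smul_add]

theorem sign_sign (x : Ext σ) : sign σ (sign σ x) = x := by
  have : (sign σ).comp (sign σ) = AlgHom.id ℂ _ := by
    apply hom_ext <;> simp
  exact DFunLike.congr_fun this x

/-- Describes the parity parts as eigenspaces of the sign automorphism: averaging with the sign
leaves the homogeneous terms of parity j and kills the others. -/
theorem mem_parityPart {j : ZMod 2} {x : Ext σ} :
    x ∈ parityPart (degree σ) j ↔ sign σ x = (-1 : ℂ) ^ j.val • x := by
  have hpow : ∀ n : ℕ, (-1 : ℂ) ^ (n : ZMod 2).val = (-1) ^ n := fun n => by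
    rw [ZMod.val_natCast, ← neg_one_pow_eq_pow_mod_two]
  constructor
  · intro hx
    rw [parityPart] at hx
    have hle : (⨆ (n : ℕ) (_ : (n : ZMod 2) = j), degree σ n) ≤
        LinearMap.ker ((sign σ).toLinearMap - ((-1 : ℂ) ^ j.val) • LinearMap.id) := by
      refine iSup₂_le fun n hn y hy => ?_
      rw [LinearMap.mem_ker, LinearMap.sub_apply, sub_eq_zero, AlgHom.toLinearMap_apply,
        sign_of_mem hy, ← hn, hpow]
      rfl
    have := hle hx
    rwa [LinearMap.mem_ker, LinearMap.sub_apply, sub_eq_zero] at this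
  · intro hx
    have key : ∀ y : Ext σ, (1 / 2 : ℂ) • (y + (-1 : ℂ) ^ j.val • sign σ y) ∈
        parityPart (degree σ) j := by
      intro y
      induction y using homogeneous_induction with
      | add x y hx hy =>
        have e : (1 / 2 : ℂ) • (x + y + (-1 : ℂ) ^ j.val • sign σ (x + y)) =
          (1 / 2 : ℂ) • (x + (-1 : ℂ) ^ j.val • sign σ x) +
          (1 / 2 : ℂ) • (y + (-1 : ℂ) ^ j.val • sign σ y) := by
          rw [map_add]
          module
        rw [e]
        exact add_mem hx hy
      | mem n y hy =>
        by_cases hn : (n : ZMod 2) = j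
        · refine Submodule.smul_mem _ _ (add_mem ?_ (Submodule.smul_mem _ _ ?_))
          · exact Submodule.mem_iSup_of_mem n (Submodule.mem_iSup_of_mem hn hy)
          · rw [sign_of_mem hy]
            exact Submodule.smul_mem _ _
              (Submodule.mem_iSup_of_mem n (Submodule.mem_iSup_of_mem hn hy))
        · have hn' : (-1 : ℂ) ^ n = -(-1) ^ j.val := by
            rw [← hpow]
            generalize (n : ZMod 2) = m at hn
            have h01 : ∀ m : ZMod 2, m = 0 ∨ m = 1 := by decide
            have hv : (1 : ZMod 2).val = 1 := rfl
            rcases h01 m with rfl | rfl <;> rcases h01 j with rfl | rfl <;> simp_all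
          have hsq : (-1 : ℂ) ^ j.val * (-1) ^ j.val = 1 := by rw [← mul_pow]; simp
          rw [sign_of_mem hy, hn', smul_smul, mul_neg, hsq]
          simp
    have := key x
    have hsq : (-1 : ℂ) ^ j.val * (-1) ^ j.val = 1 := by rw [← mul_pow]; simp
    rw [hx, smul_smul, hsq] at this
    convert this using 1
    module

end Ext

/-! ### Differentials on the exterior algebra -/

namespace IsDifferential

variable {N : ℕ} {D : Components A Γ N} {G : BicovariantCalculus A Γ}
  {d : Ext D.σ →ₗ[ℂ] Ext D.σ} (hd : IsDifferential D G d)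
include hd

/-- The graded Leibniz rule for arbitrary forms, by additivity. -/
theorem map_mul (α β : Ext D.σ) : d (α * β) = d α * β + Ext.sign D.σ α * d β := by
  induction α using Ext.homogeneous_induction with
  | mem n α hα => rw [hd.d_mul n α hα, Ext.sign_of_mem hα, smul_mul_assoc]
  | add x y hx hy => rw [add_mul, map_add, hx, hy, map_add, map_add, add_mul, add_mul]; abel

theorem sign_d (α : Ext D.σ) : Ext.sign D.σ (d α) = -d (Ext.sign D.σ α) := by
  induction α using Ext.homogeneous_induction with
  | mem n α hα =>
    rw [Ext.sign_of_mem hα, Ext.sign_of_mem (hd.d_degree n α hα), pow_succ, map_smul]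
    simp
  | add x y hx hy => simp only [map_add, hx, hy, neg_add]

/-- The products of `x dy` and homogeneous forms, in terms of the differential. -/
theorem form_smul_d_mul (x y : A) (β : Ext D.σ) :
    Ext.form D.σ (x • G.d y) * β = Ext.scalar D.σ x * d (Ext.scalar D.σ y * β) -
      Ext.scalar D.σ (x * y) * d β := by
  rw [hd.map_mul, hd.d_scalar, Ext.form_smul, Ext.sign_scalar, mul_add, Ext.scalar_mul]
  simp only [mul_assoc]
  abel

theorem d_form_d (y : A) : d (Ext.form D.σ (G.d y)) = 0 := by
  rw [← hd.d_scalar, hd.d_d]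

/-- Since d² = 0, the value on x dy is dx ∧ dy, and the Leibniz rule determines the rest. -/
theorem eq {d' : Ext D.σ →ₗ[ℂ] Ext D.σ} (hd' : IsDifferential D G d') : d' = d := by
  ext α
  induction α using Ext.induction with
  | scalar a => rw [hd.d_scalar, hd'.d_scalar]
  | form ρ =>
    induction ρ using G.form_induction with
    | add ρ ρ' h h' => simp only [map_add, h, h']
    | smul_d x y =>
      rw [Ext.form_smul, hd.map_mul, hd'.map_mul, hd.d_scalar, hd'.d_scalar, hd.d_form_d,
        hd'.d_form_d]
  | mul x y hx hy => rw [hd.map_mul, hd'.map_mul, hx, hy]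
  | add x y hx hy => rw [map_add, map_add, hx, hy]

end IsDifferential

end

section

variable {A : Type*} [Ring A] [HopfAlgebra ℂ A]
variable {Γ : Type*} [AddCommGroup Γ] [Module ℂ Γ] [Module A Γ] [Module Aᵐᵒᵖ Γ]
  [SMulCommClass A Aᵐᵒᵖ Γ] [IsScalarTower ℂ A Γ] [IsScalarTower ℂ Aᵐᵒᵖ Γ]

/-! ### The coproduct of the even subalgebra -/

/-! ### The coaction on the exterior algebra -/

namespace Ext

variable {σ : BalancedTensor A Γ →ₗ[ℂ] BalancedTensor A Γ}

theorem rTensor_form_mulRightTensor (s : A ⊗[ℂ] A) (z : Γ ⊗[ℂ] A) :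
    (form σ).rTensor A (mulRightTensor A Γ s z) =
      (scalar σ).rTensor A s * (form σ).rTensor A z := by
  induction s with
  | zero => simp
  | add x y hx hy => simp only [LinearMap.map_add, LinearMap.add_apply, add_mul, hx, hy]
  | tmul a b =>
    induction z with
    | zero => simp
    | add x y hx hy => simp only [LinearMap.map_add, mul_add, hx, hy]
    | tmul ρ c => simp [form_smul]

theorem rTensor_form_opRightTensor (s : A ⊗[ℂ] A) (z : Γ ⊗[ℂ] A) :
    (form σ).rTensor A (opRightTensor A Γ s z) =
      (form σ).rTensor A z * (scalar σ).rTensor A s := by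
  induction s with
  | zero => simp
  | add x y hx hy => simp only [LinearMap.map_add, LinearMap.add_apply, mul_add, hx, hy]
  | tmul a b =>
    induction z with
    | zero => simp
    | add x y hx hy => simp only [LinearMap.map_add, add_mul, hx, hy]
    | tmul ρ c => simp [form_op_smul]

variable (σ) in
/-- The coaction on `0`-forms. -/
def scalarCoact : A →ₐ[ℂ] Ext σ ⊗[ℂ] A :=
  (Algebra.TensorProduct.map (scalarHom σ) (AlgHom.id ℂ A)).comp (Bialgebra.comulAlgHom ℂ A)

theorem scalarCoact_apply (a : A) :
    scalarCoact σ a = (scalar σ).rTensor A (Coalgebra.comul a) := by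
  change Algebra.TensorProduct.map (scalarHom σ) (AlgHom.id ℂ A) (Coalgebra.comul a) = _
  generalize Coalgebra.comul (R := ℂ) a = t
  induction t with
  | zero => simp
  | add x y hx hy => simp only [map_add, hx, hy]
  | tmul a b => simp

theorem slice_scalarCoact_mul_tmul (g : A →ₗ[ℂ] ℂ) (t : A ⊗[ℂ] A) (x : Ext σ) (b : A) :
    slice (Ext σ) g ((scalar σ).rTensor A t * x ⊗ₜ[ℂ] b) =
      scalar σ (slice A g (t * 1 ⊗ₜ[ℂ] b)) * x := by
  induction t with
  | zero => simp
  | add x y hx hy => simp only [LinearMap.map_add, add_mul, hx, hy]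
  | tmul p q => simp

end Ext

/-- Carries coassociativity along a map that intertwines coactions; used for the inclusions of `A`
and of Γ in the exterior algebra. -/
theorem assoc_rTensor_rTensor {V W : Type*} [AddCommGroup V] [Module ℂ V] [AddCommGroup W]
    [Module ℂ W] {u : V →ₗ[ℂ] W} {cV : V →ₗ[ℂ] V ⊗[ℂ] A} {cW : W →ₗ[ℂ] W ⊗[ℂ] A}
    (hu : ∀ v, cW (u v) = u.rTensor A (cV v)) (t : V ⊗[ℂ] A) :
    TensorProduct.assoc ℂ W A A (cW.rTensor A (u.rTensor A t)) =
      u.rTensor (A ⊗[ℂ] A) (TensorProduct.assoc ℂ V A A (cV.rTensor A t)) := by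
  induction t with
  | zero => simp only [LinearMap.map_zero, LinearEquiv.map_zero]
  | add x y hx hy => simp only [LinearMap.map_add, LinearEquiv.map_add, hx, hy]
  | tmul v a =>
    simp only [LinearMap.rTensor_tmul, hu]
    generalize cV v = z
    induction z with
    | zero => simp
    | add x y hx hy => simp only [LinearMap.map_add, LinearEquiv.map_add, TensorProduct.add_tmul, hx, hy]
    | tmul p q => simp

theorem rTensor_lTensor_apply {V W X Y : Type*} [AddCommGroup V] [Module ℂ V] [AddCommGroup W]
    [Module ℂ W] [AddCommGroup X] [Module ℂ X] [AddCommGroup Y] [Module ℂ Y] (u : V →ₗ[ℂ] W)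
    (g : X →ₗ[ℂ] Y) (t : V ⊗[ℂ] X) :
    u.rTensor Y (g.lTensor V t) = g.lTensor W (u.rTensor X t) := by
  induction t with
  | zero => simp only [LinearMap.map_zero]
  | add x y hx hy => simp only [LinearMap.map_add, hx, hy]
  | tmul v a => simp

theorem slice_rTensor {V W X : Type*} [AddCommGroup V] [Module ℂ V] [AddCommGroup W]
    [Module ℂ W] [AddCommGroup X] [Module ℂ X] (u : V →ₗ[ℂ] W) (g : X →ₗ[ℂ] ℂ) (t : V ⊗[ℂ] X) :
    slice W g (u.rTensor X t) = u (slice V g t) := by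
  induction t with
  | zero => simp only [LinearMap.map_zero]
  | add x y hx hy => simp only [LinearMap.map_add, hx, hy]
  | tmul v a => simp

namespace Components.IsFor

variable {N : ℕ} {D : Components A Γ N} {G : BicovariantCalculus A Γ}
  {ω : Module.Basis (Fin N) ℂ G.leftInvariants} (h : D.IsFor G ω)

include h

/-- The element ∑ a_{ij} ω_i ⊗ ω_j is fixed by σ exactly because its array of coordinates is fixed
by the braiding matrix. -/
theorem sum_form_form {a : Fin N → Fin N → A}
    (ha : ∀ k l, ∑ i, ∑ j, D.s k l i j • a i j = a k l) :
    ∑ i, ∑ j, Ext.scalar D.σ (a i j) * (Ext.form D.σ (ω i : Γ) * Ext.form D.σ (ω j : Γ)) = 0 := by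
  have hw : D.σ ((balancedRel A Γ).mkQ (∑ i, ∑ j, (a i j • (ω i : Γ)) ⊗ₜ[ℂ] (ω j : Γ))) =
      (balancedRel A Γ).mkQ (∑ i, ∑ j, (a i j • (ω i : Γ)) ⊗ₜ[ℂ] (ω j : Γ)) := by
    have e : (balancedRel A Γ).mkQ (∑ i, ∑ j, (a i j • (ω i : Γ)) ⊗ₜ[ℂ] (ω j : Γ)) =
        ∑ i, ∑ j, btmul A (a i j • (ω i : Γ)) (ω j : Γ) := by
      simp only [map_sum]
      rfl
    rw [e]
    apply G.eq_of_pairCoord ω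
    intro k l
    rw [h.pairCoord_σ]
    simpa [G.pairCoord_smul_basis] using ha k l
  rw [← Ext.mul_form_form_eq_zero D.σ hw]
  simp [Ext.form_smul, mul_assoc]

/-- A criterion for the universal property of the exterior algebra. -/
theorem mul_map_eq_zero {B : Type*} [Ring B] [Algebra ℂ B] {α : A →ₐ[ℂ] B} {φ : Γ →ₗ[ℂ] B}
    (hl : ∀ a ρ, φ (a • ρ) = α a * φ ρ) (hr : ∀ a ρ, φ (op a • ρ) = φ ρ * α a)
    (hφ : ∀ a : Fin N → Fin N → A, (∀ k l, ∑ i, ∑ j, D.s k l i j • a i j = a k l) →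
      ∑ i, ∑ j, α (a i j) * (φ (ω i : Γ) * φ (ω j : Γ)) = 0)
    (t : Γ ⊗[ℂ] Γ) (ht : D.σ ((balancedRel A Γ).mkQ t) = (balancedRel A Γ).mkQ t) :
    LinearMap.mul' ℂ B (TensorProduct.map φ φ t) = 0 := by
  let T : BalancedTensor A Γ →ₗ[ℂ] B := (balancedRel A Γ).liftQ
    (LinearMap.mul' ℂ B ∘ₗ TensorProduct.map φ φ) (by
      rw [balancedRel, Submodule.span_le]
      rintro _ ⟨a, ρ, ρ', rfl⟩
      simp [hl, hr, mul_assoc])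
  have hT : ∀ ρ ρ', T (btmul A ρ ρ') = φ ρ * φ ρ' := fun ρ ρ' => by
    simp [T, btmul]
  change T ((balancedRel A Γ).mkQ t) = 0
  rw [← G.sum_pairCoord ω ((balancedRel A Γ).mkQ t)]
  simp only [map_sum, hT, hl, mul_assoc]
  refine hφ _ fun k l => ?_
  rw [← h.pairCoord_σ, ht]

/-- After slicing by g, the coefficient of ω_m ω_n is the slice of Δ(a_{ij})(1 ⊗ J_{mi} J_{nj}). By
`s_J_J` the braiding passes through the entries of `J` and is absorbed by a, so the new array is
fixed too. -/
theorem coact_relations (a : Fin N → Fin N → A)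
    (ha : ∀ k l, ∑ i, ∑ j, D.s k l i j • a i j = a k l) :
    ∑ i, ∑ j, Ext.scalarCoact D.σ (a i j) *
      ((Ext.form D.σ).rTensor A (G.coactR (ω i : Γ)) *
        (Ext.form D.σ).rTensor A (G.coactR (ω j : Γ))) = 0 := by
  apply eq_of_slice
  intro g
  have h1 : ∀ i j, (Ext.form D.σ).rTensor A (G.coactR (ω i : Γ)) *
      (Ext.form D.σ).rTensor A (G.coactR (ω j : Γ)) =
      ∑ m, ∑ n, (Ext.form D.σ (ω m : Γ) * Ext.form D.σ (ω n : Γ)) ⊗ₜ[ℂ] (D.J m i * D.J n j) := by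
    intro i j
    simp [h.J_spec, Finset.sum_mul_sum]
  simp only [h1, Finset.mul_sum, map_sum, Ext.scalarCoact_apply, map_zero,
    Ext.slice_scalarCoact_mul_tmul]
  rw [sum_comm_pairs]
  simp only [← Finset.sum_mul, ← map_sum]
  refine h.sum_form_form fun k l => ?_
  simp only [← map_smul, ← map_sum]
  congr 1
  rw [show (∑ i, ∑ j, D.s k l i j • ∑ m, ∑ n, Coalgebra.comul (R := ℂ) (a m n) *
      1 ⊗ₜ[ℂ] (D.J i m * D.J j n)) = ∑ m, ∑ n, Coalgebra.comul (R := ℂ) (a m n) *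
      1 ⊗ₜ[ℂ] (∑ i, ∑ j, D.s k l i j • (D.J i m * D.J j n)) by
    simp only [Finset.smul_sum]
    rw [sum_comm_pairs]
    simp only [TensorProduct.tmul_sum, Finset.mul_sum, TensorProduct.tmul_smul, mul_smul_comm]]
  simp only [h.isFrame.s_J_J]
  simp only [TensorProduct.tmul_sum, Finset.mul_sum, TensorProduct.tmul_smul, mul_smul_comm]
  rw [sum_comm_pairs]
  simp only [← smul_mul_assoc, ← Finset.sum_mul, ← map_smul, ← map_sum, ha]

/-- The right coaction on the exterior algebra. -/
def coact : Ext D.σ →ₐ[ℂ] Ext D.σ ⊗[ℂ] A :=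
  Ext.lift (α := Ext.scalarCoact D.σ) (φ := (Ext.form D.σ).rTensor A ∘ₗ G.coactR)
    (fun a ρ => by
      rw [LinearMap.comp_apply, G.coactR_smul, Ext.rTensor_form_mulRightTensor,
        Ext.scalarCoact_apply, LinearMap.comp_apply])
    (fun a ρ => by
      rw [LinearMap.comp_apply, G.coactR_op_smul, Ext.rTensor_form_opRightTensor,
        Ext.scalarCoact_apply, LinearMap.comp_apply])
    (h.mul_map_eq_zero
      (fun a ρ => by
        rw [LinearMap.comp_apply, G.coactR_smul, Ext.rTensor_form_mulRightTensor,
          Ext.scalarCoact_apply, LinearMap.comp_apply])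
      (fun a ρ => by
        rw [LinearMap.comp_apply, G.coactR_op_smul, Ext.rTensor_form_opRightTensor,
          Ext.scalarCoact_apply, LinearMap.comp_apply])
      h.coact_relations)

theorem coact_scalar (a : A) :
    h.coact (Ext.scalar D.σ a) = (Ext.scalar D.σ).rTensor A (Coalgebra.comul a) :=
  (Ext.lift_scalar _ _ _ a).trans (Ext.scalarCoact_apply a)

theorem coact_form (ρ : Γ) :
    h.coact (Ext.form D.σ ρ) = (Ext.form D.σ).rTensor A (G.coactR ρ) :=
  Ext.lift_form _ _ _ ρ

/-- Both sides are algebra homomorphisms, so functions and one-forms suffice. -/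
theorem coact_coassoc (x : Ext D.σ) :
    TensorProduct.assoc ℂ (Ext D.σ) A A (h.coact.toLinearMap.rTensor A (h.coact x)) =
      Coalgebra.comul.lTensor (Ext D.σ) (h.coact x) := by
  have key : ((Algebra.TensorProduct.assoc ℂ ℂ ℂ (Ext D.σ) A A).toAlgHom.comp
      ((Algebra.TensorProduct.map h.coact (AlgHom.id ℂ A)).comp h.coact)) =
      (Algebra.TensorProduct.map (AlgHom.id ℂ (Ext D.σ)) (Bialgebra.comulAlgHom ℂ A)).comp
        h.coact := by
    apply Ext.hom_ext
    · intro a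
      change TensorProduct.assoc ℂ (Ext D.σ) A A (h.coact.toLinearMap.rTensor A
        (h.coact (Ext.scalar D.σ a))) = Coalgebra.comul.lTensor (Ext D.σ)
        (h.coact (Ext.scalar D.σ a))
      rw [h.coact_scalar, assoc_rTensor_rTensor (u := Ext.scalar D.σ)
        (cV := Coalgebra.comul) h.coact_scalar, Coalgebra.coassoc_apply,
        rTensor_lTensor_apply]
    · intro ρ
      change TensorProduct.assoc ℂ (Ext D.σ) A A (h.coact.toLinearMap.rTensor A
        (h.coact (Ext.form D.σ ρ))) = Coalgebra.comul.lTensor (Ext D.σ)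
        (h.coact (Ext.form D.σ ρ))
      have h1 := LinearMap.congr_fun G.coactR_coassoc ρ
      simp only [LinearMap.comp_apply, LinearEquiv.coe_coe] at h1
      rw [h.coact_form, assoc_rTensor_rTensor (u := Ext.form D.σ)
        (cV := G.coactR) h.coact_form, h1,
        rTensor_lTensor_apply]
  exact DFunLike.congr_fun key x

theorem slice_counit_coact (x : Ext D.σ) :
    slice (Ext D.σ) Coalgebra.counit (h.coact x) = x := by
  have key : ((Algebra.TensorProduct.rid ℂ ℂ (Ext D.σ)).toAlgHom.comp
      ((Algebra.TensorProduct.map (AlgHom.id ℂ (Ext D.σ)) (Bialgebra.counitAlgHom ℂ A)).comp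
        h.coact)) = AlgHom.id ℂ _ := by
    apply Ext.hom_ext
    · intro a
      change slice (Ext D.σ) Coalgebra.counit (h.coact (Ext.scalar D.σ a)) = Ext.scalar D.σ a
      rw [h.coact_scalar, slice_rTensor]
      change Ext.scalar D.σ (leftAct (1 : DualAlg A) a) = _
      rw [leftAct_one]
    · intro ρ
      change slice (Ext D.σ) Coalgebra.counit (h.coact (Ext.form D.σ ρ)) = Ext.form D.σ ρ
      rw [h.coact_form, slice_rTensor]
      exact congrArg _ (G.coactR_counit ρ)
  exact DFunLike.congr_fun key x

theorem coact_sign (x : Ext D.σ) :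
    h.coact (Ext.sign D.σ x) = (Ext.sign D.σ).toLinearMap.rTensor A (h.coact x) := by
  have key : h.coact.comp (Ext.sign D.σ) =
      (Algebra.TensorProduct.map (Ext.sign D.σ) (AlgHom.id ℂ A)).comp h.coact := by
    apply Ext.hom_ext
    · intro a
      change h.coact (Ext.sign D.σ (Ext.scalar D.σ a)) =
        (Ext.sign D.σ).toLinearMap.rTensor A (h.coact (Ext.scalar D.σ a))
      rw [Ext.sign_scalar, h.coact_scalar, ← LinearMap.rTensor_comp_apply]
      congr 2
      ext a
      simp
    · intro ρ
      change h.coact (Ext.sign D.σ (Ext.form D.σ ρ)) =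
        (Ext.sign D.σ).toLinearMap.rTensor A (h.coact (Ext.form D.σ ρ))
      rw [Ext.sign_form, map_neg, h.coact_form, ← LinearMap.rTensor_comp_apply,
        ← LinearMap.neg_apply, ← LinearMap.rTensor_neg]
      congr 2
      ext a
      simp
  exact DFunLike.congr_fun key x

/-- Both d and d ⊗ id obey the graded Leibniz rule and agree on functions. On x dy the term with
d(dy) vanishes on both sides. -/
theorem coact_d {d : Ext D.σ →ₗ[ℂ] Ext D.σ} (hd : IsDifferential D G d) (x : Ext D.σ) :
    h.coact (d x) = d.rTensor A (h.coact x) := by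
  have leibniz : ∀ s t : Ext D.σ ⊗[ℂ] A, d.rTensor A (s * t) =
      d.rTensor A s * t + (Ext.sign D.σ).toLinearMap.rTensor A s * d.rTensor A t := by
    intro s t
    induction s with
    | zero => simp
    | add x y hx hy => simp only [LinearMap.map_add, add_mul, hx, hy]; abel
    | tmul a b =>
      induction t with
      | zero => simp
      | add x y hx hy => simp only [LinearMap.map_add, mul_add, hx, hy]; abel
      | tmul p q => simp [hd.map_mul, TensorProduct.add_tmul]
  have hs : ∀ t : A ⊗[ℂ] A, d.rTensor A ((Ext.scalar D.σ).rTensor A t) =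
      (Ext.form D.σ).rTensor A (G.d.rTensor A t) := by
    intro t
    rw [← LinearMap.rTensor_comp_apply, ← LinearMap.rTensor_comp_apply]
    congr 2
    ext a
    exact hd.d_scalar a
  have hf : ∀ y, d.rTensor A (h.coact (Ext.form D.σ (G.d y))) = 0 := by
    intro y
    have h0 : d ∘ₗ Ext.form D.σ ∘ₗ G.d = 0 := LinearMap.ext hd.d_form_d
    rw [h.coact_form, G.coactR_d, ← LinearMap.rTensor_comp_apply, ← LinearMap.rTensor_comp_apply,
      LinearMap.comp_assoc, h0, LinearMap.rTensor_zero, LinearMap.zero_apply]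
  induction x using Ext.induction with
  | scalar a => rw [hd.d_scalar, h.coact_scalar, h.coact_form, G.coactR_d, hs]
  | form ρ =>
    induction ρ using G.form_induction with
    | add ρ ρ' h h' => simp only [map_add, h, h']
    | smul_d x y =>
      rw [Ext.form_smul, hd.map_mul, hd.d_form_d, mul_zero, add_zero, hd.d_scalar, map_mul,
        map_mul, leibniz, hf, mul_zero, add_zero, h.coact_form, h.coact_scalar, hs, G.coactR_d]
  | mul x y hx hy =>
    rw [hd.map_mul, map_add, map_mul, map_mul, map_mul, hx, hy, leibniz, h.coact_sign]
  | add x y hx hy => simp only [map_add, hx, hy]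

end Components.IsFor

end

section

variable {A : Type*} [Ring A] [HopfAlgebra ℂ A]
variable {Γ : Type*} [AddCommGroup Γ] [Module ℂ Γ] [Module A Γ] [Module Aᵐᵒᵖ Γ]
  [SMulCommClass A Aᵐᵒᵖ Γ] [IsScalarTower ℂ A Γ] [IsScalarTower ℂ Aᵐᵒᵖ Γ]

/-! ### The coproduct of the even subalgebra -/

/-! ### The action of functionals and the inner derivatives on the exterior algebra -/

/-- Slicing by a convolution product is slicing twice after a coproduct in the second leg; with
coassociativity this makes the action of functionals multiplicative. -/
theorem slice_counit_lTensor_comul {V : Type*} [AddCommGroup V] [Module ℂ V] (f g : DualAlg A)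
    (t : V ⊗[ℂ] A) : slice V (f * g).ofConv t =
      slice V f.ofConv (slice (V ⊗[ℂ] A) g.ofConv
        ((TensorProduct.assoc ℂ V A A).symm (Coalgebra.comul.lTensor V t))) := by
  induction t with
  | zero => simp only [LinearMap.map_zero, LinearEquiv.map_zero]
  | add x y hx hy => simp only [LinearMap.map_add, LinearEquiv.map_add, hx, hy]
  | tmul v a =>
    simp only [slice_tmul, LinearMap.lTensor_tmul, dual_mul_apply]
    generalize Coalgebra.comul (R := ℂ) a = z
    induction z with
    | zero => simp
    | add x y hx hy => simp only [LinearMap.map_add, LinearEquiv.map_add, TensorProduct.tmul_add, add_smul, hx, hy]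
    | tmul p q => simp [smul_smul, mul_comm]

namespace Components.IsFor

variable {N : ℕ} {D : Components A Γ N} {G : BicovariantCalculus A Γ}
  {ω : Module.Basis (Fin N) ℂ G.leftInvariants} (h : D.IsFor G ω)

include h

/-- The action of functionals on the exterior algebra. -/
def act (g : DualAlg A) : Ext D.σ →ₗ[ℂ] Ext D.σ :=
  slice (Ext D.σ) g.ofConv ∘ₗ h.coact.toLinearMap

theorem act_apply (g : DualAlg A) (x : Ext D.σ) :
    h.act g x = slice (Ext D.σ) g.ofConv (h.coact x) := rfl

theorem act_one (x : Ext D.σ) : h.act 1 x = x := h.slice_counit_coact x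

theorem act_mul (f g : DualAlg A) (x : Ext D.σ) : h.act (f * g) x = h.act f (h.act g x) := by
  rw [act_apply, slice_counit_lTensor_comul, ← h.coact_coassoc, LinearEquiv.symm_apply_apply,
    slice_rTensor]
  rfl

/-- The action of functionals as a homomorphism of algebras. -/
def actHom : DualAlg A →ₐ[ℂ] Module.End ℂ (Ext D.σ) where
  toFun := h.act
  map_one' := LinearMap.ext h.act_one
  map_mul' f g := LinearMap.ext (h.act_mul f g)
  map_zero' := by
    ext x
    rw [act_apply]
    generalize h.coact x = z
    induction z with
    | zero => simp only [LinearMap.map_zero, LinearMap.zero_apply]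
    | add x y hx hy => simp only [LinearMap.map_add, hx, hy]; simp
    | tmul x a => simp
  map_add' f g := by
    ext x
    rw [LinearMap.add_apply, act_apply, act_apply, act_apply]
    generalize h.coact x = z
    induction z with
    | zero => simp
    | add x y hx hy => simp only [LinearMap.map_add, hx, hy]; abel
    | tmul x a => simp [add_smul]
  commutes' c := by
    ext x
    rw [act_apply, Module.algebraMap_end_apply]
    conv_rhs => rw [← h.slice_counit_coact x]
    generalize h.coact x = z
    induction z with
    | zero => simp
    | add x y hx hy => simp only [LinearMap.map_add, smul_add, hx, hy]
    | tmul x a => simp [Algebra.algebraMap_eq_smul_one, smul_smul]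

@[simp] theorem actHom_apply (g : DualAlg A) : h.actHom g = h.act g := rfl

theorem act_scalar (g : DualAlg A) (a : A) :
    h.act g (Ext.scalar D.σ a) = Ext.scalar D.σ (leftAct g a) := by
  rw [act_apply, h.coact_scalar, slice_rTensor, leftAct_eq_slice]

theorem act_form (g : DualAlg A) (ρ : Γ) :
    h.act g (Ext.form D.σ ρ) = Ext.form D.σ (slice Γ g.ofConv (G.coactR ρ)) := by
  rw [act_apply, h.coact_form, slice_rTensor]

theorem act_form_basis (g : DualAlg A) (i : Fin N) :
    h.act g (Ext.form D.σ (ω i : Γ)) = ∑ j, g.ofConv (D.J j i) • Ext.form D.σ (ω j : Γ) := by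
  rw [h.act_form, h.J_spec]
  simp

theorem act_d {d : Ext D.σ →ₗ[ℂ] Ext D.σ} (hd : IsDifferential D G d) (g : DualAlg A)
    (x : Ext D.σ) : h.act g (d x) = d (h.act g x) := by
  rw [act_apply, h.coact_d hd, slice_rTensor, act_apply]

theorem act_sign (g : DualAlg A) (x : Ext D.σ) :
    h.act g (Ext.sign D.σ x) = Ext.sign D.σ (h.act g x) := by
  rw [act_apply, h.coact_sign, slice_rTensor, act_apply, AlgHom.toLinearMap_apply]

theorem act_f_mul (i j : Fin N) (x y : Ext D.σ) :
    h.act (D.f i j) (x * y) = ∑ k, h.act (D.f i k) x * h.act (D.f k j) y := by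
  simp only [act_apply, map_mul]
  generalize h.coact x = s
  generalize h.coact y = t
  induction s with
  | zero => simp
  | add x y hx hy => simp only [LinearMap.map_add, add_mul, Finset.sum_add_distrib, hx, hy]
  | tmul a b =>
    induction t with
    | zero => simp
    | add x y hx hy => simp only [LinearMap.map_add, mul_add, Finset.sum_add_distrib, hx, hy]
    | tmul p q =>
      simp only [Algebra.TensorProduct.tmul_mul_tmul, slice_tmul, h.isFrame.f_mul,
        smul_mul_smul_comm, Finset.sum_smul]

theorem act_f_one (i j : Fin N) :
    h.act (D.f i j) 1 = if i = j then 1 else 0 := by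
  rw [act_apply, map_one, Algebra.TensorProduct.one_def, slice_tmul, h.isFrame.f_one]
  split_ifs <;> simp

theorem act_X_mul (j : Fin N) (x y : Ext D.σ) :
    h.act (D.X j) (x * y) =
      x * h.act (D.X j) y + ∑ k, h.act (D.X k) x * h.act (D.f k j) y := by
  have h1 : x * h.act (D.X j) y = h.act 1 x * h.act (D.X j) y := by rw [h.act_one]
  rw [h1]
  simp only [act_apply, map_mul]
  generalize h.coact x = s
  generalize h.coact y = t
  induction s with
  | zero => simp
  | add x y hx hy => simp only [LinearMap.map_add, add_mul, Finset.sum_add_distrib, hx, hy]; abel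
  | tmul a b =>
    induction t with
    | zero => simp
    | add x y hx hy => simp only [LinearMap.map_add, mul_add, Finset.sum_add_distrib, hx, hy]; abel
    | tmul p q =>
      simp only [Algebra.TensorProduct.tmul_mul_tmul, slice_tmul, h.isFrame.X_mul,
        smul_mul_smul_comm, Finset.sum_smul, add_smul, dual_one_apply]

theorem act_f_mem {n : ℕ} {x : Ext D.σ} (hx : x ∈ Ext.degree D.σ n) (i j : Fin N) :
    h.act (D.f i j) x ∈ Ext.degree D.σ n := by
  refine Ext.degree_induction (p := fun n x => ∀ i j, h.act (D.f i j) x ∈ Ext.degree D.σ n)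
    (fun a i j => ?_) (fun n ρ x _ ih i j => ?_) (fun n x y hx hy i j => ?_) n hx i j
  · rw [h.act_scalar]
    exact Ext.scalar_mem _
  · rw [h.act_f_mul]
    refine sum_mem fun k _ => ?_
    rw [h.act_form]
    exact Ext.form_mul_mem _ (ih k j)
  · rw [map_add]
    exact add_mem (hx i j) (hy i j)

/-! ### Inner derivatives as entries of a matrix representation -/

/-- The matrices that describe `0`-forms in the construction of the inner derivatives. -/
def innerScalar : A →ₐ[ℂ] Matrix (Option (Fin N)) (Option (Fin N)) (Ext D.σ) :=
  AlgHom.ofLinearMap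
    { toFun := fun a => Matrix.of fun p q => match p, q with
        | none, none => Ext.scalar D.σ a
        | some j, some k => h.act (D.f j k) (Ext.scalar D.σ a)
        | _, _ => 0
      map_add' := fun a b => by
        ext p q
        rcases p with _ | p <;> rcases q with _ | q <;> simp
      map_smul' := fun c a => by
        ext p q
        rcases p with _ | p <;> rcases q with _ | q <;> simp }
    (by
      ext p q
      rcases p with _ | p <;> rcases q with _ | q <;>
        simp [Ext.scalar_one, h.act_f_one, Matrix.one_apply])
    (fun a b => by
      ext p q
      rcases p with _ | p <;> rcases q with _ | q <;>
        simp [Ext.scalar_mul, h.act_f_mul, Matrix.mul_apply, Fintype.sum_option])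

/-- The matrices that describe `1`-forms in the construction of the inner derivatives. -/
def innerForm : Γ →ₗ[ℂ] Matrix (Option (Fin N)) (Option (Fin N)) (Ext D.σ) where
  toFun := fun ρ => Matrix.of fun p q => match p, q with
    -- The index `none` carries the sign automorphism and the indices `some j` carry the f's. The
    -- row `none` then contains the inner derivatives, and the matrix product is their twisted
    -- Leibniz rule.
    | none, none => -Ext.form D.σ ρ
    | none, some k => Ext.scalar D.σ (G.formCoord ω k ρ)
    | some _, none => 0
    | some j, some k => h.act (D.f j k) (Ext.form D.σ ρ)
  map_add' ρ ρ' := by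
    ext p q
    rcases p with _ | p <;> rcases q with _ | q <;> simp [add_comm]
  map_smul' c ρ := by
    ext p q
    rcases p with _ | p <;> rcases q with _ | q <;> simp

theorem innerForm_smul (a : A) (ρ : Γ) :
    h.innerForm (a • ρ) = h.innerScalar a * h.innerForm ρ := by
  ext p q
  rcases p with _ | p <;> rcases q with _ | q <;>
    simp [innerForm, innerScalar, Matrix.mul_apply, Fintype.sum_option, Ext.form_smul,
      G.formCoord_smul, Ext.scalar_mul, h.act_f_mul]

theorem innerForm_op_smul (a : A) (ρ : Γ) :
    h.innerForm (op a • ρ) = h.innerForm ρ * h.innerScalar a := by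
  ext p q
  rcases p with _ | p <;> rcases q with _ | q <;>
    simp [innerForm, innerScalar, Matrix.mul_apply, Fintype.sum_option, Ext.form_op_smul,
      h.isFrame.formCoord_op_smul, Ext.scalar_mul, h.act_f_mul, h.act_scalar]

/-- The diagonal blocks are the relation itself and its image under f_{pq}. The mixed entry is
i_q(ω_i ω_j) = σ^{mq}_{ij} ω_m - δ_{qj} ω_i, and its two terms cancel against a fixed array. -/
theorem inner_relations (a : Fin N → Fin N → A)
    (ha : ∀ k l, ∑ i, ∑ j, D.s k l i j • a i j = a k l) :
    ∑ i, ∑ j, h.innerScalar (a i j) * (h.innerForm (ω i : Γ) * h.innerForm (ω j : Γ)) = 0 := by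
  have hff := h.sum_form_form ha
  ext p q
  simp only [Matrix.sum_apply, Matrix.zero_apply]
  rcases p with _ | p <;> rcases q with _ | q
  · simpa [innerForm, innerScalar, Matrix.mul_apply, Fintype.sum_option] using hff
  · have h1 : ∀ i j, (h.innerScalar (a i j) *
        (h.innerForm (ω i : Γ) * h.innerForm (ω j : Γ))) none (some q) =
        ∑ m, Ext.scalar D.σ (D.s m q i j • a i j) * Ext.form D.σ (ω m : Γ) -
          if q = j then Ext.scalar D.σ (a i j) * Ext.form D.σ (ω i : Γ) else 0 := by
      intro i j
      simp [innerForm, innerScalar, Matrix.mul_apply, Fintype.sum_option, G.formCoord_basis,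
        apply_ite (Ext.scalar D.σ), Ext.scalar_one, h.act_form_basis, h.isFrame.s_spec,
        Finset.mul_sum, mul_add]
      split_ifs <;> simp [add_comm, sub_eq_add_neg]
    have h2 : ∑ i, ∑ j, ∑ m, Ext.scalar D.σ (D.s m q i j • a i j) * Ext.form D.σ (ω m : Γ) =
        ∑ m, Ext.scalar D.σ (a m q) * Ext.form D.σ (ω m : Γ) := by
      rw [Finset.sum_congr rfl fun i _ => Finset.sum_comm, Finset.sum_comm]
      simp only [← Finset.sum_mul, ← map_sum, ha]
    simp only [h1, Finset.sum_sub_distrib, h2]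
    simp
  · simp [innerForm, innerScalar, Matrix.mul_apply, Fintype.sum_option]
  · have h1 := congrArg (h.act (D.f p q)) hff
    simpa [innerForm, innerScalar, Matrix.mul_apply, Fintype.sum_option, h.act_f_mul] using h1

/-- The homomorphism with components the sign, the inner derivatives and the `f_{jk}`. -/
def innerHom : Ext D.σ →ₐ[ℂ] Matrix (Option (Fin N)) (Option (Fin N)) (Ext D.σ) :=
  Ext.lift h.innerForm_smul h.innerForm_op_smul
    (h.mul_map_eq_zero h.innerForm_smul h.innerForm_op_smul h.inner_relations)

theorem innerHom_scalar (a : A) : h.innerHom (Ext.scalar D.σ a) = h.innerScalar a :=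
  Ext.lift_scalar _ _ _ a

theorem innerHom_form (ρ : Γ) : h.innerHom (Ext.form D.σ ρ) = h.innerForm ρ :=
  Ext.lift_form _ _ _ ρ

theorem innerHom_some_none (j : Fin N) (x : Ext D.σ) : h.innerHom x (some j) none = 0 := by
  induction x using Ext.induction generalizing j with
  | scalar a => rw [innerHom_scalar]; rfl
  | form ρ => rw [innerHom_form]; rfl
  | mul x y hx hy => simp [Matrix.mul_apply, Fintype.sum_option, hx, hy]
  | add x y hx hy => simp [hx, hy]

theorem innerHom_none_none (x : Ext D.σ) : h.innerHom x none none = Ext.sign D.σ x := by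
  induction x using Ext.induction with
  | scalar a => rw [innerHom_scalar, Ext.sign_scalar]; rfl
  | form ρ => rw [innerHom_form, Ext.sign_form]; rfl
  | mul x y hx hy =>
    simp [Matrix.mul_apply, Fintype.sum_option, hx, hy, h.innerHom_some_none]
  | add x y hx hy => simp [hx, hy]

theorem innerHom_some_some (j k : Fin N) (x : Ext D.σ) :
    h.innerHom x (some j) (some k) = h.act (D.f j k) x := by
  induction x using Ext.induction generalizing j k with
  | scalar a => rw [innerHom_scalar]; rfl
  | form ρ => rw [innerHom_form]; rfl
  | mul x y hx hy =>
    simp [Matrix.mul_apply, Fintype.sum_option, hx, hy, h.innerHom_some_none, h.act_f_mul]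
  | add x y hx hy => simp [hx, hy]

/-- The left inner derivatives. -/
def inner (k : Fin N) : Ext D.σ →ₗ[ℂ] Ext D.σ where
  toFun x := h.innerHom x none (some k)
  map_add' x y := by simp
  map_smul' c x := by simp

theorem inner_scalar (k : Fin N) (a : A) : h.inner k (Ext.scalar D.σ a) = 0 := by
  change h.innerHom _ _ _ = _
  rw [innerHom_scalar]; rfl

theorem inner_form (k : Fin N) (ρ : Γ) :
    h.inner k (Ext.form D.σ ρ) = Ext.scalar D.σ (G.formCoord ω k ρ) := by
  change h.innerHom _ _ _ = _
  rw [innerHom_form]; rfl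

theorem inner_mul (k : Fin N) (x y : Ext D.σ) : h.inner k (x * y) =
    Ext.sign D.σ x * h.inner k y + ∑ j, h.inner j x * h.act (D.f j k) y := by
  change h.innerHom _ _ _ = _
  simp only [map_mul, Matrix.mul_apply, Fintype.sum_option, h.innerHom_none_none,
    h.innerHom_some_some]
  rfl

theorem inner_mem (k : Fin N) {n : ℕ} {x : Ext D.σ} (hx : x ∈ Ext.degree D.σ (n + 1)) :
    h.inner k x ∈ Ext.degree D.σ n := by
  -- Splits off a one-form. The first alternative covers a remaining form of degree 0, which the
  -- inner derivative kills and for which there is no degree below.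
  have key : ∀ (k : Fin N) (ρ : Γ) {m : ℕ} {y : Ext D.σ}, y ∈ Ext.degree D.σ m →
      h.inner k y = 0 ∨ (∃ n, m = n + 1 ∧ h.inner k y ∈ Ext.degree D.σ n) →
      h.inner k (Ext.form D.σ ρ * y) ∈ Ext.degree D.σ m := by
    intro k ρ m y hy hk
    rw [h.inner_mul]
    refine add_mem ?_ (sum_mem fun j _ => ?_)
    · rw [Ext.sign_form, neg_mul]
      refine neg_mem ?_
      rcases hk with hk | ⟨n, rfl, hk⟩
      · rw [hk, mul_zero]
        exact zero_mem _
      · exact Ext.form_mul_mem ρ hk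
    · rw [h.inner_form]
      exact Ext.scalar_mul_mem _ (h.act_f_mem hy j k)
  induction n generalizing x k with
  | zero =>
    rw [Ext.degree_succ] at hx
    induction hx using Submodule.mul_induction_on' with
    | add x _ y _ hx hy => rw [map_add]; exact add_mem hx hy
    | mem_mul_mem m hm y hy =>
      obtain ⟨ρ, rfl⟩ := hm
      refine key k ρ hy (.inl ?_)
      rw [Ext.degree_zero] at hy
      obtain ⟨a, rfl⟩ := hy
      exact h.inner_scalar k a
  | succ n ih =>
    rw [Ext.degree_succ] at hx
    induction hx using Submodule.mul_induction_on' with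
    | add x _ y _ hx hy => rw [map_add]; exact add_mem hx hy
    | mem_mul_mem m hm y hy =>
      obtain ⟨ρ, rfl⟩ := hm
      exact key k ρ hy (.inr ⟨n, rfl, ih k hy⟩)

theorem sign_inner (k : Fin N) (x : Ext D.σ) :
    Ext.sign D.σ (h.inner k x) = -h.inner k (Ext.sign D.σ x) := by
  induction x using Ext.induction generalizing k with
  | scalar a => simp [h.inner_scalar]
  | form ρ => simp [h.inner_form]
  | mul x y hx hy =>
    simp [h.inner_mul, hx, hy, h.act_sign, Finset.sum_neg_distrib, add_comm]
  | add x y hx hy => simp only [map_add, hx, hy, neg_add]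

end Components.IsFor

end

section

variable {A : Type*} [Ring A] [HopfAlgebra ℂ A]
variable {Γ : Type*} [AddCommGroup Γ] [Module ℂ Γ] [Module A Γ] [Module Aᵐᵒᵖ Γ]
  [SMulCommClass A Aᵐᵒᵖ Γ] [IsScalarTower ℂ A Γ] [IsScalarTower ℂ Aᵐᵒᵖ Γ]

/-! ### The coproduct of the even subalgebra -/

/-! ### Uniqueness of the coaction and of the inner derivatives -/

namespace Components.IsFor

variable {N : ℕ} {D : Components A Γ N} {G : BicovariantCalculus A Γ}
  {ω : Module.Basis (Fin N) ℂ G.leftInvariants} (h : D.IsFor G ω)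

/-- The right coaction and the left inner derivatives of the exterior algebra. -/
def ops : CartanOps D where
  coact := h.coact.toLinearMap
  inner := h.inner

include h

variable {d : Ext D.σ →ₗ[ℂ] Ext D.σ} (hd : IsDifferential D G d)
include hd

theorem ops_isFor : h.ops.IsFor G ω d where
  coact_scalar := h.coact_scalar
  coact_mul_d x α := by
    change h.coact _ = _ * d.rTensor A (h.coact α)
    rw [map_mul, h.coact_scalar, h.coact_d hd]
  inner_zero k α hα := by
    rw [Ext.degree_zero] at hα
    obtain ⟨a, rfl⟩ := hα
    exact h.inner_scalar k a
  inner_degree k n α hα := h.inner_mem k hα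
  inner_basis k j := by
    refine (h.inner_form k _).trans ?_
    rw [G.formCoord_basis]
    split_ifs <;> simp [Ext.scalar_one]
  inner_mul k n α hα β := by
    refine (h.inner_mul k α β).trans ?_
    rw [Ext.sign_of_mem hα, smul_mul_assoc]
    rfl

/-- By x dy β = x d(yβ) - xy dβ every form of degree n + 1 is a sum of terms x dα with α of degree
n, where the coaction is prescribed. -/
theorem ops_coact_eq {O : CartanOps D} (hO : O.IsFor G ω d) : O.coact = h.ops.coact := by
  have hO' := h.ops_isFor hd
  have key : ∀ n, ∀ x ∈ Ext.degree D.σ n, O.coact x = h.ops.coact x := by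
    intro n
    induction n with
    | zero =>
      intro x hx
      rw [Ext.degree_zero] at hx
      obtain ⟨a, rfl⟩ := hx
      rw [hO.coact_scalar, hO'.coact_scalar]
    | succ n ih =>
      intro x hx
      rw [Ext.degree_succ] at hx
      induction hx using Submodule.mul_induction_on' with
      | add x _ y _ hx hy => rw [map_add, map_add, hx, hy]
      | mem_mul_mem m hm β hβ =>
        obtain ⟨ρ, rfl⟩ := hm
        induction ρ using G.form_induction with
        | add ρ ρ' h1 h2 => rw [map_add, add_mul, map_add, map_add, h1, h2]
        | smul_d x y =>
          rw [hd.form_smul_d_mul, map_sub, map_sub, hO.coact_mul_d, hO.coact_mul_d,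
            hO'.coact_mul_d, hO'.coact_mul_d, ih _ hβ, ih _ (Ext.scalar_mul_mem y hβ)]
  ext x
  induction x using Ext.homogeneous_induction with
  | mem n x hx => exact key n x hx
  | add x y hx hy => rw [map_add, map_add, hx, hy]

/-- Once the coaction is known, so are the f's acting on forms. The twisted Leibniz rule then
determines the inner derivatives from their values on functions and on the ω_j. -/
theorem ops_eq {O : CartanOps D} (hO : O.IsFor G ω d) : O = h.ops := by
  have hc := h.ops_coact_eq hd hO
  have hact : ∀ g, O.act g = h.act g := fun g => by
    rw [CartanOps.act, hc]
    rfl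
  have hform : ∀ k ρ, O.inner k (Ext.form D.σ ρ) = h.inner k (Ext.form D.σ ρ) := by
    intro k ρ
    rw [h.inner_form]
    conv_lhs => rw [← G.sum_formCoord_smul ω ρ]
    simp only [map_sum, Ext.form_smul, hO.inner_mul k 0 _ (Ext.scalar_mem _),
      hO.inner_zero _ _ (Ext.scalar_mem _), hO.inner_basis]
    simp
  have hi : O.inner = h.inner := by
    funext k
    ext x
    induction x using Ext.homogeneous_induction with
    | add x y hx hy => rw [map_add, map_add, hx, hy]
    | mem n x hx =>
      refine Ext.degree_induction (p := fun _ x => ∀ k, O.inner k x = h.inner k x)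
        (fun a k => ?_) (fun n ρ x _ ih k => ?_) (fun n x y hx hy k => ?_) n hx k
      · rw [hO.inner_zero k _ (Ext.scalar_mem a), h.inner_scalar]
      · rw [hO.inner_mul k 1 _ (Ext.form_mem ρ), h.inner_mul, Ext.sign_form, ih]
        simp only [hform, hact]
        simp
      · rw [map_add, map_add, hx, hy]
  obtain ⟨c, i⟩ := O
  change c = _ at hc
  change i = _ at hi
  rw [hc, hi]
  rfl

end Components.IsFor

/-! ### The representation of the quantum Cartan algebra on the exterior algebra -/

theorem CartanOperators.RelAt.map {N : ℕ} {M M' : Type*} [AddCommGroup M] [Module ℂ M]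
    [AddCommGroup M'] [Module ℂ M'] {P : CartanOperators N M} {Q : CartanOperators N M'}
    {D : Components A Γ N} {u : M →ₗ[ℂ] M'} (hX : ∀ i v, u (P.X i v) = Q.X i (u v))
    (hf : ∀ i j v, u (P.f i j v) = Q.f i j (u v)) (hxi : ∀ i v, u (P.xi i v) = Q.xi i (u v))
    (hdel : ∀ v, u (P.del v) = Q.del (u v)) {v : M} (hv : P.RelAt D v) : Q.RelAt D (u v) where
  xi_xi a ha := by simpa [hxi] using congrArg u (hv.xi_xi a ha)
  xi_del i := by simpa [hX, hxi, hdel] using congrArg u (hv.xi_del i)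
  del_del := by simpa [hdel] using congrArg u hv.del_del
  xi_f i j k := by simpa [hxi, hf] using congrArg u (hv.xi_f i j k)
  xi_X i j := by simpa [hxi, hX] using congrArg u (hv.xi_X i j)
  f_del i j := by simpa [hdel, hf] using congrArg u (hv.f_del i j)
  X_del i := by simpa [hdel, hX] using congrArg u (hv.X_del i)

namespace Components.IsFor

variable {N : ℕ} {D : Components A Γ N} {G : BicovariantCalculus A Γ}
  {ω : Module.Basis (Fin N) ℂ G.leftInvariants} (h : D.IsFor G ω)

/-- The Lie derivatives, the `f_{ij}`, the inner derivatives and the differential. -/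
def operators (d : Ext D.σ →ₗ[ℂ] Ext D.σ) : CartanOperators N (Ext D.σ) where
  X i := h.act (D.X i)
  f i j := h.act (D.f i j)
  xi i := h.inner i
  del := d
  sgn := (Ext.sign D.σ).toLinearMap

variable {d : Ext D.σ →ₗ[ℂ] Ext D.σ} (hd : IsDifferential D G d)

include h in
theorem act_eq_of_eq {f g : DualAlg A} (e : f = g) (v : Ext D.σ) :
    h.actHom f v = h.actHom g v := by rw [e]

include hd

theorem operators_isEven : (h.operators d).IsEven D where
  f_f n m p q v := by
    have e := h.act_eq_of_eq (h.isFrame.quadraticRelations.f_f n m p q) v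
    simp only [map_sum, map_smul, map_mul, LinearMap.sum_apply, LinearMap.smul_apply,
      Module.End.mul_apply] at e
    exact e
  f_X i j k v := by
    have e := h.act_eq_of_eq (h.isFrame.quadraticRelations.f_X i j k) v
    simp only [map_add, map_sum, map_smul, map_mul, LinearMap.add_apply, LinearMap.sum_apply,
      LinearMap.smul_apply, Module.End.mul_apply] at e
    exact e
  sgn_sgn v := Ext.sign_sign v
  sgn_X i v := (h.act_sign _ v).symm
  sgn_f i j v := (h.act_sign _ v).symm
  sgn_xi i v := h.sign_inner i v
  sgn_del v := hd.sign_d v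

theorem relAt_scalar (a : A) : (h.operators d).RelAt D (Ext.scalar D.σ a) where
  xi_xi b _ := by simp [operators, h.inner_scalar]
  xi_del i := by
    simp [operators, h.inner_scalar, hd.d_scalar, h.inner_form, h.isFrame.formCoord_d,
      h.act_scalar]
  del_del := hd.d_d _
  xi_f i j k := by simp [operators, h.inner_scalar, h.act_scalar]
  xi_X i j := by simp [operators, h.inner_scalar, h.act_scalar]
  f_del i j := h.act_d hd _ _
  X_del i := h.act_d hd _ _

/-- The inner derivative of dy is X_i ▷ y, so the relations ξ-f and ξ-X at dy are the relations X-f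
and X-X acting on y. -/
theorem relAt_form_d (y : A) : (h.operators d).RelAt D (Ext.form D.σ (G.d y)) where
  xi_xi b _ := by simp [operators, h.inner_scalar, h.inner_form]
  xi_del i := by
    simp only [operators, hd.d_form_d, map_zero, zero_add, h.inner_form, h.isFrame.formCoord_d]
    rw [← hd.d_scalar y, h.act_d hd, h.act_scalar]
  del_del := hd.d_d _
  xi_f i j k := by
    have e := congrArg (fun g => leftActHom g y) (h.isFrame.quadraticRelations.X_f i k j)
    simp only [map_mul, map_sum, map_smul, LinearMap.sum_apply, LinearMap.smul_apply,
      Module.End.mul_apply, leftActHom_apply] at e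
    simp only [operators, h.inner_form, h.isFrame.formCoord_d, h.act_scalar]
    rw [← hd.d_scalar y, h.act_d hd, h.act_scalar, hd.d_scalar, h.inner_form,
      h.isFrame.formCoord_d, e]
    simp only [map_sum, map_smul]
  xi_X i j := by
    have e := congrArg (fun g => leftActHom g y) (h.isFrame.quadraticRelations.X_X i j)
    simp only [map_sub, map_mul, map_sum, map_smul, LinearMap.sum_apply, LinearMap.smul_apply,
      LinearMap.sub_apply, Module.End.mul_apply, leftActHom_apply, sub_eq_iff_eq_add] at e
    simp only [operators, h.inner_form, h.isFrame.formCoord_d, h.act_scalar]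
    rw [← hd.d_scalar y, h.act_d hd, h.act_scalar, hd.d_scalar, h.inner_form,
      h.isFrame.formCoord_d, e, add_comm]
    simp only [map_add, map_sum, map_smul]
  f_del i j := h.act_d hd _ _
  X_del i := h.act_d hd _ _

/-- The Leibniz rules of the operators say that multiplication intertwines the tensor operators with
the original ones, so `RelAt.tmul` can be pushed forward along it. -/
theorem relAt_mul {x y : Ext D.σ} (hx : (h.operators d).RelAt D x)
    (hy : (h.operators d).RelAt D y) : (h.operators d).RelAt D (x * y) := by
  have key := hx.tmul (h.operators_isEven hd) hy
  refine CartanOperators.RelAt.map (u := LinearMap.mul' ℂ (Ext D.σ)) (Q := h.operators d)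
    (fun i t => ?_) (fun i j t => ?_) (fun i t => ?_) (fun t => ?_) key
  all_goals
    induction t with
    | zero => simp
    | add x y hx hy => simp only [map_add, hx, hy]
    | tmul x y => ?_
  · simp [CartanOperators.tensor_X_tmul, operators, h.act_X_mul]
  · simp [CartanOperators.tensor_f_tmul, operators, h.act_f_mul]
  · simp [CartanOperators.tensor_xi_tmul, operators, h.inner_mul]
  · simp [CartanOperators.tensor_del_tmul, operators, hd.map_mul, add_comm]

theorem relAt (x : Ext D.σ) : (h.operators d).RelAt D x := by
  induction x using Ext.induction with
  | scalar a => exact h.relAt_scalar hd a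
  | form ρ =>
    induction ρ using G.form_induction with
    | add ρ ρ' h1 h2 => rw [map_add]; exact h1.add h2
    | smul_d x y =>
      rw [Ext.form_smul]
      exact h.relAt_mul hd (h.relAt_scalar hd x) (h.relAt_form_d hd y)
  | mul x y hx hy => exact h.relAt_mul hd hx hy
  | add x y hx hy => exact hx.add hy

omit hd in
theorem operators_eval_evenIncl (p : FreeAlgebra ℂ (EvenGen N)) :
    (h.operators d).eval (evenIncl N p) = h.actHom (D.evenEval p) := by
  have e : (h.operators d).eval.comp (evenIncl N) = h.actHom.comp D.evenEval := by
    apply FreeAlgebra.hom_ext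
    funext g
    rcases g with i | ⟨i, j⟩
    · have : evenIncl N (FreeAlgebra.ι ℂ (.X i)) = gX i := FreeAlgebra.lift_ι_apply _ _
      simp [this]
      rfl
    · have : evenIncl N (FreeAlgebra.ι ℂ (.f i j)) = gf i j := FreeAlgebra.lift_ι_apply _ _
      simp [this]
      rfl
  exact DFunLike.congr_fun e p

/-- The left Cartan calculus on the exterior algebra. -/
def cartanRep : D.CartanAlg →ₐ[ℂ] Module.End ℂ (Ext D.σ) :=
  CartanOperators.lift (P := h.operators d)
    (fun p q hpq => by rw [h.operators_eval_evenIncl, h.operators_eval_evenIncl, hpq])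
    (h.relAt hd)

theorem cartanRep_isCartanRep : h.ops.IsCartanRep d (h.cartanRep hd) where
  map_X j := CartanOperators.lift_cX _ _ j
  map_f j k := CartanOperators.lift_cf _ _ j k
  map_xi j := CartanOperators.lift_cxi _ _ j
  map_del := CartanOperators.lift_cdel _ _

end Components.IsFor

theorem CartanOps.IsCartanRep.eq {N : ℕ} {D : Components A Γ N} {O : CartanOps D}
    {d : Ext D.σ →ₗ[ℂ] Ext D.σ} {lam lam' : D.CartanAlg →ₐ[ℂ] Module.End ℂ (Ext D.σ)}
    (hl : O.IsCartanRep d lam) (hl' : O.IsCartanRep d lam') : lam = lam' :=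
  D.cartan_hom_ext (fun i => (hl.map_X i).trans (hl'.map_X i).symm)
    (fun i j => (hl.map_f i j).trans (hl'.map_f i j).symm)
    (fun i => (hl.map_xi i).trans (hl'.map_xi i).symm) (hl.map_del.trans hl'.map_del.symm)

end

section

variable {A : Type*} [Ring A] [HopfAlgebra ℂ A]
variable {Γ : Type*} [AddCommGroup Γ] [Module ℂ Γ] [Module A Γ] [Module Aᵐᵒᵖ Γ]
  [SMulCommClass A Aᵐᵒᵖ Γ] [IsScalarTower ℂ A Γ] [IsScalarTower ℂ Aᵐᵒᵖ Γ]

/-! ### The coproduct of the even subalgebra -/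

/-! ### The module algebra structure -/

theorem koszulSign_apply {B : Type*} [Ring B] [Algebra ℂ B] (γ : B →ₐ[ℂ] B)
    (hγ : ∀ x, γ (γ x) = x) (n : ℕ) (x : B) :
    letI := parityGradedAlgebra γ hγ
    koszulSign (parityGrading γ) n x =
      (1 / 2 : ℂ) • (x + γ x) + (-1 : ℂ) ^ n • (1 / 2 : ℂ) • (x - γ x) := by
  let _ := parityGradedAlgebra γ hγ
  have h0 : (1 / 2 : ℂ) • (x + γ x) ∈ parityGrading γ 0 := (evenPart γ hγ x).2
  have h1 : (1 / 2 : ℂ) • (x - γ x) ∈ parityGrading γ 1 := (oddPart γ hγ x).2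
  have hv : (1 : ZMod 2).val = 1 := rfl
  have hx : x = (1 / 2 : ℂ) • (x + γ x) + (1 / 2 : ℂ) • (x - γ x) := by module
  have p0 : GradedAlgebra.proj (parityGrading γ) 0 x = (1 / 2 : ℂ) • (x + γ x) := by
    conv_lhs => rw [hx]
    rw [map_add, GradedAlgebra.proj_apply, GradedAlgebra.proj_apply,
      DirectSum.decompose_of_mem_same _ h0, DirectSum.decompose_of_mem_ne _ h1 (by decide),
      add_zero]
  have p1 : GradedAlgebra.proj (parityGrading γ) 1 x = (1 / 2 : ℂ) • (x - γ x) := by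
    conv_lhs => rw [hx]
    rw [map_add, GradedAlgebra.proj_apply, GradedAlgebra.proj_apply,
      DirectSum.decompose_of_mem_same _ h1, DirectSum.decompose_of_mem_ne _ h0 (by decide),
      zero_add]
  have hs : ∀ F : ZMod 2 → B, ∑ i, F i = F 0 + F 1 := fun F => Fin.sum_univ_two F
  rw [koszulSign, LinearMap.sum_apply, hs]
  simp only [LinearMap.smul_apply, p0, p1, ZMod.val_zero, hv, mul_zero, mul_one, pow_zero,
    one_smul]

namespace Components

variable {N : ℕ} (D : Components A Γ N) (n : ℕ)

theorem cartan_koszulSign_apply (x : D.CartanAlg) : koszulSign D.grading n x =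
    (1 / 2 : ℂ) • (x + D.parity x) + (-1 : ℂ) ^ n • (1 / 2 : ℂ) • (x - D.parity x) :=
  koszulSign_apply D.parity D.parity_parity n x

theorem koszulSign_one : koszulSign D.grading n 1 = 1 := by
  rw [cartan_koszulSign_apply, map_one, sub_self, smul_zero, smul_zero, add_zero]
  module

variable {D} {g : D.CartanAlg}

theorem koszulSign_mul_of_even (hg : D.parity g = g) (x : D.CartanAlg) :
    koszulSign D.grading n (g * x) = g * koszulSign D.grading n x := by
  rw [cartan_koszulSign_apply, cartan_koszulSign_apply, map_mul, hg]
  simp only [mul_add, mul_sub, mul_smul_comm]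

theorem koszulSign_mul_of_odd (hg : D.parity g = -g) (x : D.CartanAlg) :
    koszulSign D.grading n (g * x) = (-1 : ℂ) ^ n • (g * koszulSign D.grading n x) := by
  have hsq : (-1 : ℂ) ^ n * (-1) ^ n = 1 := by rw [← mul_pow]; simp
  rw [cartan_koszulSign_apply, cartan_koszulSign_apply, map_mul, hg, mul_add,
    mul_smul_comm, mul_smul_comm, mul_smul_comm, smul_add ((-1 : ℂ) ^ n),
    smul_smul ((-1 : ℂ) ^ n) ((-1 : ℂ) ^ n), hsq, mul_add, mul_sub, neg_mul]
  module

namespace IsCartanHopf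

variable {H : SuperHopf D.grading} (hH : D.IsCartanHopf H)
include hH

omit hH in
theorem of_comul (x : D.CartanAlg) :
    GradedTensorProduct.of ℂ D.grading D.grading (H.comul x) = H.comulHom x :=
  LinearEquiv.apply_symm_apply _ _

theorem comul_cX_mul (i : Fin N) (x : D.CartanAlg) :
    H.comul (D.cX i * x) = D.cartanOps.tensor.X i (H.comul x) := by
  apply (GradedTensorProduct.of ℂ D.grading D.grading).injective
  rw [of_tensor_X, ← hH.comul_X, of_comul, of_comul, of_comul, map_mul]

theorem comul_cf_mul (i j : Fin N) (x : D.CartanAlg) :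
    H.comul (D.cf i j * x) = D.cartanOps.tensor.f i j (H.comul x) := by
  apply (GradedTensorProduct.of ℂ D.grading D.grading).injective
  rw [of_tensor_f, ← hH.comul_f, of_comul, of_comul, of_comul, map_mul]

theorem comul_cxi_mul (i : Fin N) (x : D.CartanAlg) :
    H.comul (D.cxi i * x) = D.cartanOps.tensor.xi i (H.comul x) := by
  apply (GradedTensorProduct.of ℂ D.grading D.grading).injective
  rw [of_tensor_xi, ← hH.comul_xi, of_comul, of_comul, of_comul, map_mul]

theorem comul_cdel_mul (x : D.CartanAlg) :
    H.comul (D.cdel * x) = D.cartanOps.tensor.del (H.comul x) := by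
  apply (GradedTensorProduct.of ℂ D.grading D.grading).injective
  rw [of_tensor_del, ← hH.comul_del, of_comul, of_comul, of_comul, map_mul]

omit hH in
theorem comul_one : H.comul 1 = 1 ⊗ₜ 1 := by
  apply (GradedTensorProduct.of ℂ D.grading D.grading).injective
  rw [of_comul, map_one]
  rfl

end IsCartanHopf

namespace IsFor

variable {G : BicovariantCalculus A Γ}
  {ω : Module.Basis (Fin N) ℂ G.leftInvariants} (h : D.IsFor G ω)
  {d : Ext D.σ →ₗ[ℂ] Ext D.σ} (hd : IsDifferential D G d)
  {lam : D.CartanAlg →ₐ[ℂ] Module.End ℂ (Ext D.σ)} (hlam : h.ops.IsCartanRep d lam)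

include hd hlam

/-- Evenness of the representation, phrased with the sign automorphisms so that no element has to be
homogeneous. -/
theorem sign_rep (x : D.CartanAlg) (α : Ext D.σ) :
    lam (D.parity x) (Ext.sign D.σ α) = Ext.sign D.σ (lam x α) := by
  have hX : ∀ i, lam (D.cX i) = h.act (D.X i) := hlam.map_X
  have hf : ∀ i j, lam (D.cf i j) = h.act (D.f i j) := hlam.map_f
  have hxi : ∀ i, lam (D.cxi i) = h.inner i := hlam.map_xi
  induction x using D.cartan_induction_left with
  | one => simp
  | add x y hx hy => simp only [map_add, LinearMap.add_apply, hx, hy]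
  | smul c x hx => simp only [map_smul, LinearMap.smul_apply, hx]
  | cX i x hx => simp [hX, hx, h.act_sign]
  | cf i j x hx => simp [hf, hx, h.act_sign]
  | cxi i x hx => simp [hxi, hx, h.sign_inner]
  | cdel x hx => simp [hlam.map_del, hx, hd.sign_d]

/-- Induction over left multiplication by generators: for each generator the identity is its own
Leibniz rule. -/
theorem rep_mul {H : SuperHopf D.grading} (hH : D.IsCartanHopf H) (n : ℕ) (x : D.CartanAlg)
    {α : Ext D.σ} (hα : α ∈ Ext.degree D.σ n) (β : Ext D.σ) :
    lam x (α * β) = LinearMap.mul' ℂ (Ext D.σ) (TensorProduct.map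
      (LinearMap.applyₗ α ∘ₗ lam.toLinearMap)
      (LinearMap.applyₗ β ∘ₗ lam.toLinearMap ∘ₗ koszulSign D.grading n) (H.comul x)) := by
  have hX : ∀ i, lam (D.cX i) = h.act (D.X i) := hlam.map_X
  have hf : ∀ i j, lam (D.cf i j) = h.act (D.f i j) := hlam.map_f
  have hxi : ∀ i, lam (D.cxi i) = h.inner i := hlam.map_xi
  -- An odd generator that passes λ_a(α) sees the sign (-1)^{|a| + n}: the part from a comes from
  -- the graded coproduct, the part from n from the Koszul sign.
  have hsgn : ∀ a, (-1 : ℂ) ^ n • lam (D.parity a) α = Ext.sign D.σ (lam a α) := by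
    intro a
    rw [← h.sign_rep hd hlam, Ext.sign_of_mem hα, map_smul]
  induction x using D.cartan_induction_left with
  | one => simp [IsCartanHopf.comul_one, koszulSign_one]
  | add x y hx hy => simp only [map_add, LinearMap.add_apply, hx, hy]
  | smul c x hx => simp only [map_smul, LinearMap.smul_apply, hx]
  | cX i x hx =>
    rw [map_mul lam, Module.End.mul_apply, hx, hH.comul_cX_mul, hX]
    generalize H.comul x = t
    induction t with
    | zero => simp
    | add x y hx hy => simp only [map_add, hx, hy]
    | tmul a b =>
      simp [CartanOperators.tensor_X_tmul, cartanOps, koszulSign_mul_of_even, hX, hf, h.act_X_mul]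
  | cf i j x hx =>
    rw [map_mul lam, Module.End.mul_apply, hx, hH.comul_cf_mul, hf]
    generalize H.comul x = t
    induction t with
    | zero => simp
    | add x y hx hy => simp only [map_add, hx, hy]
    | tmul a b =>
      simp [CartanOperators.tensor_f_tmul, cartanOps, koszulSign_mul_of_even, hf, h.act_f_mul]
  | cxi i x hx =>
    rw [map_mul lam, Module.End.mul_apply, hx, hH.comul_cxi_mul, hxi]
    generalize H.comul x = t
    induction t with
    | zero => simp
    | add x y hx hy => simp only [map_add, hx, hy]
    | tmul a b =>
      simp [CartanOperators.tensor_xi_tmul, cartanOps, koszulSign_mul_of_even,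
        koszulSign_mul_of_odd, hxi, hf, h.inner_mul, ← hsgn]
  | cdel x hx =>
    rw [map_mul lam, Module.End.mul_apply, hx, hH.comul_cdel_mul, hlam.map_del]
    generalize H.comul x = t
    induction t with
    | zero => simp
    | add x y hx hy => simp only [map_add, hx, hy]
    | tmul a b =>
      simp [CartanOperators.tensor_del_tmul, cartanOps,
        koszulSign_mul_of_odd, hlam.map_del, hd.map_mul, ← hsgn, add_comm]

theorem rep_one {H : SuperHopf D.grading} (hH : D.IsCartanHopf H) (x : D.CartanAlg) :
    lam x 1 = H.counit x • (1 : Ext D.σ) := by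
  have hX : ∀ i, lam (D.cX i) = h.act (D.X i) := hlam.map_X
  have hf : ∀ i j, lam (D.cf i j) = h.act (D.f i j) := hlam.map_f
  have hxi : ∀ i, lam (D.cxi i) = h.inner i := hlam.map_xi
  have h1 : ∀ i, h.act (D.X i) 1 = 0 := fun i => by
    rw [act_apply, map_one, Algebra.TensorProduct.one_def, slice_tmul, h.isFrame.X_one, zero_smul]
  have h2 : ∀ i, h.inner i 1 = 0 := fun i => by
    rw [← Ext.scalar_one, h.inner_scalar]
  have h3 : d 1 = 0 := by
    rw [← Ext.scalar_one, hd.d_scalar, G.d_one, map_zero]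
  induction x using D.cartan_induction_left with
  | one => simp
  | add x y hx hy => simp only [map_add, LinearMap.add_apply, hx, hy, add_smul]
  | smul c x hx => simp only [map_smul, LinearMap.smul_apply, hx, smul_assoc]
  | cX i x hx => simp [hX, hx, h1, hH.counit_X]
  | cf i j x hx => simp [hf, hx, h.act_f_one, hH.counit_f]
  | cxi i x hx => simp [hxi, hx, h2, hH.counit_xi]
  | cdel x hx => simp [hlam.map_del, hx, h3, hH.counit_del]

theorem isModuleAlgebra {H : SuperHopf D.grading} (hH : D.IsCartanHopf H) :
    IsModuleAlgebra H (Ext.degree D.σ) lam where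
  even i x hx j α hα := by
    rw [Ext.mem_parityPart] at hα ⊢
    have hx' : D.parity x = (-1 : ℂ) ^ i.val • x := mem_parityGrading.1 hx
    have e := h.sign_rep hd hlam x α
    rw [hx', hα, map_smul, map_smul, LinearMap.smul_apply, smul_smul] at e
    rw [← e, ZMod.val_add, ← neg_one_pow_eq_pow_mod_two, pow_add, mul_comm]
  map_mul x n α hα β := h.rep_mul hd hlam hH n x hα β
  map_one x := h.rep_one hd hlam hH x

end IsFor

end Components

end

end

end QCartan

theorem theorem3p1 {A : Type*} [Ring A] [HopfAlgebra ℂ A]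
    (hS : Function.Bijective (HopfAlgebra.antipode ℂ : A →ₗ[ℂ] A))
    {Γ : Type*} [AddCommGroup Γ] [Module ℂ Γ] [Module A Γ] [Module Aᵐᵒᵖ Γ]
    [SMulCommClass A Aᵐᵒᵖ Γ] [IsScalarTower ℂ A Γ] [IsScalarTower ℂ Aᵐᵒᵖ Γ]
    (G : QCartan.BicovariantCalculus A Γ) {N : ℕ}
    (ω : Module.Basis (Fin N) ℂ G.leftInvariants) :
    (∃! D : QCartan.Components A Γ N, D.IsFor G ω) ∧
    ∀ D : QCartan.Components A Γ N, D.IsFor G ω →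
      D.QuadraticRelations ∧
      (D.SCompatible →
        (∃! H : QCartan.SuperHopf D.grading, D.IsCartanHopf H) ∧
        ∀ d : QCartan.Ext D.σ →ₗ[ℂ] QCartan.Ext D.σ, QCartan.IsDifferential D G d →
          (∀ d' : QCartan.Ext D.σ →ₗ[ℂ] QCartan.Ext D.σ, QCartan.IsDifferential D G d' → d' = d) ∧
          (∃! O : QCartan.CartanOps D, O.IsFor G ω d) ∧
          ∀ O : QCartan.CartanOps D, O.IsFor G ω d →
            (∃! lam : D.CartanAlg →ₐ[ℂ] Module.End ℂ (QCartan.Ext D.σ), O.IsCartanRep d lam) ∧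
            ∀ (H : QCartan.SuperHopf D.grading)
              (lam : D.CartanAlg →ₐ[ℂ] Module.End ℂ (QCartan.Ext D.σ)),
              D.IsCartanHopf H → O.IsCartanRep d lam →
                QCartan.IsModuleAlgebra H (QCartan.Ext.degree D.σ) lam) := by
  refine ⟨⟨QCartan.Components.ofCalculus G ω, QCartan.Components.ofCalculus_isFor G ω,
    fun D hD => hD.eq (QCartan.Components.ofCalculus_isFor G ω)⟩, fun D h =>
    ⟨h.isFrame.quadraticRelations, fun hC => ⟨h.isFrame.existsUnique_cartanHopf hC,
      fun d hd => ⟨fun d' hd' => hd.eq hd', ⟨h.ops, h.ops_isFor hd, fun O hO => h.ops_eq hd hO⟩,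
        fun O hO => ?_⟩⟩⟩⟩
  -- Uniqueness replaces arbitrary operators by the constructed ones.
  rw [h.ops_eq hd hO]
  exact ⟨⟨h.cartanRep hd, h.cartanRep_isCartanRep hd, fun lam hlam =>
    hlam.eq (h.cartanRep_isCartanRep hd)⟩,
    fun H lam hH hlam => h.isModuleAlgebra hd hlam hH⟩
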